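/- **Setting.** $N\ge 2$ agents $x_i(k+1)=Ax_i(k)+Bu_i(k)$, $A\in\mathbb R^{n\times n}$, $B\in\mathbb R^{n\times m}$, $n\ge1$, $(A,B)$ controllable, communicate over a directed graph with weights $a_{ij}\ge 0$ that contains a spanning tree; $\mathcal L$ is its Laplacian, with eigenvalues $\lambda_1=0,\lambda_2,\dots,\lambda_N$. Let $Q\succeq0$, $\gamma>0$, $\mu\ge1$. Let $P\succeq 0$ solve the Riccati equation $$P=Q+\mu^2A^TPA-\mu^4A^TPB(\gamma I+\mu^2B^TPB)^{-1}B^TPA,$$ let $H=\begin{bmatrix}H_{11}&H_{12}\\H_{12}^T&H_{22}\end{bmatrix}=\begin{bmatrix}Q+\mu^2A^TPA&\mu^2A^TPB\\ \mu^2B^TPA&\gamma I+\mu^2B^TPB\end{bmatrix}$ be the matrix of the associated Q-function, so that $P=H_{11}-H_{12}H_{22}^{-1}H_{12}^T$, and let $K=H_{22}^{-1}H_{12}^T$. Assume that there is a $c>0$ with $$P-(\mu A-\mu c\lambda_iBK)^*P(\mu A-\mu c\lambda_iBK)\succ0,\qquad i=2,\dots,N. \tag{L}$$ Put $$\mathcal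 S(\beta,s,\lambda)=\begin{bmatrix}Q+s\gamma|\lambda|^2H_{12}H_{22}^{-2}H_{12}^T&\beta H_{12}\\ \beta H_{12}^T&H_{22}\end{bmatrix},\qquad \mathcal N(\beta,c,\lambda)=\begin{bmatrix}\beta-\sigma&\tau\\ \tau&\beta+\sigma\end{bmatrix},$$ with $\sigma=\sqrt{1-(\mathrm{Re}\lambda)^2/|\lambda|^2}$ and $\tau=|\lambda|^{-1}(c|\lambda|^2-\mathrm{Re}\lambda)$. The non-convex problem is to maximize $\alpha$ over $(\alpha,\beta,c)\in\mathbb R^3$ subject to $\mathcal S(\beta,c^2,\lambda_i)\succeq\alpha I$ and $\mathcal N(\beta,c,\lambda_i)\succeq0$ for $i=2,\dots,N$. The subproblem at $c_0\in\mathbb R$ is the semidefinite program obtained by replacing $c^2$ with its linearization $2c_0c-c_0^2$. The algorithm starts from any $(\alpha^{(0)},\beta^{(0)},c^{(0)})\in\mathbb R^3$, of which only $c^{(0)}$ is used, and takes as $(\alpha^{(k+1)},\beta^{(k+1)},c^{(k+1)})$ an optimal solution (any one, if there are several) of the subproblem at $c^{(k)}$. A stationary point of the non-convex problem is a Karush–Kuhn–Tucker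 point: a feasible point with positive semidefinite multipliers for which complementary slackness holds and the gradient of the Lagrangian vanishes. **Theorem 5.** (0) $(H,P)$ is an optimal solution $(H,W)$ of the semidefinite program: maximize $\operatorname{trace} W$ over symmetric $H\in\mathbb R^{(n+m)\times(n+m)}$ and $W\in\mathbb R^{n\times n}$ subject to $$\begin{bmatrix}H_{11}-W&H_{12}\\H_{12}^T&H_{22}\end{bmatrix}\succeq0,\qquad \begin{bmatrix}\mu^2[A\ B]^TH_{11}[A\ B]-H+\begin{bmatrix}Q&0\\0&\gamma I\end{bmatrix}&\mu[A\ B]^TH_{12}\\ \mu H_{12}^T[A\ B]&H_{22}\end{bmatrix}\succeq0 .$$ Every optimal solution $(H',W')$ satisfies $W'=P$ and $H'\preceq H$. (i) From every initialization the algorithm generates a sequence of iterates: all subproblems have optimal solutions. For every such sequence, $\alpha^{(k)}\le\alpha^{(k+1)}$ for all $k\ge1$, and also for $k=0$ if the initial triple is feasible for the non-convex problem; every iterate with $k\ge1$ is feasible for the non-convex problem; and $\alpha^{(k)}$ converges, so that for every $\epsilon>0$ there is a $k\ge1$ with $|\alpha^{(k+1)}-\alpha^{(k)}|\le\epsilon$.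 (ii) Every limit point (cluster point) of the sequence of iterates is a stationary point of the non-convex problem. If $K\ne0$ and $c^{(0)}\ge0$, then the sequence is bounded, so that limit points exist, and its distance to the set of stationary points tends to $0$. If moreover each limit point $(\alpha^*,\beta^*,c^*)$ is the only optimal solution of the subproblem at $c^*$, then the whole sequence converges to a stationary point. A limit point $(\alpha^*,\beta^*,c^*)$ with $\alpha^*>0$ certifies consensus at rate $\mu$: (L) holds with $c=c^*$, the spectral radius of $A-c^*\lambda_iBK$ is less than $\mu^{-1}$ for $i=2,\dots,N$, and under the control law $u_i=-c^*K\sum_ja_{ij}(x_i-x_j)$ one has $\mu^k\|x_i(k)-x_j(k)\|\to0$ for all $i,j$ and all initial states. -/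

import Mathlib

open Matrix Filter Topology
open scoped ComplexOrder

namespace Consensus

/-! ### The multi-agent system -/

/-- The Laplacian `D - A` of the weighted digraph with adjacency matrix `a`; `a i j` is the weight
of the edge from node `j` to node `i`, and it is `0` when there is no such edge. -/
def laplacian {N : ℕ} (a : Matrix (Fin N) (Fin N) ℝ) : Matrix (Fin N) (Fin N) ℝ :=
  Matrix.diagonal (fun i => ∑ j, a i j) - a

/-- Some node is connected to every other node by a directed path. -/
def HasSpanningTree {N : ℕ} (a : Matrix (Fin N) (Fin N) ℝ) : Prop :=
  ∃ r : Fin N, ∀ i : Fin N, Relation.ReflTransGen (fun j i => 0 < a i j) r i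

/-- `lam` lists the eigenvalues of the real matrix `L` other than one zero eigenvalue, each as often
as its algebraic multiplicity says: `0, lam 0, lam 1, …` are the complex roots of the
characteristic polynomial. -/
def ListsModes {N : ℕ} (L : Matrix (Fin N) (Fin N) ℝ) (lam : Fin (N - 1) → ℂ) : Prop :=
  (0 : ℂ) ::ₘ (Finset.univ.val.map lam) = (L.map Complex.ofReal).charpoly.roots

/-- Controllability: the block matrix `[B, A B, …, A ^ (n - 1) B]` has rank `n`. -/
def Controllable {n m : ℕ} (A : Matrix (Fin n) (Fin n) ℝ) (B : Matrix (Fin n) (Fin m) ℝ) : Prop :=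
  (Matrix.of fun (i : Fin n) (p : Fin n × Fin m) => (A ^ (p.1 : ℕ) * B) i p.2).rank = n

/-- `x k i` is the state of agent `i` at time `k` under the control law
`u_i = - c K ∑_j a_ij (x_i - x_j)`. -/
def IsClosedLoopTrajectory {N n m : ℕ} (a : Matrix (Fin N) (Fin N) ℝ)
    (A : Matrix (Fin n) (Fin n) ℝ) (B : Matrix (Fin n) (Fin m) ℝ) (c : ℝ)
    (K : Matrix (Fin m) (Fin n) ℝ) (x : ℕ → Fin N → Fin n → ℝ) : Prop :=
  ∀ k i, x (k + 1) i = A *ᵥ x k i + B *ᵥ (-(c • (K *ᵥ ∑ j, a i j • (x k i - x k j))))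

/-- Dynamic consensus at rate `μ`: along every closed-loop trajectory the disagreements tend to
zero faster than `μ ^ (-k)`. -/
def ReachesConsensusAtRate {N n m : ℕ} (μ : ℝ) (a : Matrix (Fin N) (Fin N) ℝ)
    (A : Matrix (Fin n) (Fin n) ℝ) (B : Matrix (Fin n) (Fin m) ℝ) (c : ℝ)
    (K : Matrix (Fin m) (Fin n) ℝ) : Prop :=
  ∀ x : ℕ → Fin N → Fin n → ℝ, IsClosedLoopTrajectory a A B c K x →
    ∀ i j, Tendsto (fun k => μ ^ k * ‖x k i - x k j‖) atTop (𝓝 0)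

/-! ### The synthetic LQR problem and its semidefinite program -/

section LQR

variable {n m : ℕ}

/-- `P` is a positive semidefinite solution of the discrete-time algebraic Riccati equation for the
dynamics `(μ A, μ B)` and the weights `Q` and `γ I`. -/
def IsRiccatiSolution (μ : ℝ) (A : Matrix (Fin n) (Fin n) ℝ) (B : Matrix (Fin n) (Fin m) ℝ)
    (Q : Matrix (Fin n) (Fin n) ℝ) (γ : ℝ) (P : Matrix (Fin n) (Fin n) ℝ) : Prop :=
  P.PosSemidef ∧
    P = Q + μ ^ 2 • (Aᵀ * P * A)
      - μ ^ 4 • ((Aᵀ * P * B) * (γ • (1 : Matrix (Fin m) (Fin m) ℝ) + μ ^ 2 • (Bᵀ * P * B))⁻¹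
          * (Bᵀ * P * A))

/-- The matrix of the Q-function that belongs to the value function `x ↦ xᵀ P x`. -/
def qMatrix (μ : ℝ) (A : Matrix (Fin n) (Fin n) ℝ) (B : Matrix (Fin n) (Fin m) ℝ)
    (Q : Matrix (Fin n) (Fin n) ℝ) (γ : ℝ) (P : Matrix (Fin n) (Fin n) ℝ) :
    Matrix (Fin n ⊕ Fin m) (Fin n ⊕ Fin m) ℝ :=
  Matrix.fromBlocks (Q + μ ^ 2 • (Aᵀ * P * A)) (μ ^ 2 • (Aᵀ * P * B))
    (μ ^ 2 • (Bᵀ * P * A)) (γ • 1 + μ ^ 2 • (Bᵀ * P * B))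

/-- The block matrix `𝓜(H, μ, A, B)` of the semidefinite program for `H`. -/
def lmiMatrix (μ : ℝ) (A : Matrix (Fin n) (Fin n) ℝ) (B : Matrix (Fin n) (Fin m) ℝ)
    (Q : Matrix (Fin n) (Fin n) ℝ) (γ : ℝ) (H : Matrix (Fin n ⊕ Fin m) (Fin n ⊕ Fin m) ℝ) :
    Matrix ((Fin n ⊕ Fin m) ⊕ Fin m) ((Fin n ⊕ Fin m) ⊕ Fin m) ℝ :=
  Matrix.fromBlocks
    (μ ^ 2 • ((Matrix.fromCols A B)ᵀ * H.toBlocks₁₁ * Matrix.fromCols A B) - H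
      + Matrix.fromBlocks Q 0 0 (γ • 1))
    (μ • ((Matrix.fromCols A B)ᵀ * H.toBlocks₁₂))
    (μ • (H.toBlocks₁₂ᵀ * Matrix.fromCols A B))
    H.toBlocks₂₂

/-- Feasibility of `(H, W)` for the semidefinite program that maximizes `trace W`. -/
def LQRFeasible (μ : ℝ) (A : Matrix (Fin n) (Fin n) ℝ) (B : Matrix (Fin n) (Fin m) ℝ)
    (Q : Matrix (Fin n) (Fin n) ℝ) (γ : ℝ) (H : Matrix (Fin n ⊕ Fin m) (Fin n ⊕ Fin m) ℝ)
    (W : Matrix (Fin n) (Fin n) ℝ) : Prop :=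
  H.IsSymm ∧
  (Matrix.fromBlocks (H.toBlocks₁₁ - W) H.toBlocks₁₂ H.toBlocks₁₂ᵀ H.toBlocks₂₂).PosSemidef ∧
  (lmiMatrix μ A B Q γ H).PosSemidef

/-- `(H, W)` is an optimal solution of the semidefinite program: feasible, with `trace W`
maximal. -/
def LQROptimal (μ : ℝ) (A : Matrix (Fin n) (Fin n) ℝ) (B : Matrix (Fin n) (Fin m) ℝ)
    (Q : Matrix (Fin n) (Fin n) ℝ) (γ : ℝ) (H : Matrix (Fin n ⊕ Fin m) (Fin n ⊕ Fin m) ℝ)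
    (W : Matrix (Fin n) (Fin n) ℝ) : Prop :=
  LQRFeasible μ A B Q γ H W ∧
    ∀ H' W', LQRFeasible μ A B Q γ H' W' → W'.trace ≤ W.trace

/-- The candidate Lyapunov matrix `H₁₁ - H₁₂ H₂₂⁻¹ H₁₂ᵀ`. -/
noncomputable def lyapMatrix (H : Matrix (Fin n ⊕ Fin m) (Fin n ⊕ Fin m) ℝ) :
    Matrix (Fin n) (Fin n) ℝ :=
  H.toBlocks₁₁ - H.toBlocks₁₂ * H.toBlocks₂₂⁻¹ * H.toBlocks₁₂ᵀ

/-- The feedback gain `H₂₂⁻¹ H₁₂ᵀ`. -/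
noncomputable def gain (H : Matrix (Fin n ⊕ Fin m) (Fin n ⊕ Fin m) ℝ) :
    Matrix (Fin m) (Fin n) ℝ :=
  H.toBlocks₂₂⁻¹ * H.toBlocks₁₂ᵀ

/-- The closed-loop matrix `A - c l B K` of the mode with Laplacian eigenvalue `l`. -/
noncomputable def modeMatrix (A : Matrix (Fin n) (Fin n) ℝ) (B : Matrix (Fin n) (Fin m) ℝ)
    (K : Matrix (Fin m) (Fin n) ℝ) (c : ℝ) (l : ℂ) : Matrix (Fin n) (Fin n) ℂ :=
  A.map Complex.ofReal - ((c : ℂ) * l) • (B * K).map Complex.ofReal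

/-- The modewise Lyapunov inequality `P - (μ A - μ c l B K)* P (μ A - μ c l B K) ≻ 0`. -/
def LyapunovIneq (μ : ℝ) (A : Matrix (Fin n) (Fin n) ℝ) (B : Matrix (Fin n) (Fin m) ℝ)
    (P : Matrix (Fin n) (Fin n) ℝ) (K : Matrix (Fin m) (Fin n) ℝ) (c : ℝ) (l : ℂ) : Prop :=
  (P.map Complex.ofReal
    - ((μ : ℂ) • modeMatrix A B K c l)ᴴ * P.map Complex.ofReal
        * ((μ : ℂ) • modeMatrix A B K c l)).PosDef

end LQR

/-! ### The non-convex problem and its linearizations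

A point `p : ℝ × ℝ × ℝ` stands for the triple `(α, β, c)`: `α = p.1`, `β = p.2.1`, `c = p.2.2`. -/

section Coupling

variable {n m : ℕ} {ι : Type*} [Fintype ι]

/-- The block matrix `[Q + s γ |l|² H₁₂ H₂₂⁻² H₁₂ᵀ, β H₁₂; β H₁₂ᵀ, H₂₂]`, where `s` stands for `c²`
or for its linearization. -/
noncomputable def couplingMatrix (Q : Matrix (Fin n) (Fin n) ℝ) (γ : ℝ)
    (H : Matrix (Fin n ⊕ Fin m) (Fin n ⊕ Fin m) ℝ) (β s : ℝ) (l : ℂ) :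
    Matrix (Fin n ⊕ Fin m) (Fin n ⊕ Fin m) ℝ :=
  Matrix.fromBlocks
    (Q + (s * γ * ‖l‖ ^ 2) •
      (H.toBlocks₁₂ * H.toBlocks₂₂⁻¹ * H.toBlocks₂₂⁻¹ * H.toBlocks₁₂ᵀ))
    (β • H.toBlocks₁₂) (β • H.toBlocks₁₂ᵀ) H.toBlocks₂₂

/-- The matrix `𝓢_q`, with the term `c²`. -/
noncomputable def Sq (Q : Matrix (Fin n) (Fin n) ℝ) (γ : ℝ)
    (H : Matrix (Fin n ⊕ Fin m) (Fin n ⊕ Fin m) ℝ) (β c : ℝ) (l : ℂ) :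
    Matrix (Fin n ⊕ Fin m) (Fin n ⊕ Fin m) ℝ :=
  couplingMatrix Q γ H β (c ^ 2) l

/-- The matrix `𝓢_l`, with `c²` replaced by its linearization `2 c₀ c - c₀²` at `c₀`. -/
noncomputable def Sl (Q : Matrix (Fin n) (Fin n) ℝ) (γ : ℝ)
    (H : Matrix (Fin n ⊕ Fin m) (Fin n ⊕ Fin m) ℝ) (β c c₀ : ℝ) (l : ℂ) :
    Matrix (Fin n ⊕ Fin m) (Fin n ⊕ Fin m) ℝ :=
  couplingMatrix Q γ H β (2 * c₀ * c - c₀ ^ 2) l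

/-- The `2 × 2` matrix `𝓝(β, c, l)`. -/
noncomputable def modeLMI (β c : ℝ) (l : ℂ) : Matrix (Fin 2) (Fin 2) ℝ :=
  !![β - √(1 - l.re ^ 2 / ‖l‖ ^ 2), 1 / ‖l‖ * (c * ‖l‖ ^ 2 - l.re);
     1 / ‖l‖ * (c * ‖l‖ ^ 2 - l.re), β + √(1 - l.re ^ 2 / ‖l‖ ^ 2)]

/-- Feasibility for the non-convex problem: maximize `α` subject to `𝓢_q ⪰ α I` and `𝓝 ⪰ 0` for
every mode. -/
def Feasible (Q : Matrix (Fin n) (Fin n) ℝ) (γ : ℝ)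
    (H : Matrix (Fin n ⊕ Fin m) (Fin n ⊕ Fin m) ℝ) (lam : ι → ℂ) (p : ℝ × ℝ × ℝ) : Prop :=
  ∀ i, (Sq Q γ H p.2.1 p.2.2 (lam i) - p.1 • 1).PosSemidef ∧
    (modeLMI p.2.1 p.2.2 (lam i)).PosSemidef

/-- Feasibility for the convex subproblem linearized at `c₀`. -/
def SubFeasible (Q : Matrix (Fin n) (Fin n) ℝ) (γ : ℝ)
    (H : Matrix (Fin n ⊕ Fin m) (Fin n ⊕ Fin m) ℝ) (lam : ι → ℂ) (c₀ : ℝ)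
    (p : ℝ × ℝ × ℝ) : Prop :=
  ∀ i, (Sl Q γ H p.2.1 p.2.2 c₀ (lam i) - p.1 • 1).PosSemidef ∧
    (modeLMI p.2.1 p.2.2 (lam i)).PosSemidef

/-- Optimal solutions of the convex subproblem linearized at `c₀`. -/
def SubOptimal (Q : Matrix (Fin n) (Fin n) ℝ) (γ : ℝ)
    (H : Matrix (Fin n ⊕ Fin m) (Fin n ⊕ Fin m) ℝ) (lam : ι → ℂ) (c₀ : ℝ)
    (p : ℝ × ℝ × ℝ) : Prop :=
  SubFeasible Q γ H lam c₀ p ∧ ∀ q, SubFeasible Q γ H lam c₀ q → q.1 ≤ p.1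

/-- `x` is a sequence of iterates of the algorithm: `x (k + 1)` is an optimal solution (any one, if
there are several) of the subproblem linearized at the gain of `x k`. The start `x 0` is
arbitrary; only its gain is used. -/
def IsRun (Q : Matrix (Fin n) (Fin n) ℝ) (γ : ℝ)
    (H : Matrix (Fin n ⊕ Fin m) (Fin n ⊕ Fin m) ℝ) (lam : ι → ℂ)
    (x : ℕ → ℝ × ℝ × ℝ) : Prop :=
  ∀ k, SubOptimal Q γ H lam (x k).2.2 (x (k + 1))

/-- The Lagrangian of the non-convex problem, with multipliers `Z i` for `𝓢_q - α I ⪰ 0` and `Y i`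
for `𝓝 ⪰ 0`. -/
noncomputable def lagrangian (Q : Matrix (Fin n) (Fin n) ℝ) (γ : ℝ)
    (H : Matrix (Fin n ⊕ Fin m) (Fin n ⊕ Fin m) ℝ) (lam : ι → ℂ)
    (Z : ι → Matrix (Fin n ⊕ Fin m) (Fin n ⊕ Fin m) ℝ) (Y : ι → Matrix (Fin 2) (Fin 2) ℝ)
    (p : ℝ × ℝ × ℝ) : ℝ :=
  p.1 + ∑ i, (Z i * (Sq Q γ H p.2.1 p.2.2 (lam i) - p.1 • 1)).trace
    + ∑ i, (Y i * modeLMI p.2.1 p.2.2 (lam i)).trace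

/-- Stationary (Karush–Kuhn–Tucker) points of the non-convex problem: feasible, with positive
semidefinite multipliers that satisfy complementary slackness and at which the gradient of the
Lagrangian vanishes. -/
def IsStationaryPoint (Q : Matrix (Fin n) (Fin n) ℝ) (γ : ℝ)
    (H : Matrix (Fin n ⊕ Fin m) (Fin n ⊕ Fin m) ℝ) (lam : ι → ℂ) (p : ℝ × ℝ × ℝ) : Prop :=
  Feasible Q γ H lam p ∧
  ∃ (Z : ι → Matrix (Fin n ⊕ Fin m) (Fin n ⊕ Fin m) ℝ) (Y : ι → Matrix (Fin 2) (Fin 2) ℝ),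
    (∀ i, (Z i).PosSemidef ∧ (Y i).PosSemidef) ∧
    (∀ i, (Z i * (Sq Q γ H p.2.1 p.2.2 (lam i) - p.1 • 1)).trace = 0 ∧
      (Y i * modeLMI p.2.1 p.2.2 (lam i)).trace = 0) ∧
    HasFDerivAt (lagrangian Q γ H lam Z Y) (0 : ℝ × ℝ × ℝ →L[ℝ] ℝ) p

end Coupling

end Consensus

open Consensus

namespace Consensus

/-! ### Real quadratic forms -/

/-! Every matrix inequality is read as an inequality between quadratic forms. Write K for the gain;
then H₁₂ᵀ = H₂₂K.

Semidefinite program: the constraints say that xᵀWx lies below the Q-function of the matrix variable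
and that this Q-function satisfies the Bellman inequality for every next input (`lqrFeasible_iff`).
The Riccati Q-function satisfies it with equality under the feedback -K, so its gap to a feasible
Q-function does not increase along the loop μ(A - BK). The loop is stable: (L) for a single mode
forces Q + γKᵀK ≻ 0, which by the Riccati equation is the Lyapunov inequality with c = λ = 1. Hence
the gap is at least its limit 0 (`qForm_le_qForm_qMatrix`), and minimizing over the input gives W ⪯
P.

Algorithm: 𝓝 ⪰ 0 means |1 - cλ| ≤ β, and 2c₀c - c₀² ≤ c² with equality at c₀; this yields feasible
iterates and monotone values. A limit point solves its own subproblem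
(`IsRun.subOptimal_of_mapClusterPt`). That problem is convex and satisfies Slater's condition, so
multipliers exist; the two Lagrangians differ by a multiple of (c - c*)², so the same multipliers
give stationarity for the non-convex problem.

Boundedness: if the gains were unbounded, dividing the constraint by c² would leave `RecessionIneq`,
which forces α < 0 when K ≠ 0. For α < 0 the same inequality lets every subproblem at a large gain
exceed α strictly. Applied to the limit value this is a contradiction.

Convergence: uniqueness makes consecutive gains approach each other, so the limit points of the
gains fill an interval. If it were nondegenerate, one value of α would be feasible at all gains in
it; varying c then shows that null vectors of the constraint do not see β, so β can be increased,
against uniqueness (`false_of_unique_of_eventually_feasible`).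

Certificate: the Riccati equation turns (L) into Q + c²|λ|²γKᵀK - |1 - cλ|²KᵀH₂₂K ≻ 0, which follows
from the coupling constraint at u = -βKx. Differences to one agent evolve under I ⊗ A - c Lᵣ ⊗ BK,
where the reduced Laplacian Lᵣ has the eigenvalues λ₂, …, λ_N. -/

theorem posSemidef_iff_real {d : Type*} [Fintype d] (M : Matrix d d ℝ) :
    M.PosSemidef ↔ M.IsSymm ∧ ∀ x, 0 ≤ x ⬝ᵥ M *ᵥ x := by
  rw [Matrix.posSemidef_iff_dotProduct_mulVec]
  simp [Matrix.IsHermitian, Matrix.IsSymm]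

theorem posDef_iff_real {d : Type*} [Fintype d] (M : Matrix d d ℝ) :
    M.PosDef ↔ M.IsSymm ∧ ∀ x, x ≠ 0 → 0 < x ⬝ᵥ M *ᵥ x := by
  rw [Matrix.posDef_iff_dotProduct_mulVec]
  simp [Matrix.IsHermitian, Matrix.IsSymm]

theorem eq_zero_of_forall_nonneg {b d : ℝ} (h : ∀ s : ℝ, 0 ≤ s * b + s ^ 2 * d) : b = 0 := by
  by_contra hb
  have hd : 0 < |d| + 1 := by positivity
  have h1 := h (-b / (|d| + 1))
  have h2 : -b / (|d| + 1) * b + (-b / (|d| + 1)) ^ 2 * d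
      = (b ^ 2 / (|d| + 1) ^ 2) * (d - (|d| + 1)) := by
    field_simp; ring
  rw [h2] at h1
  have h3 : 0 < b ^ 2 / (|d| + 1) ^ 2 := by positivity
  nlinarith [le_abs_self d]

theorem dotProduct_mulVec_comm_of_isSymm {d : Type*} [Fintype d] {M : Matrix d d ℝ}
    (hM : M.IsSymm) (x y : d → ℝ) : x ⬝ᵥ M *ᵥ y = y ⬝ᵥ M *ᵥ x := by
  rw [← dotProduct_transpose_mulVec, hM.eq]

theorem mulVec_eq_zero_of_form_eq_zero {d : Type*} [Fintype d] {M : Matrix d d ℝ}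
    (hM : M.PosSemidef) {x : d → ℝ} (hx : x ⬝ᵥ M *ᵥ x = 0) : M *ᵥ x = 0 := by
  obtain ⟨hs, hp⟩ := (posSemidef_iff_real M).1 hM
  have key : ∀ y, y ⬝ᵥ M *ᵥ x = 0 := by
    intro y
    have : 2 * (y ⬝ᵥ M *ᵥ x) = 0 := by
      apply eq_zero_of_forall_nonneg (d := y ⬝ᵥ M *ᵥ y)
      intro s
      have h := hp (x + s • y)
      simp only [mulVec_add, mulVec_smul, dotProduct_add, add_dotProduct, smul_dotProduct,
        dotProduct_smul, smul_eq_mul] at h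
      rw [hx, dotProduct_mulVec_comm_of_isSymm hs x y] at h
      linarith
    linarith
  exact dotProduct_eq_zero _ (fun y => by rw [dotProduct_comm]; exact key y)

/-- On the unit sphere of a complement of ker M the form of M has a positive lower bound, which
absorbs a small multiple of N; on ker M both vanish. This allows small parameter changes at a
degenerate constraint. -/
theorem exists_pos_forall_form_nonneg {d : Type*} [Fintype d] {M N : Matrix d d ℝ}
    (hM : M.PosSemidef) (hN : N.IsSymm) (hker : ∀ z, z ⬝ᵥ M *ᵥ z = 0 → N *ᵥ z = 0) :
    ∃ ε : ℝ, 0 < ε ∧ ∀ δ, |δ| ≤ ε → ∀ z, 0 ≤ z ⬝ᵥ M *ᵥ z + δ * (z ⬝ᵥ N *ᵥ z) := by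
  obtain ⟨hs, hp⟩ := (posSemidef_iff_real M).1 hM
  obtain ⟨C, hC⟩ := Submodule.exists_isCompl (LinearMap.ker M.mulVecLin)
  set S : Set (d → ℝ) := (C : Set (d → ℝ)) ∩ Metric.sphere 0 1
  have hScomp : IsCompact S :=
    (isCompact_sphere 0 1).inter_left (Submodule.closed_of_finiteDimensional C)
  have hcM : Continuous fun z : d → ℝ => z ⬝ᵥ M *ᵥ z := by fun_prop
  have hcN : Continuous fun z : d → ℝ => z ⬝ᵥ N *ᵥ z := by fun_prop
  have hpos : ∀ z ∈ S, 0 < z ⬝ᵥ M *ᵥ z := by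
    intro z hz
    refine lt_of_le_of_ne (hp z) fun h0 => ?_
    have hk : z ∈ LinearMap.ker M.mulVecLin := mulVec_eq_zero_of_form_eq_zero hM h0.symm
    have := (Submodule.disjoint_def.1 hC.disjoint) z hk hz.1
    have h1 : ‖z‖ = 1 := by simpa using hz.2
    simp [this] at h1
  obtain ⟨a, ha, hap⟩ := hScomp.exists_forall_le' hcM.continuousOn hpos
  obtain ⟨b, hb⟩ := hScomp.exists_bound_of_continuousOn hcN.continuousOn
  have hb1 : 0 < |b| + 1 := by positivity
  refine ⟨a / (|b| + 1), by positivity, fun δ hδ z => ?_⟩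
  have hz : z ∈ LinearMap.ker M.mulVecLin ⊔ C := by rw [hC.sup_eq_top]; trivial
  obtain ⟨z0, hz0, z1, hz1, rfl⟩ := Submodule.mem_sup.1 hz
  have hM0 : M *ᵥ z0 = 0 := hz0
  have hN0 : N *ᵥ z0 = 0 := hker z0 (by rw [hM0, dotProduct_zero])
  have e1 : (z0 + z1) ⬝ᵥ M *ᵥ (z0 + z1) = z1 ⬝ᵥ M *ᵥ z1 := by
    rw [mulVec_add, hM0, zero_add, add_dotProduct, dotProduct_mulVec_comm_of_isSymm hs z0, hM0]
    simp
  have e2 : (z0 + z1) ⬝ᵥ N *ᵥ (z0 + z1) = z1 ⬝ᵥ N *ᵥ z1 := by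
    rw [mulVec_add, hN0, zero_add, add_dotProduct, dotProduct_mulVec_comm_of_isSymm hN z0, hN0]
    simp
  rw [e1, e2]
  by_cases h0 : z1 = 0
  · simp [h0]
  have hn : 0 < ‖z1‖ := norm_pos_iff.2 h0
  have hw : ‖z1‖⁻¹ • z1 ∈ S := ⟨C.smul_mem _ hz1, by simp [norm_smul, hn.ne']⟩
  have h1 := hap _ hw
  have h2 := hb _ hw
  simp only [mulVec_smul, smul_dotProduct, dotProduct_smul, smul_eq_mul] at h1 h2
  have h3 : |δ| * |b| ≤ a := by
    rw [le_div_iff₀ hb1] at hδ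
    nlinarith [abs_nonneg δ, abs_nonneg b]
  have h4 : |δ * (‖z1‖⁻¹ * (‖z1‖⁻¹ * (z1 ⬝ᵥ N *ᵥ z1)))| ≤ a := by
    rw [abs_mul]
    refine le_trans (mul_le_mul_of_nonneg_left (le_trans h2 (le_abs_self b)) (abs_nonneg _)) h3
  have h5 := (abs_le.1 h4).1
  have h6 : z1 ⬝ᵥ M *ᵥ z1 + δ * (z1 ⬝ᵥ N *ᵥ z1)
      = ‖z1‖ ^ 2 * (‖z1‖⁻¹ * (‖z1‖⁻¹ * (z1 ⬝ᵥ M *ᵥ z1))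
        + δ * (‖z1‖⁻¹ * (‖z1‖⁻¹ * (z1 ⬝ᵥ N *ᵥ z1)))) := by
    field_simp
  rw [h6]
  exact mul_nonneg (by positivity) (by linarith)

/-! ### The form of the coupling matrix -/

section Form

variable {n m : ℕ}

/-- The quadratic form of `couplingMatrix Q γ H β s l - α • 1`, where `t = s γ |l|²`. -/
noncomputable def couplingForm (Q : Matrix (Fin n) (Fin n) ℝ)
    (H : Matrix (Fin n ⊕ Fin m) (Fin n ⊕ Fin m) ℝ) (α β t : ℝ)
    (x : Fin n → ℝ) (u : Fin m → ℝ) : ℝ :=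
  x ⬝ᵥ Q *ᵥ x - α * (x ⬝ᵥ x) + t * (gain H *ᵥ x ⬝ᵥ gain H *ᵥ x)
    + 2 * β * (u ⬝ᵥ H.toBlocks₂₂ *ᵥ gain H *ᵥ x) + u ⬝ᵥ H.toBlocks₂₂ *ᵥ u - α * (u ⬝ᵥ u)

/-- What the coupling problem needs to know about the matrix of the Q-function. -/
structure IsCouplingData (Q : Matrix (Fin n) (Fin n) ℝ) (γ : ℝ)
    (H : Matrix (Fin n ⊕ Fin m) (Fin n ⊕ Fin m) ℝ) : Prop where
  posSemidef : Q.PosSemidef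
  pos : 0 < γ
  nonempty : Nonempty (Fin m)
  isSymm : H.toBlocks₂₂.IsSymm
  coercive : ∀ u, γ * (u ⬝ᵥ u) ≤ u ⬝ᵥ H.toBlocks₂₂ *ᵥ u
  factor : H.toBlocks₁₂ᵀ = H.toBlocks₂₂ * gain H
  strict : ∀ x, gain H *ᵥ x ⬝ᵥ H.toBlocks₂₂ *ᵥ gain H *ᵥ x ≤ γ * (gain H *ᵥ x ⬝ᵥ gain H *ᵥ x) →
    gain H *ᵥ x = 0

theorem couplingMatrix_form {Q : Matrix (Fin n) (Fin n) ℝ} {γ : ℝ}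
    {H : Matrix (Fin n ⊕ Fin m) (Fin n ⊕ Fin m) ℝ} (hD : IsCouplingData Q γ H) (α β s : ℝ) (l : ℂ)
    (x : Fin n → ℝ) (u : Fin m → ℝ) :
    Sum.elim x u ⬝ᵥ (couplingMatrix Q γ H β s l - α • 1) *ᵥ Sum.elim x u
      = couplingForm Q H α β (s * γ * ‖l‖ ^ 2) x u := by
  have hG : H.toBlocks₁₂ * H.toBlocks₂₂⁻¹ * H.toBlocks₂₂⁻¹ * H.toBlocks₁₂ᵀ
      = (gain H)ᵀ * gain H := by
    rw [gain, transpose_mul, transpose_transpose, transpose_nonsing_inv, hD.isSymm.eq]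
    simp only [Matrix.mul_assoc]
  have h12 : H.toBlocks₁₂ = (gain H)ᵀ * H.toBlocks₂₂ := by
    rw [← transpose_transpose H.toBlocks₁₂, hD.factor, transpose_mul, hD.isSymm.eq]
  have hsymm : ∀ v : Fin n → ℝ, v ⬝ᵥ ((gain H)ᵀ *ᵥ H.toBlocks₂₂ *ᵥ u)
      = u ⬝ᵥ H.toBlocks₂₂ *ᵥ gain H *ᵥ v := by
    intro v
    rw [dotProduct_transpose_mulVec, dotProduct_comm, ← dotProduct_mulVec_comm_of_isSymm hD.isSymm]
  rw [couplingMatrix, hG, hD.factor, h12, sub_mulVec, dotProduct_sub, fromBlocks_mulVec,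
    sumElim_dotProduct_sumElim, smul_mulVec (b := α), one_mulVec, dotProduct_smul,
    sumElim_dotProduct_sumElim]
  simp only [Sum.elim_comp_inl, Sum.elim_comp_inr, add_mulVec, smul_mulVec, dotProduct_add,
    dotProduct_smul, smul_eq_mul, ← mulVec_mulVec, hsymm, dotProduct_transpose_mulVec]
  rw [couplingForm]
  ring

theorem couplingMatrix_isSymm {Q : Matrix (Fin n) (Fin n) ℝ} {γ : ℝ}
    {H : Matrix (Fin n ⊕ Fin m) (Fin n ⊕ Fin m) ℝ} (hD : IsCouplingData Q γ H) (β s : ℝ) (l : ℂ) :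
    (couplingMatrix Q γ H β s l).IsSymm := by
  have hQ := ((posSemidef_iff_real Q).1 hD.posSemidef).1
  rw [couplingMatrix, Matrix.isSymm_fromBlocks_iff]
  refine ⟨?_, by simp, by simp, hD.isSymm⟩
  rw [Matrix.IsSymm, transpose_add, hQ.eq, transpose_smul]
  simp only [transpose_mul, transpose_transpose, transpose_nonsing_inv, hD.isSymm.eq,
    Matrix.mul_assoc]

theorem posSemidef_couplingMatrix_iff {Q : Matrix (Fin n) (Fin n) ℝ} {γ : ℝ}
    {H : Matrix (Fin n ⊕ Fin m) (Fin n ⊕ Fin m) ℝ} (hD : IsCouplingData Q γ H) (α β s : ℝ)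
    (l : ℂ) :
    (couplingMatrix Q γ H β s l - α • 1).PosSemidef ↔
      ∀ x u, 0 ≤ couplingForm Q H α β (s * γ * ‖l‖ ^ 2) x u := by
  rw [posSemidef_iff_real]
  constructor
  · rintro ⟨-, h⟩ x u
    rw [← couplingMatrix_form hD]
    exact h _
  · intro h
    refine ⟨(couplingMatrix_isSymm hD β s l).sub (by simp [Matrix.IsSymm]), fun z => ?_⟩
    rw [← Sum.elim_comp_inl_inr z, couplingMatrix_form hD]
    exact h _ _

theorem norm_sq_one_sub_mul (c : ℝ) (l : ℂ) :
    ‖1 - (c : ℂ) * l‖ ^ 2 = 1 - 2 * c * l.re + c ^ 2 * ‖l‖ ^ 2 := by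
  rw [← Complex.normSq_eq_norm_sq, ← Complex.normSq_eq_norm_sq, Complex.normSq_apply,
    Complex.normSq_apply]
  simp
  ring

/-- The matrix is βI plus the traceless symmetric matrix with rows (-σ, τ) and (τ, σ), whose
eigenvalues are ±√(σ² + τ²), and σ² + τ² = |1 - cl|². -/
theorem posSemidef_modeLMI_iff {l : ℂ} (hl : l ≠ 0) (β c : ℝ) :
    (modeLMI β c l).PosSemidef ↔ ‖1 - (c : ℂ) * l‖ ≤ β := by
  have hn : 0 < ‖l‖ := norm_pos_iff.2 hl
  have hre : l.re ^ 2 / ‖l‖ ^ 2 ≤ 1 := by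
    rw [div_le_one (by positivity)]
    exact sq_le_sq' (by linarith [Complex.abs_re_le_norm l, neg_abs_le l.re])
      ((le_abs_self _).trans (Complex.abs_re_le_norm l))
  set σ := √(1 - l.re ^ 2 / ‖l‖ ^ 2) with hσ
  have hσ0 : 0 ≤ σ := Real.sqrt_nonneg _
  have hσ2 : σ ^ 2 = 1 - l.re ^ 2 / ‖l‖ ^ 2 := Real.sq_sqrt (by linarith)
  set τ := 1 / ‖l‖ * (c * ‖l‖ ^ 2 - l.re) with hτ
  have hsum : σ ^ 2 + τ ^ 2 = ‖1 - (c : ℂ) * l‖ ^ 2 := by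
    rw [norm_sq_one_sub_mul, hσ2, hτ]
    field_simp
    ring
  have hform : ∀ z : Fin 2 → ℝ, z ⬝ᵥ modeLMI β c l *ᵥ z
      = (β - σ) * z 0 ^ 2 + 2 * τ * (z 0 * z 1) + (β + σ) * z 1 ^ 2 := by
    intro z
    simp only [modeLMI, ← hσ, ← hτ, mulVec, dotProduct, Fin.sum_univ_two, of_apply, cons_val_zero,
      cons_val_one, cons_val', cons_val_fin_one]
    ring
  rw [posSemidef_iff_real]
  constructor
  · rintro ⟨-, h⟩
    have h1 : 0 ≤ β - σ := by
      have := h ![1, 0]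
      rw [hform] at this
      simpa using this
    -- Up to sign these are the columns of the adjugate, where the form equals a diagonal entry
    -- times the determinant.
    have h2 := h ![-τ, β - σ]
    have h3 := h ![-(β + σ), τ]
    simp only [hform, cons_val_zero, cons_val_one] at h2 h3
    refine abs_le_of_sq_le_sq' (a := ‖1 - (c : ℂ) * l‖) ?_ (by linarith) |>.2
    rw [← hsum]
    by_contra hlt
    push Not at hlt
    have h4 : 0 ≤ (β - σ) * (β ^ 2 - (σ ^ 2 + τ ^ 2)) := by nlinarith
    have h5 : 0 ≤ (β + σ) * (β ^ 2 - (σ ^ 2 + τ ^ 2)) := by nlinarith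
    have h6 : β = 0 := by nlinarith
    have h7 : σ = 0 := by nlinarith
    have h8 := h ![1, -τ]
    rw [hform, h6, h7] at h8
    simp only [cons_val_zero, cons_val_one] at h8
    simp only [h6, h7] at hlt
    nlinarith
  · intro h
    refine ⟨?_, fun z => ?_⟩
    · ext i j
      fin_cases i <;> fin_cases j <;> simp [modeLMI]
    · rw [hform]
      have hβ : 0 ≤ β := (norm_nonneg _).trans h
      have h1 : (σ * (z 0 ^ 2 - z 1 ^ 2) - 2 * τ * (z 0 * z 1)) ^ 2
          ≤ (β * (z 0 ^ 2 + z 1 ^ 2)) ^ 2 := by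
        have h2 : (σ * (z 0 ^ 2 - z 1 ^ 2) - 2 * τ * (z 0 * z 1)) ^ 2
            ≤ (σ ^ 2 + τ ^ 2) * (z 0 ^ 2 + z 1 ^ 2) ^ 2 := by
          nlinarith [sq_nonneg (σ * (2 * (z 0 * z 1)) + τ * (z 0 ^ 2 - z 1 ^ 2))]
        refine h2.trans ?_
        rw [mul_pow β, hsum]
        gcongr
      have h3 := (abs_le_of_sq_le_sq' h1 (by positivity)).2
      linarith

end Form

/-! ### Perturbation of the coupling form and bounds on α and β -/

section Sub

variable {n m : ℕ} {Q : Matrix (Fin n) (Fin n) ℝ} {γ : ℝ}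
  {H : Matrix (Fin n ⊕ Fin m) (Fin n ⊕ Fin m) ℝ}

theorem dotProduct_self_nonneg_real {d : ℕ} (x : Fin d → ℝ) : 0 ≤ x ⬝ᵥ x := by
  simpa using dotProduct_star_self_nonneg x

theorem dotProduct_self_pos_real {d : ℕ} {x : Fin d → ℝ} (hx : x ≠ 0) : 0 < x ⬝ᵥ x :=
  lt_of_le_of_ne (dotProduct_self_nonneg_real x) fun h => hx (dotProduct_self_eq_zero.1 h.symm)

theorem couplingForm_mono {α α' β t t' : ℝ} (hα : α' ≤ α) (ht : t ≤ t')
    (x : Fin n → ℝ) (u : Fin m → ℝ) :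
    couplingForm Q H α β t x u ≤ couplingForm Q H α' β t' x u := by
  unfold couplingForm
  have h1 := mul_nonneg (sub_nonneg.2 hα) (dotProduct_self_nonneg_real x)
  have h2 := mul_nonneg (sub_nonneg.2 hα) (dotProduct_self_nonneg_real u)
  have h3 := mul_nonneg (sub_nonneg.2 ht) (dotProduct_self_nonneg_real (gain H *ᵥ x))
  linarith

theorem couplingForm_neg (α β t : ℝ) (x : Fin n → ℝ) (u : Fin m → ℝ) :
    couplingForm Q H α β t x (-u) = couplingForm Q H α (-β) t x u := by
  simp [couplingForm, mulVec_neg]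

theorem couplingForm_smul (α β t s : ℝ) (x : Fin n → ℝ) (u : Fin m → ℝ) :
    couplingForm Q H α β t x (s • u) = x ⬝ᵥ Q *ᵥ x - α * (x ⬝ᵥ x)
      + t * (gain H *ᵥ x ⬝ᵥ gain H *ᵥ x) + s * (2 * β * (u ⬝ᵥ H.toBlocks₂₂ *ᵥ gain H *ᵥ x))
      + s ^ 2 * (u ⬝ᵥ H.toBlocks₂₂ *ᵥ u - α * (u ⬝ᵥ u)) := by
  simp [couplingForm, mulVec_smul]
  ring

theorem subFeasible_iff (hD : IsCouplingData Q γ H) {ι : Type*} [Fintype ι] {lam : ι → ℂ}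
    (hlam : ∀ i, lam i ≠ 0) (c₀ : ℝ) (p : ℝ × ℝ × ℝ) :
    SubFeasible Q γ H lam c₀ p ↔ ∀ i,
      (∀ x u, 0 ≤ couplingForm Q H p.1 p.2.1 ((2 * c₀ * p.2.2 - c₀ ^ 2) * γ * ‖lam i‖ ^ 2) x u) ∧
        ‖1 - (p.2.2 : ℂ) * lam i‖ ≤ p.2.1 := by
  refine forall_congr' fun i => ?_
  rw [Sl, posSemidef_couplingMatrix_iff hD, posSemidef_modeLMI_iff (hlam i)]

theorem feasible_iff_subFeasible_self {ι : Type*} [Fintype ι] {lam : ι → ℂ} (p : ℝ × ℝ × ℝ) :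
    Feasible Q γ H lam p ↔ SubFeasible Q γ H lam p.2.2 p := by
  have : 2 * p.2.2 * p.2.2 - p.2.2 ^ 2 = p.2.2 ^ 2 := by ring
  simp only [Feasible, SubFeasible, Sq, Sl, this]

/-- A positive coupling form stays nonnegative when `α` grows a little. -/
theorem exists_increase_of_form_pos (hD : IsCouplingData Q γ H) {ι : Type*} [Finite ι]
    {α β : ℝ} {t : ι → ℝ}
    (h : ∀ i x u, (x ≠ 0 ∨ u ≠ 0) → 0 < couplingForm Q H α β (t i) x u) :
    ∃ ε : ℝ, 0 < ε ∧ ∀ i x u, 0 ≤ couplingForm Q H (α + ε) β (t i) x u := by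
  have hne : ∀ z : Fin n ⊕ Fin m → ℝ, z ≠ 0 → z ∘ Sum.inl ≠ 0 ∨ z ∘ Sum.inr ≠ 0 := by
    intro z hz
    by_contra hcon
    push Not at hcon
    apply hz
    rw [← Sum.elim_comp_inl_inr z, hcon.1, hcon.2]
    ext (i | i) <;> rfl
  have key : ∀ i, ∃ ε : ℝ, 0 < ε ∧ ∀ x u, 0 ≤ couplingForm Q H (α + ε) β (t i) x u := by
    intro i
    -- Any t is s γ |l|² with s = t/γ and l = 1, so the matrix lemmas apply to the form.
    have e : t i / γ * γ * ‖(1 : ℂ)‖ ^ 2 = t i := by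
      have := hD.pos.ne'
      simp; field_simp
    have hform := couplingMatrix_form hD α β (t i / γ) (1 : ℂ)
    rw [e] at hform
    set M := couplingMatrix Q γ H β (t i / γ) (1 : ℂ) - α • 1 with hM
    have hpos : ∀ z, z ≠ 0 → 0 < z ⬝ᵥ M *ᵥ z := by
      intro z hz
      rw [← Sum.elim_comp_inl_inr z, hform]
      exact h i _ _ (hne z hz)
    have hpsd : M.PosSemidef := by
      rw [posSemidef_couplingMatrix_iff hD]
      intro x u
      rw [e, ← hform]
      by_cases hz : Sum.elim x u = 0
      · simp [hz]
      · exact (hpos _ hz).le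
    obtain ⟨ε, hε, hh⟩ := exists_pos_forall_form_nonneg hpsd (N := -1)
      (by simp [Matrix.IsSymm]) (fun z hz => by
        by_cases h0 : z = 0
        · simp [h0]
        · exact absurd hz (hpos z h0).ne')
    refine ⟨ε, hε, fun x u => ?_⟩
    have := hh ε (abs_of_pos hε).le (Sum.elim x u)
    rw [hform] at this
    simp only [neg_mulVec, one_mulVec, dotProduct_neg, sumElim_dotProduct_sumElim] at this
    unfold couplingForm at this ⊢
    linarith
  choose ε hε hh using key
  rcases isEmpty_or_nonempty ι with hι | hι
  · exact ⟨1, one_pos, fun i => isEmptyElim i⟩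
  obtain ⟨i₀, hi₀⟩ := Finite.exists_min ε
  exact ⟨ε i₀, hε i₀, fun i x u => (hh i x u).trans
    (couplingForm_mono (by linarith [hi₀ i]) le_rfl x u)⟩

/-- A nonnegative coupling form is positive after `β` is decreased, when `α < 0`. -/
theorem couplingForm_pos_of_abs_lt (hD : IsCouplingData Q γ H) {α β β' t t' : ℝ} (hα : α < 0)
    (hβ : |β'| < β) (ht : t ≤ t') (h : ∀ x u, 0 ≤ couplingForm Q H α β t x u)
    (x : Fin n → ℝ) (u : Fin m → ℝ) (hxu : x ≠ 0 ∨ u ≠ 0) :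
    0 < couplingForm Q H α β' t' x u := by
  refine lt_of_lt_of_le ?_ (couplingForm_mono le_rfl ht x u)
  obtain ⟨hβ1, hβ2⟩ := abs_lt.1 hβ
  have hβ0 : 0 < β := by linarith [abs_nonneg β']
  have hu : ∀ v : Fin m → ℝ, v ≠ 0 → 0 < v ⬝ᵥ H.toBlocks₂₂ *ᵥ v - α * (v ⬝ᵥ v) := by
    intro v hv
    have h1 := hD.coercive v
    have h2 := dotProduct_self_pos_real hv
    nlinarith [hD.pos, mul_pos hD.pos h2, mul_pos (neg_pos.2 hα) h2]
  have h1 := h x u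
  have h2 := h x (-u)
  -- The form is affine in β and a sign change of u is one of β, so the form at β' is a convex
  -- combination with positive weights.
  have e : couplingForm Q H α β' t x u = ((β + β') / (2 * β)) * couplingForm Q H α β t x u
      + ((β - β') / (2 * β)) * couplingForm Q H α β t x (-u) := by
    rw [couplingForm_neg]
    unfold couplingForm
    field_simp
    ring
  have hA : 0 < (β + β') / (2 * β) := div_pos (by linarith) (by linarith)
  have hB : 0 < (β - β') / (2 * β) := div_pos (by linarith) (by linarith)
  rw [e]
  by_contra hcon
  have z1 : couplingForm Q H α β t x u = 0 := by nlinarith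
  have z2 : couplingForm Q H α β t x (-u) = 0 := by nlinarith
  have h0 := h x 0
  rw [couplingForm_neg] at z2
  have hx0 := couplingForm_smul (Q := Q) (H := H) α β t 0 x u
  rw [zero_smul] at hx0
  have hu0 : u = 0 := by
    by_contra hu0
    have h3 := hu u hu0
    rw [hx0] at h0
    unfold couplingForm at z1 z2
    linarith
  subst hu0
  have hx : x ≠ 0 := by simpa using hxu
  rw [hx0] at z1
  have hb : 2 * β * (gain H *ᵥ x ⬝ᵥ H.toBlocks₂₂ *ᵥ gain H *ᵥ x) = 0 := by
    apply eq_zero_of_forall_nonneg (d := (gain H *ᵥ x ⬝ᵥ H.toBlocks₂₂ *ᵥ gain H *ᵥ x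
      - α * (gain H *ᵥ x ⬝ᵥ gain H *ᵥ x)))
    intro s
    have := h x (s • gain H *ᵥ x)
    rw [couplingForm_smul] at this
    linarith
  have hb' : gain H *ᵥ x ⬝ᵥ H.toBlocks₂₂ *ᵥ gain H *ᵥ x = 0 := by
    rcases mul_eq_zero.1 hb with h | h
    · linarith
    · exact h
  have hK : gain H *ᵥ x = 0 := by
    by_contra hK
    have := dotProduct_self_pos_real hK
    nlinarith [hD.coercive (gain H *ᵥ x), hD.pos]
  have hq := ((posSemidef_iff_real Q).1 hD.posSemidef).2 x
  have hxx := dotProduct_self_pos_real hx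
  rw [hK] at z1
  simp only [dotProduct_zero, mulVec_zero, mul_zero] at z1
  nlinarith [mul_pos (neg_pos.2 hα) hxx]

/-- Every `α` admits no more than the coercivity of the lower right block allows. -/
theorem exists_le_of_form_nonneg (hD : IsCouplingData Q γ H) : ∃ a : ℝ, ∀ α β t,
    (∀ x u, 0 ≤ couplingForm Q H α β t x u) → α ≤ a := by
  obtain ⟨j⟩ := hD.nonempty
  refine ⟨Pi.single j 1 ⬝ᵥ H.toBlocks₂₂ *ᵥ Pi.single j 1, fun α β t h => ?_⟩
  have := h 0 (Pi.single j 1)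
  simp [couplingForm] at this
  simpa using this

/-- Along u = sKx the form is a quadratic in s whose linear coefficient is proportional to β; its
minimum, of order -β², must be compensated by the t-term. -/
theorem exists_bound_beta (hD : IsCouplingData Q γ H) {x : Fin n → ℝ} (hx : gain H *ᵥ x ≠ 0)
    (α₀ : ℝ) : ∃ C₁ C₂ : ℝ, 0 ≤ C₁ ∧ 0 ≤ C₂ ∧ ∀ α β t, α₀ ≤ α →
      (∀ x u, 0 ≤ couplingForm Q H α β t x u) → β ^ 2 ≤ C₁ + C₂ * |t| := by
  set y := gain H *ᵥ x with hy
  set h := y ⬝ᵥ H.toBlocks₂₂ *ᵥ y with hh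
  have hyy := dotProduct_self_pos_real hx
  have hpos : 0 < h := lt_of_lt_of_le (mul_pos hD.pos hyy) (hD.coercive y)
  set A := |α₀| * (y ⬝ᵥ y) with hA
  have hA0 : 0 ≤ A := by positivity
  have hq := ((posSemidef_iff_real Q).1 hD.posSemidef).2 x
  have hxx := dotProduct_self_nonneg_real x
  refine ⟨(h + A) / h ^ 2 * (x ⬝ᵥ Q *ᵥ x + |α₀| * (x ⬝ᵥ x)), (h + A) / h ^ 2 * (y ⬝ᵥ y),
    by positivity, by positivity, fun α β t hα hf => ?_⟩
  have h1 := (hf x ((-(β * h / (h + A))) • y)).trans (couplingForm_mono hα le_rfl _ _)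
  rw [couplingForm_smul, ← hy, ← hh] at h1
  have h2 : 0 ≤ (β * h / (h + A)) ^ 2 * (A + α₀ * (y ⬝ᵥ y)) := by
    refine mul_nonneg (sq_nonneg _) ?_
    have := mul_le_mul_of_nonneg_right (neg_abs_le α₀) hyy.le
    linarith
  have h3 : 0 ≤ (|α₀| + α₀) * (x ⬝ᵥ x) := mul_nonneg (by linarith [neg_abs_le α₀]) hxx
  have h4 : t * (y ⬝ᵥ y) ≤ |t| * (y ⬝ᵥ y) := mul_le_mul_of_nonneg_right (le_abs_self t) hyy.le
  have h5 : -(β * h / (h + A)) * (2 * β * h) + (-(β * h / (h + A))) ^ 2 * (h + A)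
      = -(h ^ 2 / (h + A) * β ^ 2) := by
    have : h + A ≠ 0 := by positivity
    field_simp
    ring
  have h6 : h ^ 2 / (h + A) * β ^ 2 ≤ x ⬝ᵥ Q *ᵥ x + |α₀| * (x ⬝ᵥ x) + |t| * (y ⬝ᵥ y) := by
    linarith
  have h7 : β ^ 2 = (h + A) / h ^ 2 * (h ^ 2 / (h + A) * β ^ 2) := by
    field_simp
  calc β ^ 2 = (h + A) / h ^ 2 * (h ^ 2 / (h + A) * β ^ 2) := h7
    _ ≤ (h + A) / h ^ 2 * (x ⬝ᵥ Q *ᵥ x + |α₀| * (x ⬝ᵥ x) + |t| * (y ⬝ᵥ y)) :=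
      mul_le_mul_of_nonneg_left h6 (by positivity)
    _ = _ := by ring

end Sub

/-! ### Existence of iterates, monotone values and limit points -/

section Run

variable {n m : ℕ} {Q : Matrix (Fin n) (Fin n) ℝ} {γ : ℝ}
  {H : Matrix (Fin n ⊕ Fin m) (Fin n ⊕ Fin m) ℝ} {ι : Type*} [Fintype ι] {lam : ι → ℂ}

theorem exists_mulVec_ne_zero {k l : Type*} [Fintype l] {M : Matrix k l ℝ} (hM : M ≠ 0) :
    ∃ x, M *ᵥ x ≠ 0 := by
  classical
  by_contra hcon
  push Not at hcon
  exact hM (Matrix.ext_of_mulVec_single fun i => by rw [hcon, zero_mulVec])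

theorem isClosed_setOf_subFeasible (hD : IsCouplingData Q γ H) (hlam : ∀ i, lam i ≠ 0) :
    IsClosed {q : ℝ × ℝ × ℝ × ℝ | SubFeasible Q γ H lam q.1 q.2} := by
  simp only [subFeasible_iff hD hlam, Set.ofPred_forall, Set.ofPred_and]
  refine isClosed_iInter fun i => IsClosed.inter ?_ ?_
  · refine isClosed_iInter fun x => isClosed_iInter fun u => isClosed_le continuous_const ?_
    unfold couplingForm
    fun_prop
  · refine isClosed_le ?_ (by fun_prop)
    fun_prop

theorem subFeasible_of_tendsto (hD : IsCouplingData Q γ H) (hlam : ∀ i, lam i ≠ 0) {c : ℕ → ℝ}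
    {x : ℕ → ℝ × ℝ × ℝ} {c₀ : ℝ} {p : ℝ × ℝ × ℝ} (hc : Tendsto c atTop (𝓝 c₀))
    (hx : Tendsto x atTop (𝓝 p)) (h : ∀ᶠ k in atTop, SubFeasible Q γ H lam (c k) (x k)) :
    SubFeasible Q γ H lam c₀ p := by
  have hm : (c₀, p) ∈ {q : ℝ × ℝ × ℝ × ℝ | SubFeasible Q γ H lam q.1 q.2} :=
    (isClosed_setOf_subFeasible hD hlam).mem_of_tendsto (hc.prodMk_nhds hx)
      (h.mono fun k hk => hk)
  exact hm

theorem abs_mul_norm_le {c β : ℝ} {l : ℂ} (h : ‖1 - (c : ℂ) * l‖ ≤ β) : |c| * ‖l‖ ≤ 1 + β := by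
  have h1 : ‖(c : ℂ) * l‖ ≤ ‖(1 : ℂ)‖ + ‖1 - (c : ℂ) * l‖ := by
    have := norm_sub_le (1 : ℂ) (1 - (c : ℂ) * l)
    simpa using this
  rw [norm_mul, Complex.norm_real, Real.norm_eq_abs, norm_one] at h1
  linarith

/-- Since t is affine in c, β² is bounded linearly in |c|; since |1 - cλ| ≤ β, |c| is bounded
linearly in β. Together β² ≤ a₁ + b₁β. For K = 0 the coupling constraint would not restrict β and c
at all. -/
theorem exists_bound_of_subFeasible [Nonempty ι] (hD : IsCouplingData Q γ H)
    (hlam : ∀ i, lam i ≠ 0) (hK : gain H ≠ 0) (R α₀ : ℝ) :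
    ∃ B : ℝ, ∀ c₀ p, |c₀| ≤ R → SubFeasible Q γ H lam c₀ p → α₀ ≤ p.1 → ‖p‖ ≤ B := by
  obtain ⟨x, hx⟩ : ∃ x, gain H *ᵥ x ≠ 0 := exists_mulVec_ne_zero hK
  obtain ⟨C₁, C₂, hC₁, hC₂, hC⟩ := exists_bound_beta hD hx α₀
  obtain ⟨a, ha⟩ := exists_le_of_form_nonneg hD
  obtain ⟨i⟩ := ‹Nonempty ι›
  set ℓ := ‖lam i‖ with hℓ
  have hℓ0 : 0 < ℓ := norm_pos_iff.2 (hlam i)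
  have hγ := hD.pos
  set a₁ := C₁ + C₂ * (2 * |R| * γ * ℓ + R ^ 2 * γ * ℓ ^ 2) with ha₁
  set b₁ := C₂ * (2 * |R| * γ * ℓ) with hb₁
  have ha₁0 : 0 ≤ a₁ := by positivity
  have hb₁0 : 0 ≤ b₁ := by positivity
  -- Exceeds the larger root of β² = a₁ + b₁β.
  set B := a₁ + b₁ + 1 with hB
  refine ⟨max (max |α₀| |a|) (max B ((1 + B) / ℓ)), fun c₀ p hc₀ hp hα => ?_⟩
  obtain ⟨hf, hN⟩ := (subFeasible_iff hD hlam c₀ p).1 hp i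
  have hβ0 : 0 ≤ p.2.1 := (norm_nonneg _).trans hN
  have hcl := abs_mul_norm_le hN
  have hR : 0 ≤ R := (abs_nonneg c₀).trans hc₀
  have ht : |(2 * c₀ * p.2.2 - c₀ ^ 2) * γ * ‖lam i‖ ^ 2|
      ≤ 2 * |R| * γ * ℓ * (1 + p.2.1) + R ^ 2 * γ * ℓ ^ 2 := by
    rw [abs_mul, abs_mul, abs_of_pos hγ, abs_of_nonneg (sq_nonneg ‖lam i‖), ← hℓ,
      abs_of_nonneg hR]
    have h1 : |2 * c₀ * p.2.2 - c₀ ^ 2| ≤ 2 * R * |p.2.2| + R ^ 2 := by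
      refine (abs_sub _ _).trans ?_
      rw [abs_mul, abs_mul, abs_pow, abs_two]
      gcongr
    calc |2 * c₀ * p.2.2 - c₀ ^ 2| * γ * ℓ ^ 2 ≤ (2 * R * |p.2.2| + R ^ 2) * γ * ℓ ^ 2 := by
          gcongr
      _ = 2 * R * γ * ℓ * (|p.2.2| * ℓ) + R ^ 2 * γ * ℓ ^ 2 := by ring
      _ ≤ _ := by gcongr
  have hβ2 := hC _ _ _ hα hf
  have hβ3 : p.2.1 ^ 2 ≤ a₁ + b₁ * p.2.1 := by
    refine hβ2.trans ?_
    have := mul_le_mul_of_nonneg_left ht hC₂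
    rw [ha₁, hb₁]
    linarith
  have hβB : p.2.1 ≤ B := by
    by_contra hlt
    push Not at hlt
    nlinarith
  have hcB : |p.2.2| ≤ (1 + B) / ℓ := by
    rw [le_div_iff₀ hℓ0]
    linarith
  rw [Prod.norm_def, Prod.norm_def]
  refine max_le_max ?_ (max_le_max ?_ hcB)
  · rw [Real.norm_eq_abs]
    rcases le_total 0 p.1 with h | h
    · rw [abs_of_nonneg h]
      exact le_max_of_le_right ((ha _ _ _ hf).trans (le_abs_self a))
    · rw [abs_of_nonpos h]
      exact le_max_of_le_left (by linarith [neg_abs_le α₀])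
  · rw [Real.norm_eq_abs, abs_of_nonneg hβ0]
    exact hβB

theorem exists_form_lower_bound (hD : IsCouplingData Q γ H) (β t : ℝ) :
    ∃ A : ℝ, ∀ α x u, (A - α) * (x ⬝ᵥ x + u ⬝ᵥ u) ≤ couplingForm Q H α β t x u := by
  have e : t / γ * γ * ‖(1 : ℂ)‖ ^ 2 = t := by
    have := hD.pos.ne'
    simp; field_simp
  have hform := couplingMatrix_form hD 0 β (t / γ) (1 : ℂ)
  rw [e] at hform
  obtain ⟨ε, hε, h⟩ := exists_pos_forall_form_nonneg
    (M := (1 : Matrix (Fin n ⊕ Fin m) (Fin n ⊕ Fin m) ℝ)) Matrix.PosSemidef.one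
    (N := couplingMatrix Q γ H β (t / γ) (1 : ℂ) - (0 : ℝ) • 1)
    ((couplingMatrix_isSymm hD _ _ _).sub (by simp [Matrix.IsSymm])) (fun z hz => by
      rw [one_mulVec, dotProduct_self_eq_zero] at hz
      simp [hz])
  refine ⟨-(1 / ε), fun α x u => ?_⟩
  have h1 := h ε (abs_of_pos hε).le (Sum.elim x u)
  rw [hform, one_mulVec, sumElim_dotProduct_sumElim] at h1
  have h2 : 0 ≤ 1 / ε * (x ⬝ᵥ x + u ⬝ᵥ u) + couplingForm Q H 0 β t x u := by
    have := mul_nonneg (by positivity : 0 ≤ 1 / ε) h1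
    rw [mul_add, ← mul_assoc, one_div_mul_cancel hε.ne', one_mul] at this
    exact this
  unfold couplingForm at h2 ⊢
  linarith

/-- Slater's condition holds for every subproblem. -/
theorem exists_strictly_subFeasible (hD : IsCouplingData Q γ H) (lam : ι → ℂ) (c₀ c : ℝ) :
    ∃ p : ℝ × ℝ × ℝ, p.2.2 = c ∧ ∀ i, (∀ x u, (x ≠ 0 ∨ u ≠ 0) →
      0 < couplingForm Q H p.1 p.2.1 ((2 * c₀ * p.2.2 - c₀ ^ 2) * γ * ‖lam i‖ ^ 2) x u) ∧
        ‖1 - (p.2.2 : ℂ) * lam i‖ < p.2.1 := by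
  obtain ⟨b, hb⟩ := (Set.finite_range fun i => ‖1 - (c : ℂ) * lam i‖).bddAbove
  choose A hA using fun i => exists_form_lower_bound hD (b + 1)
    ((2 * c₀ * c - c₀ ^ 2) * γ * ‖lam i‖ ^ 2)
  obtain ⟨a, ha⟩ := (Set.finite_range A).bddBelow
  refine ⟨(a - 1, b + 1, c), rfl, fun i => ⟨fun x u hxu => ?_, ?_⟩⟩
  · have h1 : a ≤ A i := ha ⟨i, rfl⟩
    refine lt_of_lt_of_le ?_ (hA i (a - 1) x u)
    have hp : 0 < x ⬝ᵥ x + u ⬝ᵥ u := by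
      have h2 := dotProduct_self_nonneg_real x
      have h3 := dotProduct_self_nonneg_real u
      rcases hxu with h | h
      · linarith [dotProduct_self_pos_real h]
      · linarith [dotProduct_self_pos_real h]
    exact mul_pos (by linarith) hp
  · have : ‖1 - (c : ℂ) * lam i‖ ≤ b := hb ⟨i, rfl⟩
    simpa using lt_of_le_of_lt this (by linarith : b < b + 1)

theorem exists_subFeasible (hD : IsCouplingData Q γ H) (hlam : ∀ i, lam i ≠ 0) (c₀ c : ℝ) :
    ∃ p : ℝ × ℝ × ℝ, p.2.2 = c ∧ SubFeasible Q γ H lam c₀ p := by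
  obtain ⟨p, hc, hp⟩ := exists_strictly_subFeasible hD lam c₀ c
  refine ⟨p, hc, (subFeasible_iff hD hlam c₀ p).2 fun i => ⟨fun x u => ?_, (hp i).2.le⟩⟩
  by_cases hxu : x ≠ 0 ∨ u ≠ 0
  · exact ((hp i).1 x u hxu).le
  · push Not at hxu
    simp [couplingForm, hxu.1, hxu.2]

theorem subFeasible_of_gain_eq_zero (hD : IsCouplingData Q γ H) (hlam : ∀ i, lam i ≠ 0)
    (hK : gain H = 0) {c₀ c₁ β c : ℝ} {p : ℝ × ℝ × ℝ} (hp : SubFeasible Q γ H lam c₀ p)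
    (hN : ∀ i, ‖1 - (c : ℂ) * lam i‖ ≤ β) : SubFeasible Q γ H lam c₁ (p.1, β, c) := by
  rw [subFeasible_iff hD hlam] at hp ⊢
  refine fun i => ⟨fun x u => ?_, hN i⟩
  have := (hp i).1 x u
  simpa [couplingForm, hK] using this

/-- Every subproblem has an optimal solution. -/
theorem exists_subOptimal [Nonempty ι] (hD : IsCouplingData Q γ H) (hlam : ∀ i, lam i ≠ 0)
    (c₀ : ℝ) : ∃ p, SubOptimal Q γ H lam c₀ p := by
  have hclosed : IsClosed {p : ℝ × ℝ × ℝ | SubFeasible Q γ H lam c₀ p} :=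
    (isClosed_setOf_subFeasible hD hlam).preimage (by fun_prop : Continuous fun p => (c₀, p))
  obtain ⟨p₀, hp₀c, hp₀⟩ := exists_subFeasible hD hlam c₀ 0
  by_cases hK : gain H = 0
  · obtain ⟨a, ha⟩ := exists_le_of_form_nonneg hD
    obtain ⟨i⟩ := ‹Nonempty ι›
    -- The feasible set is unbounded in β and c here, but the coupling constraint ignores both; they
    -- are fixed and only α is maximized.
    set S : Set ℝ := {α | SubFeasible Q γ H lam c₀ (α, p₀.2)} ∩ Set.Icc p₀.1 a with hS
    have hN : ∀ i, ‖1 - (p₀.2.2 : ℂ) * lam i‖ ≤ p₀.2.1 := fun i =>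
      ((subFeasible_iff hD hlam c₀ p₀).1 hp₀ i).2
    have hle : ∀ {c} q, SubFeasible Q γ H lam c q → q.1 ≤ a := fun {c} q hq =>
      ha _ _ _ ((subFeasible_iff hD hlam c q).1 hq i).1
    have hcomp : IsCompact S :=
      isCompact_Icc.inter_left (hclosed.preimage (by fun_prop : Continuous fun α => (α, p₀.2)))
    obtain ⟨α, hα, hmax⟩ := hcomp.exists_isMaxOn ⟨p₀.1, hp₀, le_rfl, hle _ hp₀⟩
      continuousOn_id
    refine ⟨(α, p₀.2), hα.1, fun q hq => ?_⟩
    rcases le_total q.1 p₀.1 with h | h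
    · exact h.trans hα.2.1
    · exact hmax (a := q.1) ⟨subFeasible_of_gain_eq_zero hD hlam hK hq hN, h, hle _ hq⟩
  · obtain ⟨B, hB⟩ := exists_bound_of_subFeasible hD hlam hK |c₀| p₀.1
    set S : Set (ℝ × ℝ × ℝ) := {p | SubFeasible Q γ H lam c₀ p} ∩ {p | p₀.1 ≤ p.1} with hS
    have hcomp : IsCompact S := by
      refine Metric.isCompact_of_isClosed_isBounded
        (hclosed.inter (isClosed_le continuous_const continuous_fst)) ?_
      exact (Metric.isBounded_closedBall (x := 0) (r := B)).subset fun p hp => by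
        simpa using hB c₀ p le_rfl hp.1 hp.2
    obtain ⟨p, hp, hmax⟩ := hcomp.exists_isMaxOn ⟨p₀, hp₀, le_refl p₀.1⟩ continuous_fst.continuousOn
    refine ⟨p, hp.1, fun q hq => ?_⟩
    rcases le_total q.1 p₀.1 with h | h
    · exact h.trans hp.2
    · exact hmax ⟨hq, h⟩

theorem exists_isRun [Nonempty ι] (hD : IsCouplingData Q γ H) (hlam : ∀ i, lam i ≠ 0)
    (p₀ : ℝ × ℝ × ℝ) : ∃ x, x 0 = p₀ ∧ IsRun Q γ H lam x := by
  choose f hf using exists_subOptimal hD hlam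
  refine ⟨fun k => (fun p => f p.2.2)^[k] p₀, rfl, fun k => ?_⟩
  simp only [Function.iterate_succ_apply']
  exact hf _

/-- The difference c² - (2c₀c - c₀²) = (c - c₀)² is nonnegative and the form is nondecreasing in t,
so the linearized constraint is the stronger one. -/
theorem feasible_of_subFeasible (hD : IsCouplingData Q γ H) (hlam : ∀ i, lam i ≠ 0)
    {c₀ : ℝ} {p : ℝ × ℝ × ℝ} (hp : SubFeasible Q γ H lam c₀ p) : Feasible Q γ H lam p := by
  rw [feasible_iff_subFeasible_self, subFeasible_iff hD hlam]
  rw [subFeasible_iff hD hlam] at hp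
  refine fun i => ⟨fun x u => ((hp i).1 x u).trans (couplingForm_mono le_rfl ?_ x u), (hp i).2⟩
  have hγ := hD.pos
  refine mul_le_mul_of_nonneg_right (mul_le_mul_of_nonneg_right ?_ hγ.le) (sq_nonneg _)
  nlinarith [sq_nonneg (p.2.2 - c₀)]

namespace IsRun

variable {x : ℕ → ℝ × ℝ × ℝ}

theorem feasible (hx : IsRun Q γ H lam x) (hD : IsCouplingData Q γ H) (hlam : ∀ i, lam i ≠ 0)
    (k : ℕ) : Feasible Q γ H lam (x (k + 1)) :=
  feasible_of_subFeasible hD hlam (hx k).1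

theorem le_succ_of_feasible (hx : IsRun Q γ H lam x) {k : ℕ} (h : Feasible Q γ H lam (x k)) :
    (x k).1 ≤ (x (k + 1)).1 :=
  (hx k).2 _ ((feasible_iff_subFeasible_self _).1 h)

theorem monotone (hx : IsRun Q γ H lam x) (hD : IsCouplingData Q γ H) (hlam : ∀ i, lam i ≠ 0) :
    Monotone fun k => (x (k + 1)).1 :=
  monotone_nat_of_le_succ fun k => hx.le_succ_of_feasible (hx.feasible hD hlam k)

theorem exists_tendsto [Nonempty ι] (hx : IsRun Q γ H lam x) (hD : IsCouplingData Q γ H)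
    (hlam : ∀ i, lam i ≠ 0) :
    ∃ a, Tendsto (fun k => (x k).1) atTop (𝓝 a) ∧ ∀ k, (x (k + 1)).1 ≤ a := by
  obtain ⟨a, ha⟩ := exists_le_of_form_nonneg hD
  obtain ⟨i⟩ := ‹Nonempty ι›
  have hb : BddAbove (Set.range fun k => (x (k + 1)).1) := by
    refine ⟨a, ?_⟩
    rintro _ ⟨k, rfl⟩
    exact ha _ _ _ ((subFeasible_iff hD hlam _ _).1 (hx k).1 i).1
  have h1 := tendsto_atTop_ciSup (hx.monotone hD hlam) hb
  exact ⟨_, (tendsto_add_atTop_iff_nat 1).1 h1, fun k => le_ciSup hb k⟩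

end IsRun

/-- Moving the linearization point changes t slightly, and δ|x|² absorbs the change of t|Kx|². This
lower semicontinuity of the optimal value lets optimality pass to limit points. -/
theorem eventually_subFeasible_sub (hD : IsCouplingData Q γ H) (hlam : ∀ i, lam i ≠ 0)
    {c₀ δ : ℝ} (hδ : 0 < δ) {q : ℝ × ℝ × ℝ} (hq : SubFeasible Q γ H lam c₀ q) :
    ∀ᶠ c in 𝓝 c₀, SubFeasible Q γ H lam c (q.1 - δ, q.2) := by
  obtain ⟨ε, hε, h⟩ := exists_pos_forall_form_nonneg
    (M := (1 : Matrix (Fin n) (Fin n) ℝ)) Matrix.PosSemidef.one (N := (gain H)ᵀ * gain H)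
    (by simp [Matrix.IsSymm]) (fun z hz => by
      rw [one_mulVec, dotProduct_self_eq_zero] at hz
      simp [hz])
  have hK : ∀ s z, |s| ≤ ε * δ → 0 ≤ δ * (z ⬝ᵥ z) + s * (gain H *ᵥ z ⬝ᵥ gain H *ᵥ z) := by
    intro s z hs
    have h1 := h (s / δ) (by rw [abs_div, abs_of_pos hδ, div_le_iff₀ hδ]; exact hs) z
    rw [← mulVec_mulVec, dotProduct_transpose_mulVec, one_mulVec] at h1
    have h2 := mul_nonneg hδ.le h1
    rw [mul_add, ← mul_assoc δ (s / δ), mul_div_cancel₀ _ hδ.ne'] at h2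
    exact h2
  simp only [subFeasible_iff hD hlam] at hq ⊢
  have hev : ∀ i, ∀ᶠ c in 𝓝 c₀, |(2 * c * q.2.2 - c ^ 2) * γ * ‖lam i‖ ^ 2
      - (2 * c₀ * q.2.2 - c₀ ^ 2) * γ * ‖lam i‖ ^ 2| < ε * δ := by
    intro i
    have hc : Continuous fun c : ℝ => |(2 * c * q.2.2 - c ^ 2) * γ * ‖lam i‖ ^ 2
      - (2 * c₀ * q.2.2 - c₀ ^ 2) * γ * ‖lam i‖ ^ 2| := by fun_prop
    exact hc.continuousAt.eventually_lt continuousAt_const (by simpa using mul_pos hε hδ)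
  filter_upwards [eventually_all.2 hev] with c hc i
  refine ⟨fun x u => ?_, (hq i).2⟩
  have h1 := (hq i).1 x u
  have h2 := hK _ x (hc i).le
  have h3 := mul_nonneg hδ.le (dotProduct_self_nonneg_real u)
  unfold couplingForm at h1 ⊢
  linarith

/-- A limit point solves its own subproblem. -/
theorem IsRun.subOptimal_of_mapClusterPt [Nonempty ι] {x : ℕ → ℝ × ℝ × ℝ}
    (hx : IsRun Q γ H lam x) (hD : IsCouplingData Q γ H) (hlam : ∀ i, lam i ≠ 0)
    {p : ℝ × ℝ × ℝ} (hp : MapClusterPt p atTop x) :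
    SubOptimal Q γ H lam p.2.2 p ∧ Tendsto (fun k => (x k).1) atTop (𝓝 p.1) := by
  obtain ⟨a, ha, hale⟩ := hx.exists_tendsto hD hlam
  obtain ⟨φ, hφ, hlim⟩ := hp.tendsto_subseq
  have hpa : p.1 = a := tendsto_nhds_unique ((continuous_fst.tendsto p).comp hlim)
    (ha.comp hφ.tendsto_atTop)
  have hfeas : SubFeasible Q γ H lam p.2.2 p := by
    refine subFeasible_of_tendsto hD hlam (c := fun k => (x (φ k)).2.2)
      (((continuous_snd.comp continuous_snd).tendsto p).comp hlim) hlim ?_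
    filter_upwards [eventually_ge_atTop 1] with k hk
    obtain ⟨j, hj⟩ := Nat.exists_eq_add_of_le' (hk.trans (hφ.id_le k))
    simp only [Function.comp, hj]
    exact (feasible_iff_subFeasible_self _).1 (hx.feasible hD hlam j)
  refine ⟨⟨hfeas, fun q hq => ?_⟩, hpa ▸ ha⟩
  by_contra hlt
  push Not at hlt
  -- Half the gap, so that the lowered competitor still beats the limit value.
  have hδ : 0 < (q.1 - p.1) / 2 := by linarith
  have h1 := (((continuous_snd.comp continuous_snd).tendsto p).comp hlim).eventually
    (eventually_subFeasible_sub hD hlam hδ hq)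
  obtain ⟨k, hk⟩ := h1.exists
  have h2 := (hx (φ k)).2 _ hk
  have h3 := hale (φ k)
  simp only at h2
  linarith

/-! ### Boundedness of the iterates -/

/-- The coupling constraint at infinity. -/
def RecessionIneq (γ : ℝ) (H : Matrix (Fin n ⊕ Fin m) (Fin n ⊕ Fin m) ℝ) (lam : ι → ℂ)
    (α : ℝ) : Prop :=
  ∀ i j x u, 0 ≤ γ * ‖lam i‖ ^ 2 * (gain H *ᵥ x ⬝ᵥ gain H *ᵥ x)
    + 2 * ‖lam j‖ * (u ⬝ᵥ H.toBlocks₂₂ *ᵥ gain H *ᵥ x) + u ⬝ᵥ H.toBlocks₂₂ *ᵥ u - α * (u ⬝ᵥ u)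

theorem couplingForm_nonneg_of_abs_le {α β β' t : ℝ} (hβ : |β'| ≤ β)
    (h : ∀ x u, 0 ≤ couplingForm Q H α β t x u) (x : Fin n → ℝ) (u : Fin m → ℝ) :
    0 ≤ couplingForm Q H α β' t x u := by
  obtain ⟨h1, h2⟩ := abs_le.1 hβ
  have h3 := h x u
  have h4 := h x (-u)
  rw [couplingForm_neg] at h4
  rcases (abs_nonneg β').trans hβ |>.eq_or_lt with h0 | h0
  · have : β' = β := by linarith
    rwa [this]
  unfold couplingForm at h3 h4 ⊢
  have h5 := mul_nonneg (by linarith : 0 ≤ β + β') h3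
  have h6 := mul_nonneg (by linarith : 0 ≤ β - β') h4
  refine nonneg_of_mul_nonneg_right (a := 2 * β) ?_ (by linarith)
  linarith

/-- Since β ≥ |c||λⱼ| - 1, the form may be tested at this smaller β and at (x, |c|u). There it
equals c² times the recession expression up to terms at most linear in |c|. -/
theorem recessionIneq_of_unbounded (hlam : ∀ i, lam i ≠ 0) (hD : IsCouplingData Q γ H) {α : ℝ}
    (h : ∀ R : ℝ, ∃ p, R < |p.2.2| ∧ α ≤ p.1 ∧ Feasible Q γ H lam p) :
    RecessionIneq γ H lam α := by
  intro i j x u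
  set E := γ * ‖lam i‖ ^ 2 * (gain H *ᵥ x ⬝ᵥ gain H *ᵥ x)
    + 2 * ‖lam j‖ * (u ⬝ᵥ H.toBlocks₂₂ *ᵥ gain H *ᵥ x) + u ⬝ᵥ H.toBlocks₂₂ *ᵥ u - α * (u ⬝ᵥ u)
    with hE
  set b := u ⬝ᵥ H.toBlocks₂₂ *ᵥ gain H *ᵥ x with hb
  set q := x ⬝ᵥ Q *ᵥ x - α * (x ⬝ᵥ x) with hq
  by_contra hneg
  push Not at hneg
  have hj : 0 < ‖lam j‖ := norm_pos_iff.2 (hlam j)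
  -- The threshold makes |c||λⱼ| - 1 nonnegative and makes c²E outweigh q - 2|c|b.
  obtain ⟨p, hpc, hpα, hp⟩ := h (1 / ‖lam j‖ + (|q| + 2 * |b|) / (-E) + 1)
  rw [feasible_iff_subFeasible_self, subFeasible_iff hD hlam] at hp
  have hE0 : 0 < -E := by linarith
  have hc1 : 1 ≤ |p.2.2| := by
    have h1 : 0 ≤ 1 / ‖lam j‖ := by positivity
    have h2 : 0 ≤ (|q| + 2 * |b|) / (-E) := by positivity
    linarith
  have hc2 : 1 ≤ |p.2.2| * ‖lam j‖ := by
    have h2 : 0 ≤ (|q| + 2 * |b|) / (-E) := by positivity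
    rw [← div_le_iff₀ hj]
    linarith
  have hc3 : |q| + 2 * |b| < |p.2.2| * (-E) := by
    rw [← div_lt_iff₀ hE0]
    have h1 : 0 ≤ 1 / ‖lam j‖ := by positivity
    linarith
  have hcl := abs_mul_norm_le (hp j).2
  have h1 := (couplingForm_nonneg_of_abs_le (β' := |p.2.2| * ‖lam j‖ - 1)
    (by rw [abs_of_nonneg (by linarith)]; linarith) (hp i).1 x (|p.2.2| • u)).trans
    (couplingForm_mono hpα le_rfl _ _)
  rw [couplingForm_smul, ← hb] at h1
  have h2 : q + |p.2.2| ^ 2 * E - 2 * |p.2.2| * b ≥ 0 := by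
    rw [hE, hq, sq_abs]
    have : |p.2.2| ^ 2 = p.2.2 ^ 2 := sq_abs _
    calc (0 : ℝ) ≤ _ := h1
      _ = _ := by ring_nf; rw [this]; ring
  have h3 : |p.2.2| * (|q| + 2 * |b|) ≤ |p.2.2| * (|p.2.2| * (-E)) :=
    mul_le_mul_of_nonneg_left hc3.le (abs_nonneg _)
  have h4 : |p.2.2| * (|q| + 2 * |b|) < |p.2.2| * (|p.2.2| * (-E)) :=
    mul_lt_mul_of_pos_left hc3 (by linarith)
  have h5 : q ≤ |p.2.2| * |q| := (le_abs_self q).trans (le_mul_of_one_le_left (abs_nonneg _) hc1)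
  have h6 : -(2 * |p.2.2| * b) ≤ 2 * |p.2.2| * |b| := by
    have := mul_le_mul_of_nonneg_left (neg_abs_le b) (by positivity : 0 ≤ 2 * |p.2.2|)
    linarith
  nlinarith

-- At u = -|λᵢ|Kx the expression is |λᵢ|² times γ|Kx|² - (Kx)ᵀH₂₂(Kx) - α|Kx|². For α ≥ 0 its
-- nonnegativity is the equality case of coercivity, where `strict` gives Kx = 0.
omit [Fintype ι] in
theorem RecessionIneq.neg [Nonempty ι] (hlam : ∀ i, lam i ≠ 0) (hD : IsCouplingData Q γ H)
    (hK : gain H ≠ 0) {α : ℝ} (h : RecessionIneq γ H lam α) : α < 0 := by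
  obtain ⟨x, hx⟩ : ∃ x, gain H *ᵥ x ≠ 0 := exists_mulVec_ne_zero hK
  obtain ⟨i⟩ := ‹Nonempty ι›
  by_contra hα
  push Not at hα
  apply hx
  apply hD.strict
  have h1 := h i i x (-(‖lam i‖ • gain H *ᵥ x))
  simp only [mulVec_neg, mulVec_smul, dotProduct_neg, neg_dotProduct, smul_dotProduct,
    dotProduct_smul, smul_eq_mul] at h1
  have hi : 0 < ‖lam i‖ := norm_pos_iff.2 (hlam i)
  have hy := dotProduct_self_nonneg_real (gain H *ᵥ x)
  have h2 : 0 ≤ ‖lam i‖ ^ 2 * (γ * (gain H *ᵥ x ⬝ᵥ gain H *ᵥ x)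
      - gain H *ᵥ x ⬝ᵥ H.toBlocks₂₂ *ᵥ gain H *ᵥ x - α * (gain H *ᵥ x ⬝ᵥ gain H *ᵥ x)) := by
    linarith
  have h3 := nonneg_of_mul_nonneg_right h2 (by positivity)
  nlinarith [mul_nonneg hα hy]

omit [Fintype ι] in
theorem RecessionIneq.of_tendsto {α : ℕ → ℝ} {a : ℝ} (hα : Tendsto α atTop (𝓝 a))
    (h : ∀ k, RecessionIneq γ H lam (α k)) : RecessionIneq γ H lam a := by
  intro i j x u
  have hc : Continuous fun α : ℝ => γ * ‖lam i‖ ^ 2 * (gain H *ᵥ x ⬝ᵥ gain H *ᵥ x)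
    + 2 * ‖lam j‖ * (u ⬝ᵥ H.toBlocks₂₂ *ᵥ gain H *ᵥ x) + u ⬝ᵥ H.toBlocks₂₂ *ᵥ u
    - α * (u ⬝ᵥ u) := by fun_prop
  exact ge_of_tendsto' ((hc.tendsto a).comp hα) fun k => h k i j x u

theorem SubOptimal.lt_of_form_pos (hlam : ∀ i, lam i ≠ 0) (hD : IsCouplingData Q γ H) {c₀ : ℝ}
    {p : ℝ × ℝ × ℝ} (hp : SubOptimal Q γ H lam c₀ p) {α β c : ℝ}
    (h : ∀ i x u, (x ≠ 0 ∨ u ≠ 0) →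
      0 < couplingForm Q H α β ((2 * c₀ * c - c₀ ^ 2) * γ * ‖lam i‖ ^ 2) x u)
    (hN : ∀ i, ‖1 - (c : ℂ) * lam i‖ ≤ β) : α < p.1 := by
  obtain ⟨ε, hε, hf⟩ := exists_increase_of_form_pos hD h
  have := hp.2 (α + ε, β, c) ((subFeasible_iff hD hlam _ _).2 fun i => ⟨hf i, hN i⟩)
  simp only at this
  linarith

/-- For such c₀ one has |1 - c₀λⱼ| ≤ c₀|λⱼ|, so the recession inequality at (c₀x, ±u) controls the
coupling term at c = c₀. As -α|x|² adds strict positivity, α can still be raised. -/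
theorem RecessionIneq.lt_of_subOptimal [Nonempty ι] (hlam : ∀ i, lam i ≠ 0)
    (hD : IsCouplingData Q γ H) {α : ℝ} (h : RecessionIneq γ H lam α) (hα : α < 0) {c₀ : ℝ}
    (hc₀ : 0 < c₀) (hlarge : ∀ j, 1 < 2 * c₀ * (lam j).re) {p : ℝ × ℝ × ℝ}
    (hp : SubOptimal Q γ H lam c₀ p) : α < p.1 := by
  obtain ⟨j, hj⟩ := Finite.exists_max fun j => ‖1 - (c₀ : ℂ) * lam j‖
  refine hp.lt_of_form_pos hlam hD (β := ‖1 - (c₀ : ℂ) * lam j‖) (c := c₀) ?_ hj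
  intro i x u hxu
  have hβ : ‖1 - (c₀ : ℂ) * lam j‖ ≤ c₀ * ‖lam j‖ := by
    refine abs_le_of_sq_le_sq' ?_ (by positivity) |>.2
    rw [norm_sq_one_sub_mul]
    nlinarith [hlarge j]
  set β := ‖1 - (c₀ : ℂ) * lam j‖ with hβdef
  have hβ0 : 0 ≤ β := norm_nonneg _
  have h1 := h i j (c₀ • x) u
  have h2 := h i j (c₀ • x) (-u)
  simp only [mulVec_smul, mulVec_neg, dotProduct_neg, neg_dotProduct, neg_neg, smul_dotProduct,
    dotProduct_smul, smul_eq_mul] at h1 h2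
  have hj0 : 0 < ‖lam j‖ := norm_pos_iff.2 (hlam j)
  set b := u ⬝ᵥ H.toBlocks₂₂ *ᵥ gain H *ᵥ x with hb
  set y := gain H *ᵥ x ⬝ᵥ gain H *ᵥ x with hy
  have hD0 : 0 < c₀ * ‖lam j‖ := by positivity
  have h3 : 0 ≤ γ * ‖lam i‖ ^ 2 * (c₀ ^ 2 * y) + 2 * β * b
      + u ⬝ᵥ H.toBlocks₂₂ *ᵥ u - α * (u ⬝ᵥ u) := by
    have h5 := mul_nonneg (by linarith : 0 ≤ c₀ * ‖lam j‖ + β) h1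
    have h6 := mul_nonneg (by linarith : 0 ≤ c₀ * ‖lam j‖ - β) h2
    refine nonneg_of_mul_nonneg_right (a := 2 * (c₀ * ‖lam j‖)) ?_ (by linarith)
    linarith
  have hform : couplingForm Q H α β ((2 * c₀ * c₀ - c₀ ^ 2) * γ * ‖lam i‖ ^ 2) x u
      = x ⬝ᵥ Q *ᵥ x - α * (x ⬝ᵥ x) + (γ * ‖lam i‖ ^ 2 * (c₀ ^ 2 * y) + 2 * β * b
      + u ⬝ᵥ H.toBlocks₂₂ *ᵥ u - α * (u ⬝ᵥ u)) := by
    rw [couplingForm, ← hb, ← hy]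
    ring
  by_cases hx : x = 0
  · subst hx
    have hu : u ≠ 0 := by simpa using hxu
    have hu2 := dotProduct_self_pos_real hu
    have := hD.coercive u
    simp only [couplingForm, mulVec_zero, dotProduct_zero, mul_zero]
    nlinarith [mul_pos hD.pos hu2, mul_pos (neg_pos.2 hα) hu2]
  · have hx2 := dotProduct_self_pos_real hx
    have hq := ((posSemidef_iff_real Q).1 hD.posSemidef).2 x
    rw [hform]
    nlinarith [mul_pos (neg_pos.2 hα) hx2]

/-- For c < 0 and Re λ > 0, |1 - cλ| > 1. If α < 0, passing to c = 0, β = 1 therefore lowers β, does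
not lower the linearization, and makes the form strictly positive, so α was not optimal. -/
theorem SubOptimal.nonneg_of_neg [Nonempty ι] (hre : ∀ i, 0 < (lam i).re)
    (hD : IsCouplingData Q γ H) {c₀ : ℝ} (hc₀ : 0 ≤ c₀) {p : ℝ × ℝ × ℝ}
    (hp : SubOptimal Q γ H lam c₀ p) (hc : p.2.2 < 0) : 0 ≤ p.1 := by
  have hlam : ∀ i, lam i ≠ 0 := fun i h => by simpa [h] using hre i
  by_contra hα
  push Not at hα
  have hf := (subFeasible_iff hD hlam _ _).1 hp.1
  refine lt_irrefl p.1 (hp.lt_of_form_pos hlam hD (β := 1) (c := 0) (fun i x u hxu => ?_)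
    (by simp))
  refine couplingForm_pos_of_abs_lt hD hα ?_ ?_ (hf i).1 x u hxu
  · rw [abs_one]
    refine lt_of_lt_of_le ?_ (hf i).2
    refine lt_of_pow_lt_pow_left₀ 2 (norm_nonneg _) ?_
    rw [norm_sq_one_sub_mul]
    nlinarith [mul_pos (neg_pos.2 hc) (hre i), sq_nonneg (p.2.2 * ‖lam i‖)]
  · refine mul_le_mul_of_nonneg_right (mul_le_mul_of_nonneg_right ?_ hD.pos.le) (sq_nonneg _)
    nlinarith

/-- Unbounded gains put every value under the recession inequality, which makes it negative and
keeps all gains nonnegative. The inequality passes to the limit value, yet the iterate after a large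
gain would exceed that value. -/
theorem IsRun.isBounded [Nonempty ι] {x : ℕ → ℝ × ℝ × ℝ} (hx : IsRun Q γ H lam x)
    (hre : ∀ i, 0 < (lam i).re) (hD : IsCouplingData Q γ H) (hK : gain H ≠ 0)
    (hc₀ : 0 ≤ (x 0).2.2) : Bornology.IsBounded (Set.range x) := by
  have hlam : ∀ i, lam i ≠ 0 := fun i h => by simpa [h] using hre i
  have hmono := hx.monotone hD hlam
  by_cases hb : ∃ R, ∀ k, |(x (k + 1)).2.2| ≤ R
  · obtain ⟨R, hR⟩ := hb
    obtain ⟨B, hB⟩ := exists_bound_of_subFeasible hD hlam hK R (x 1).1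
    refine (Metric.isBounded_closedBall (x := 0) (r := max ‖x 0‖ B)).subset ?_
    rintro _ ⟨k, rfl⟩
    rw [mem_closedBall_zero_iff]
    rcases k with _ | k
    · exact le_max_left _ _
    · exact le_max_of_le_right (hB _ _ (hR k)
        ((feasible_iff_subFeasible_self _).1 (hx.feasible hD hlam k)) (hmono (Nat.zero_le k)))
  exfalso
  push Not at hb
  have hrec : ∀ k, RecessionIneq γ H lam (x (k + 1)).1 := by
    intro k
    refine recessionIneq_of_unbounded hlam hD fun R => ?_
    -- M bounds the finitely many gains before k, so a gain beyond it occurs later, where the value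
    -- is no smaller.
    obtain ⟨M, hM⟩ := ((Set.finite_Iio k).image fun j => |(x (j + 1)).2.2|).bddAbove
    obtain ⟨j, hj⟩ := hb (max R M)
    have hkj : k ≤ j := by
      by_contra hlt
      have : |(x (j + 1)).2.2| ≤ M := hM ⟨j, not_le.1 hlt, rfl⟩
      linarith [le_max_right R M]
    exact ⟨x (j + 1), lt_of_le_of_lt (le_max_left _ _) hj, hmono hkj, hx.feasible hD hlam j⟩
  have hneg : ∀ k, (x (k + 1)).1 < 0 := fun k => (hrec k).neg hlam hD hK
  have hc : ∀ k, 0 ≤ (x k).2.2 := by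
    intro k
    induction k with
    | zero => exact hc₀
    | succ k ih =>
      by_contra hlt
      linarith [hneg k, (hx k).nonneg_of_neg hre hD ih (not_le.1 hlt)]
  obtain ⟨a, ha, hale⟩ := hx.exists_tendsto hD hlam
  have hra : RecessionIneq γ H lam a :=
    RecessionIneq.of_tendsto ((tendsto_add_atTop_iff_nat 1).2 ha) hrec
  obtain ⟨i, hi⟩ := Finite.exists_min fun i => (lam i).re
  obtain ⟨k, hk⟩ := hb (1 / (lam i).re)
  rw [abs_of_nonneg (hc _), div_lt_iff₀ (hre i)] at hk
  have hcpos : 0 < (x (k + 1)).2.2 := by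
    by_contra h0
    have : (x (k + 1)).2.2 = 0 := le_antisymm (not_lt.1 h0) (hc _)
    rw [this] at hk
    linarith
  have := hra.lt_of_subOptimal hlam hD (hra.neg hlam hD hK) hcpos (fun j => by
    have := mul_le_mul_of_nonneg_left (hi j) hcpos.le
    linarith) (hx (k + 1))
  linarith [hale (k + 1)]

end Run

/-! ### Lagrange multipliers -/

/-- Lagrange duality for the maximization of a linear functional under a conic constraint that
satisfies Slater's condition. -/
theorem exists_lagrange_functional {V W : Type*} [AddCommGroup V] [Module ℝ V]
    [TopologicalSpace W] [AddCommGroup W] [Module ℝ W] [IsTopologicalAddGroup W]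
    [ContinuousSMul ℝ W] {K : Set W} (hopen : IsOpen K) (hconv : Convex ℝ K)
    (hsmul : ∀ t : ℝ, 0 < t → ∀ k ∈ K, t • k ∈ K) (g : V →ₗ[ℝ] ℝ) (F : V → W)
    (hF : ∀ p q (a b : ℝ), a + b = 1 → F (a • p + b • q) = a • F p + b • F q) (p : V)
    (hmax : ∀ q, F q ∈ K → g q ≤ g p) (hslater : ∃ q, F q ∈ K) :
    ∃ φ : W →L[ℝ] ℝ, (∀ k ∈ K, 0 ≤ φ k) ∧ ∀ q, g q + φ (F q) ≤ g p := by
  obtain ⟨q₀, hq₀⟩ := hslater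
  set T : Set (ℝ × W) := Set.range fun q => (g q - g p, F q) with hT
  have hTconv : Convex ℝ T := by
    rintro _ ⟨q, rfl⟩ _ ⟨q', rfl⟩ a b - - hab
    refine ⟨a • q + b • q', ?_⟩
    simp only [hF _ _ _ _ hab, map_add, map_smul, smul_eq_mul, Prod.smul_mk, Prod.mk_add_mk,
      Prod.mk.injEq, and_true]
    linear_combination g p * hab
  have hdisj : Disjoint (Set.Ioi (0 : ℝ) ×ˢ K) T := by
    rw [Set.disjoint_left]
    rintro _ ⟨h1, h2⟩ ⟨q, rfl⟩
    have := hmax q h2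
    have h3 : 0 < g q - g p := h1
    linarith
  -- Optimality of p separates (0, ∞) × K from T: f < u on the former and f ≥ u on T.
  obtain ⟨f, u, hfu, huf⟩ := geometric_hahn_banach_open ((convex_Ioi 0).prod hconv)
    (isOpen_Ioi.prod hopen) hTconv hdisj
  have hu : 0 ≤ u := by
    by_contra hu
    push Not at hu
    have h1 := hfu ((1 : ℝ), F q₀) ⟨Set.mem_Ioi.2 one_pos, hq₀⟩
    have h2 : f ((1 : ℝ), F q₀) < 0 := h1.trans hu
    have h3 : 0 < u / (2 * f ((1 : ℝ), F q₀)) := div_pos_of_neg_of_neg hu (by linarith)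
    have h4 := hfu ((u / (2 * f ((1 : ℝ), F q₀))) • ((1 : ℝ), F q₀))
      ⟨by simpa using h3, hsmul _ h3 _ hq₀⟩
    rw [map_smul, smul_eq_mul] at h4
    have h5 : u / (2 * f ((1 : ℝ), F q₀)) * f ((1 : ℝ), F q₀) = u / 2 := by
      have h6 : f ((1 : ℝ), F q₀) ≠ 0 := h2.ne
      rw [div_mul_eq_mul_div, div_eq_div_iff (mul_ne_zero two_ne_zero h6) two_ne_zero]
      ring
    linarith
  have hA : ∀ r : ℝ, 0 < r → ∀ k ∈ K, f (r, k) ≤ 0 := by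
    intro r hr k hk
    by_contra hpos
    push Not at hpos
    have h3 : 0 < (u + 1) / f (r, k) := div_pos (by linarith) hpos
    have h4 := hfu (((u + 1) / f (r, k)) • (r, k))
      ⟨by simpa using mul_pos h3 hr, hsmul _ h3 _ hk⟩
    rw [map_smul, smul_eq_mul, div_mul_cancel₀ _ hpos.ne'] at h4
    linarith
  have hB : ∀ q, 0 ≤ f (g q - g p, F q) := fun q => hu.trans (huf _ ⟨q, rfl⟩)
  have hsplit : ∀ r w, f (r, w) = r * f (1, 0) + f (0, w) := by
    intro r w
    rw [← smul_eq_mul, ← map_smul, ← map_add]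
    simp
  have hK : ∀ k ∈ K, f (0, k) ≤ 0 := by
    intro k hk
    refine le_of_forall_pos_le_add fun ε hε => ?_
    have hd : 0 < |f (1, 0)| + 1 := by positivity
    have h1 := hA (ε / (|f (1, 0)| + 1)) (by positivity) k hk
    rw [hsplit] at h1
    have h2 : -(ε / (|f (1, 0)| + 1) * f (1, 0)) ≤ ε := by
      rw [← mul_neg, div_mul_eq_mul_div, div_le_iff₀ hd]
      nlinarith [neg_abs_le (f (1, 0))]
    linarith
  -- Slater's condition makes the hyperplane nonvertical: if f(1, 0) = 0, then f(0, ·) is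
  -- nonpositive on the open set K and zero at F q₀ ∈ K, hence zero everywhere, against strict
  -- separation.
  have hτ : f (1, 0) < 0 := by
    by_contra hτ
    push Not at hτ
    have h0 : f (1, 0) = 0 := by
      refine le_antisymm ?_ hτ
      by_contra hpos
      push Not at hpos
      have h1 := hA ((1 - f (0, F q₀)) / f (1, 0))
        (div_pos (by linarith [hK _ hq₀]) hpos) _ hq₀
      rw [hsplit, div_mul_cancel₀ _ hpos.ne'] at h1
      linarith
    have hq : f (0, F q₀) = 0 := by
      refine le_antisymm (hK _ hq₀) ?_
      have := hB q₀
      rw [hsplit, h0] at this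
      linarith
    have hzero : ∀ w, f (0, w) = 0 := by
      have hle : ∀ w, f (0, w) ≤ 0 := by
        intro w
        have hcont : Continuous fun t : ℝ => F q₀ + t • w := by fun_prop
        have hmem : ∀ᶠ t in 𝓝 (0 : ℝ), F q₀ + t • w ∈ K :=
          hcont.continuousAt.eventually_mem (hopen.mem_nhds (by simpa using hq₀))
        obtain ⟨t, ht, htpos⟩ := (hmem.filter_mono nhdsWithin_le_nhds).and
          (self_mem_nhdsWithin (a := (0 : ℝ)) (s := Set.Ioi 0)) |>.exists
        have h1 := hK _ ht
        have h2 : f (0, F q₀ + t • w) = f (0, F q₀) + t * f (0, w) := by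
          rw [← smul_eq_mul, ← map_smul, ← map_add]
          simp
        rw [h2, hq, zero_add] at h1
        exact nonpos_of_mul_nonpos_right h1 htpos
      intro w
      refine le_antisymm (hle w) ?_
      have h1 := hle (-w)
      have h2 : f (0, -w) = -f (0, w) := by
        rw [← map_neg]
        simp
      linarith
    have h1 := hfu ((1 : ℝ), F q₀) ⟨Set.mem_Ioi.2 one_pos, hq₀⟩
    rw [hsplit, h0, hzero] at h1
    have h2 := huf _ ⟨p, rfl⟩
    rw [hsplit, h0, hzero] at h2
    linarith
  refine ⟨(f (1, 0))⁻¹ • f.comp (ContinuousLinearMap.inr ℝ ℝ W), fun k hk => ?_, fun q => ?_⟩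
  · simpa using mul_nonneg_of_nonpos_of_nonpos (inv_nonpos.2 hτ.le) (hK k hk)
  · have h1 := hB q
    rw [hsplit] at h1
    have h2 := mul_nonpos_of_nonpos_of_nonneg (inv_nonpos.2 hτ.le) h1
    rw [mul_add, mul_comm (g q - g p), ← mul_assoc, inv_mul_cancel₀ hτ.ne, one_mul] at h2
    simp only [_root_.smul_apply, ContinuousLinearMap.comp_apply,
      ContinuousLinearMap.inr_apply, smul_eq_mul]
    linarith

/-- A linear functional on matrices that is nonnegative on positive forms is the trace pairing
with a positive semidefinite matrix. -/
theorem exists_posSemidef_trace {d : Type*} [Fintype d] [DecidableEq d]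
    (f : Matrix d d ℝ →ₗ[ℝ] ℝ) (h : ∀ M : Matrix d d ℝ, (∀ z, 0 ≤ z ⬝ᵥ M *ᵥ z) → 0 ≤ f M) :
    ∃ Z : Matrix d d ℝ, Z.PosSemidef ∧ ∀ M, f M = (Z * M).trace := by
  set Z : Matrix d d ℝ := Matrix.of fun j i => f (Matrix.single i j 1) with hZ
  have htr : ∀ M, f M = (Z * M).trace := by
    intro M
    conv_lhs => rw [Matrix.matrix_eq_sum_single M]
    simp only [map_sum, trace, diag_apply, mul_apply, hZ, of_apply]
    rw [Finset.sum_comm]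
    refine Finset.sum_congr rfl fun j _ => Finset.sum_congr rfl fun i _ => ?_
    have : Matrix.single i j (M i j) = M i j • Matrix.single i j (1 : ℝ) := by
      simp [Matrix.smul_single]
    rw [this, map_smul, smul_eq_mul, mul_comm]
  refine ⟨Z, ?_, htr⟩
  rw [posSemidef_iff_real]
  constructor
  -- Skew matrices have zero form, so f is nonnegative on them and on their negatives; this makes Z
  -- symmetric.
  · have hskew : ∀ i j, f (Matrix.single i j 1 - Matrix.single j i 1) = 0 := by
      have h1 : ∀ i j, 0 ≤ f (Matrix.single i j 1 - Matrix.single j i 1) := by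
        intro i j
        refine h _ fun z => ?_
        have h2 : z ⬝ᵥ Matrix.single j i 1 *ᵥ z = z ⬝ᵥ Matrix.single i j 1 *ᵥ z := by
          rw [← dotProduct_transpose_mulVec, transpose_single]
        rw [sub_mulVec, dotProduct_sub, h2, sub_self]
      intro i j
      refine le_antisymm ?_ (h1 i j)
      have := h1 j i
      rw [← neg_sub, map_neg] at this
      linarith
    ext i j
    have := hskew i j
    rw [map_sub] at this
    simp only [hZ, transpose_apply, of_apply]
    linarith
  · intro z
    have h1 := h (vecMulVec z z) (fun y => by
      rw [vecMulVec_mulVec, dotProduct_smul, MulOpposite.smul_eq_mul_unop, dotProduct_comm]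
      exact mul_self_nonneg _)
    rw [htr, mul_vecMulVec, trace_vecMulVec, dotProduct_comm] at h1
    exact h1

theorem isOpen_setOf_form_pos {d : Type*} [Fintype d] :
    IsOpen {M : Matrix d d ℝ | ∀ z, z ≠ 0 → 0 < z ⬝ᵥ M *ᵥ z} := by
  have hset : {M : Matrix d d ℝ | ∀ z, z ≠ 0 → 0 < z ⬝ᵥ M *ᵥ z}
      = {M : Matrix d d ℝ | ∀ z ∈ Metric.sphere (0 : d → ℝ) 1, 0 < z ⬝ᵥ M *ᵥ z} := by
    ext M
    constructor
    · intro h z hz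
      refine h z fun h0 => ?_
      simp [h0] at hz
    · intro h z hz
      have hn : 0 < ‖z‖ := norm_pos_iff.2 hz
      have h1 := h (‖z‖⁻¹ • z) (by simp [norm_smul, hn.ne'])
      simp only [mulVec_smul, smul_dotProduct, dotProduct_smul, smul_eq_mul] at h1
      exact pos_of_mul_pos_right (pos_of_mul_pos_right h1 (by positivity)) (by positivity)
  rw [hset, isOpen_iff_eventually]
  intro M hM
  refine (isCompact_sphere (0 : d → ℝ) 1).eventually_forall_of_forall_eventually fun z hz => ?_
  have hc : Continuous fun q : Matrix d d ℝ × (d → ℝ) => q.2 ⬝ᵥ q.1 *ᵥ q.2 := by fun_prop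
  exact continuousAt_const.eventually_lt hc.continuousAt (hM z hz)

section Stationary

variable {n m : ℕ} {Q : Matrix (Fin n) (Fin n) ℝ} {γ : ℝ}
  {H : Matrix (Fin n ⊕ Fin m) (Fin n ⊕ Fin m) ℝ} {ι : Type*} [Fintype ι] {lam : ι → ℂ}

theorem couplingMatrix_sub_affine (α α' β β' s s' : ℝ) (l : ℂ) {a b : ℝ} (hab : a + b = 1) :
    couplingMatrix Q γ H (a * β + b * β') (a * s + b * s') l - (a * α + b * α') • 1
      = a • (couplingMatrix Q γ H β s l - α • 1)
        + b • (couplingMatrix Q γ H β' s' l - α' • 1) := by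
  obtain rfl : b = 1 - a := by linarith
  ext (i | i) (j | j) <;> simp [couplingMatrix] <;> ring

theorem modeLMI_affine (β β' c c' : ℝ) (l : ℂ) {a b : ℝ} (hab : a + b = 1) :
    modeLMI (a * β + b * β') (a * c + b * c') l = a • modeLMI β c l + b • modeLMI β' c' l := by
  obtain rfl : b = 1 - a := by linarith
  ext i j
  fin_cases i <;> fin_cases j <;> simp [modeLMI] <;> ring

theorem modeLMI_form_pos {l : ℂ} (hl : l ≠ 0) {β c : ℝ} (h : ‖1 - (c : ℂ) * l‖ < β)
    (z : Fin 2 → ℝ) (hz : z ≠ 0) : 0 < z ⬝ᵥ modeLMI β c l *ᵥ z := by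
  have h1 := ((posSemidef_iff_real _).1 ((posSemidef_modeLMI_iff hl _ c).2 le_rfl)).2 z
  have h2 : modeLMI β c l = modeLMI ‖1 - (c : ℂ) * l‖ c l
      + (β - ‖1 - (c : ℂ) * l‖) • (1 : Matrix (Fin 2) (Fin 2) ℝ) := by
    ext i j
    fin_cases i <;> fin_cases j <;> simp [modeLMI] <;> ring
  rw [h2, add_mulVec, dotProduct_add, smul_mulVec, one_mulVec, dotProduct_smul, smul_eq_mul]
  have h3 := dotProduct_self_pos_real hz
  nlinarith [mul_pos (sub_pos.2 h) h3]

/-- A point that solves its own subproblem is stationary for the non-convex problem. -/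
theorem isStationaryPoint_of_subOptimal (hD : IsCouplingData Q γ H) (hlam : ∀ i, lam i ≠ 0)
    {p : ℝ × ℝ × ℝ} (hp : SubOptimal Q γ H lam p.2.2 p) : IsStationaryPoint Q γ H lam p := by
  classical
  refine ⟨(feasible_iff_subFeasible_self p).2 hp.1, ?_⟩
  set F : ℝ × ℝ × ℝ → (ι → Matrix (Fin n ⊕ Fin m) (Fin n ⊕ Fin m) ℝ) ×
    (ι → Matrix (Fin 2) (Fin 2) ℝ) := fun q =>
    (fun i => Sl Q γ H q.2.1 q.2.2 p.2.2 (lam i) - q.1 • 1, fun i => modeLMI q.2.1 q.2.2 (lam i))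
    with hFdef
  -- Nonsymmetric matrices are included, so that the cone is open in the full matrix space.
  set K : Set ((ι → Matrix (Fin n ⊕ Fin m) (Fin n ⊕ Fin m) ℝ) ×
    (ι → Matrix (Fin 2) (Fin 2) ℝ)) := {w | ∀ i, (∀ z, z ≠ 0 → 0 < z ⬝ᵥ w.1 i *ᵥ z) ∧
      ∀ z, z ≠ 0 → 0 < z ⬝ᵥ w.2 i *ᵥ z} with hKdef
  have hmemK : ∀ w, w ∈ K ↔ ∀ i, (∀ z, z ≠ 0 → 0 < z ⬝ᵥ w.1 i *ᵥ z) ∧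
      ∀ z, z ≠ 0 → 0 < z ⬝ᵥ w.2 i *ᵥ z := fun w => Iff.rfl
  have hopen : IsOpen K := by
    have : K = ⋂ i, ((fun w => w.1 i) ⁻¹' {M | ∀ z, z ≠ 0 → 0 < z ⬝ᵥ M *ᵥ z}) ∩
        ((fun w => w.2 i) ⁻¹' {M | ∀ z, z ≠ 0 → 0 < z ⬝ᵥ M *ᵥ z}) := by
      ext w
      simp [hKdef]
    rw [this]
    refine isOpen_iInter_of_finite fun i => IsOpen.inter ?_ ?_
    · exact isOpen_setOf_form_pos.preimage (by fun_prop)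
    · exact isOpen_setOf_form_pos.preimage (by fun_prop)
  have hsmul : ∀ t : ℝ, 0 < t → ∀ k ∈ K, t • k ∈ K := by
    intro t ht k hk
    rw [hmemK] at hk ⊢
    intro i
    refine ⟨fun z hz => ?_, fun z hz => ?_⟩
    · have := (hk i).1 z hz
      simp only [Prod.smul_fst, Pi.smul_apply, smul_mulVec, dotProduct_smul, smul_eq_mul]
      positivity
    · have := (hk i).2 z hz
      simp only [Prod.smul_snd, Pi.smul_apply, smul_mulVec, dotProduct_smul, smul_eq_mul]
      positivity
  have hadd : ∀ k ∈ K, ∀ k' ∈ K, k + k' ∈ K := by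
    intro k hk k' hk'
    rw [hmemK] at hk hk' ⊢
    intro i
    refine ⟨fun z hz => ?_, fun z hz => ?_⟩
    · simpa only [Prod.fst_add, Pi.add_apply, add_mulVec, dotProduct_add] using
        add_pos ((hk i).1 z hz) ((hk' i).1 z hz)
    · simpa only [Prod.snd_add, Pi.add_apply, add_mulVec, dotProduct_add] using
        add_pos ((hk i).2 z hz) ((hk' i).2 z hz)
  have hconv : Convex ℝ K := by
    intro k hk k' hk' a b ha hb hab
    rcases ha.eq_or_lt with rfl | ha
    · obtain rfl : b = 1 := by linarith
      simpa using hk'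
    rcases hb.eq_or_lt with rfl | hb
    · obtain rfl : a = 1 := by linarith
      simpa using hk
    exact hadd _ (hsmul a ha k hk) _ (hsmul b hb k' hk')
  have hF : ∀ q q' (a b : ℝ), a + b = 1 → F (a • q + b • q') = a • F q + b • F q' := by
    intro q q' a b hab
    refine Prod.ext (funext fun i => ?_) (funext fun i => ?_)
    · have h1 : 2 * p.2.2 * (a * q.2.2 + b * q'.2.2) - p.2.2 ^ 2
          = a * (2 * p.2.2 * q.2.2 - p.2.2 ^ 2) + b * (2 * p.2.2 * q'.2.2 - p.2.2 ^ 2) := by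
        linear_combination p.2.2 ^ 2 * hab
      simp only [hFdef, Sl, Prod.fst_add, Prod.snd_add, Prod.smul_fst, Prod.smul_snd,
        smul_eq_mul, Pi.add_apply, Pi.smul_apply, h1]
      exact couplingMatrix_sub_affine _ _ _ _ _ _ _ hab
    · simp only [hFdef, Prod.fst_add, Prod.snd_add, Prod.smul_fst, Prod.smul_snd,
        smul_eq_mul, Pi.add_apply, Pi.smul_apply]
      exact modeLMI_affine _ _ _ _ _ hab
  have hformF : ∀ q i x u, Sum.elim x u ⬝ᵥ (F q).1 i *ᵥ Sum.elim x u
      = couplingForm Q H q.1 q.2.1 ((2 * p.2.2 * q.2.2 - p.2.2 ^ 2) * γ * ‖lam i‖ ^ 2) x u :=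
    fun q i x u => couplingMatrix_form hD _ _ _ _ _ _
  have hmax : ∀ q, F q ∈ K → LinearMap.fst ℝ ℝ (ℝ × ℝ) q ≤ LinearMap.fst ℝ ℝ (ℝ × ℝ) p := by
    intro q hq
    refine hp.2 q fun i => ?_
    rw [hmemK] at hq
    refine ⟨(posSemidef_iff_real _).2 ⟨(couplingMatrix_isSymm hD _ _ _).sub
      (by simp [Matrix.IsSymm]), fun z => ?_⟩, (posSemidef_iff_real _).2 ⟨?_, fun z => ?_⟩⟩
    · by_cases hz : z = 0
      · simp [hz]
      · exact ((hq i).1 z hz).le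
    · ext i j
      fin_cases i <;> fin_cases j <;> simp [modeLMI]
    · by_cases hz : z = 0
      · simp [hz]
      · exact ((hq i).2 z hz).le
  have hslater : ∃ q, F q ∈ K := by
    obtain ⟨q, -, hq⟩ := exists_strictly_subFeasible hD lam p.2.2 0
    refine ⟨q, (hmemK _).2 fun i => ⟨fun z hz => ?_, modeLMI_form_pos (hlam i) (hq i).2⟩⟩
    rw [← Sum.elim_comp_inl_inr z, hformF]
    refine (hq i).1 _ _ ?_
    by_contra hcon
    push Not at hcon
    apply hz
    rw [← Sum.elim_comp_inl_inr z, hcon.1, hcon.2]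
    ext (i | i) <;> rfl
  obtain ⟨φ, hφK, hφ⟩ := exists_lagrange_functional hopen hconv hsmul
    (LinearMap.fst ℝ ℝ (ℝ × ℝ)) F hF p hmax hslater
  simp only [LinearMap.fst_apply] at hφ
  -- nonnegativity passes to the closed cone
  have hφ0 : ∀ w : (ι → Matrix (Fin n ⊕ Fin m) (Fin n ⊕ Fin m) ℝ) ×
      (ι → Matrix (Fin 2) (Fin 2) ℝ),
      (∀ i, (∀ z, 0 ≤ z ⬝ᵥ w.1 i *ᵥ z) ∧ ∀ z, 0 ≤ z ⬝ᵥ w.2 i *ᵥ z) → 0 ≤ φ w := by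
    intro w hw
    obtain ⟨q, hq⟩ := hslater
    have hmem : ∀ ε : ℝ, 0 < ε → w + ε • F q ∈ K := by
      intro ε hε
      have h1 := (hmemK _).1 (hsmul ε hε _ hq)
      refine (hmemK _).2 fun i => ⟨fun z hz => ?_, fun z hz => ?_⟩
      · simpa only [Prod.fst_add, Pi.add_apply, add_mulVec, dotProduct_add] using
          add_pos_of_nonneg_of_pos ((hw i).1 z) ((h1 i).1 z hz)
      · simpa only [Prod.snd_add, Pi.add_apply, add_mulVec, dotProduct_add] using
          add_pos_of_nonneg_of_pos ((hw i).2 z) ((h1 i).2 z hz)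
    have hq0 := hφK _ hq
    by_contra hneg
    push Not at hneg
    have h2 := hφK _ (hmem (-φ w / (φ (F q) + 1)) (div_pos (by linarith) (by linarith)))
    rw [map_add, map_smul, smul_eq_mul] at h2
    have h3 : φ w + -φ w / (φ (F q) + 1) * φ (F q) = φ w / (φ (F q) + 1) := by
      have : φ (F q) + 1 ≠ 0 := by linarith
      field_simp
      ring
    rw [h3] at h2
    exact absurd h2 (not_le.2 (div_neg_of_neg_of_pos hneg (by linarith)))
  have hZ : ∀ i, ∃ Z : Matrix (Fin n ⊕ Fin m) (Fin n ⊕ Fin m) ℝ, Z.PosSemidef ∧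
      ∀ M, φ (Pi.single i M, 0) = (Z * M).trace := by
    intro i
    refine exists_posSemidef_trace (φ.toLinearMap ∘ₗ LinearMap.inl ℝ _ (ι → Matrix (Fin 2) (Fin 2) ℝ) ∘ₗ
      LinearMap.single ℝ (fun _ : ι => Matrix (Fin n ⊕ Fin m) (Fin n ⊕ Fin m) ℝ) i)
      (fun M hM => ?_)
    refine hφ0 _ fun j => ⟨fun z => ?_, fun z => by simp⟩
    by_cases hij : j = i
    · subst hij
      simpa using hM z
    · simp [Pi.single_eq_of_ne hij]
  have hY : ∀ i, ∃ Y : Matrix (Fin 2) (Fin 2) ℝ, Y.PosSemidef ∧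
      ∀ M, φ (0, Pi.single i M) = (Y * M).trace := by
    intro i
    refine exists_posSemidef_trace (φ.toLinearMap ∘ₗ LinearMap.inr ℝ
      (ι → Matrix (Fin n ⊕ Fin m) (Fin n ⊕ Fin m) ℝ) _ ∘ₗ
      LinearMap.single ℝ (fun _ : ι => Matrix (Fin 2) (Fin 2) ℝ) i) (fun M hM => ?_)
    refine hφ0 _ fun j => ⟨fun z => by simp, fun z => ?_⟩
    by_cases hij : j = i
    · subst hij
      simpa using hM z
    · simp [Pi.single_eq_of_ne hij]
  choose Z hZpsd hZ using hZ
  choose Y hYpsd hY using hY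
  have hsum : ∀ w, φ w = ∑ i, (Z i * w.1 i).trace + ∑ i, (Y i * w.2 i).trace := by
    intro w
    have h1 : w = ∑ i, ((Pi.single i (w.1 i), 0) : (ι → Matrix (Fin n ⊕ Fin m) (Fin n ⊕ Fin m) ℝ)
        × (ι → Matrix (Fin 2) (Fin 2) ℝ)) + ∑ i, (0, Pi.single i (w.2 i)) := by
      refine Prod.ext ?_ ?_
      · simp [Prod.fst_sum, Finset.univ_sum_single]
      · simp [Prod.snd_sum, Finset.univ_sum_single]
    conv_lhs => rw [h1]
    simp only [map_add, map_sum, hZ, hY]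
  have hFp : ∀ i, (∀ z, 0 ≤ z ⬝ᵥ (F p).1 i *ᵥ z) ∧ ∀ z, 0 ≤ z ⬝ᵥ (F p).2 i *ᵥ z := fun i =>
    ⟨((posSemidef_iff_real _).1 (hp.1 i).1).2, ((posSemidef_iff_real _).1 (hp.1 i).2).2⟩
  have hFp0 : φ (F p) = 0 := le_antisymm (by linarith [hφ p]) (hφ0 _ hFp)
  -- The exact remainder of the linearization at `p.2.2`. It is of second order, so both problems
  -- have the same first-order conditions at p.
  have hSq : ∀ (q : ℝ × ℝ × ℝ) i, Sq Q γ H q.2.1 q.2.2 (lam i) = Sl Q γ H q.2.1 q.2.2 p.2.2 (lam i)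
      + ((q.2.2 - p.2.2) ^ 2 * (γ * ‖lam i‖ ^ 2)) • Matrix.fromBlocks
        (H.toBlocks₁₂ * H.toBlocks₂₂⁻¹ * H.toBlocks₂₂⁻¹ * H.toBlocks₁₂ᵀ) 0 0 0 := by
    intro q i
    ext (a | a) (b | b) <;> simp [Sq, Sl, couplingMatrix]
    ring
  have hterm1 : ∀ i, 0 ≤ (Z i * (F p).1 i).trace := by
    intro i
    rw [← hZ]
    refine hφ0 _ fun j => ⟨fun z => ?_, fun z => by simp⟩
    by_cases hij : j = i
    · subst hij
      simpa using (hFp j).1 z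
    · simp [Pi.single_eq_of_ne hij]
  have hterm2 : ∀ i, 0 ≤ (Y i * (F p).2 i).trace := by
    intro i
    rw [← hY]
    refine hφ0 _ fun j => ⟨fun z => by simp, fun z => ?_⟩
    by_cases hij : j = i
    · subst hij
      simpa using (hFp j).2 z
    · simp [Pi.single_eq_of_ne hij]
  have hsp := hsum (F p)
  rw [hFp0] at hsp
  have hs1 := Finset.sum_nonneg fun i (_ : i ∈ Finset.univ) => hterm1 i
  have hs2 := Finset.sum_nonneg fun i (_ : i ∈ Finset.univ) => hterm2 i
  have hz1 := (Finset.sum_eq_zero_iff_of_nonneg fun i _ => hterm1 i).1 (by linarith)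
  have hz2 := (Finset.sum_eq_zero_iff_of_nonneg fun i _ => hterm2 i).1 (by linarith)
  refine ⟨Z, Y, fun i => ⟨hZpsd i, hYpsd i⟩, fun i => ⟨?_, hz2 i (Finset.mem_univ i)⟩, ?_⟩
  · rw [hSq, sub_self]
    simpa using hz1 i (Finset.mem_univ i)
  -- An affine function of q that attains its upper bound `p.1` at p is constant; the reflected
  -- point 2p - q gives the missing inequality.
  · have hconst : ∀ q, q.1 + φ (F q) = p.1 := by
      intro q
      refine le_antisymm (hφ q) ?_
      have h1 := hφ ((2 : ℝ) • p + (-1 : ℝ) • q)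
      rw [hF _ _ _ _ (by norm_num)] at h1
      simp only [map_add, map_smul, Prod.fst_add, Prod.smul_fst, smul_eq_mul, hFp0] at h1
      linarith
    have hlag : lagrangian Q γ H lam Z Y = fun q : ℝ × ℝ × ℝ => p.1 + (q.2.2 - p.2.2) ^ 2 *
        ∑ i, γ * ‖lam i‖ ^ 2 * (Z i * Matrix.fromBlocks
        (H.toBlocks₁₂ * H.toBlocks₂₂⁻¹ * H.toBlocks₂₂⁻¹ * H.toBlocks₁₂ᵀ) 0 0 0).trace := by
      funext q
      rw [← hconst q, hsum, lagrangian]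
      have : ∀ i, (Z i * (Sq Q γ H q.2.1 q.2.2 (lam i) - q.1 • 1)).trace
          = (Z i * (F q).1 i).trace + (q.2.2 - p.2.2) ^ 2 * (γ * ‖lam i‖ ^ 2 *
            (Z i * Matrix.fromBlocks
        (H.toBlocks₁₂ * H.toBlocks₂₂⁻¹ * H.toBlocks₂₂⁻¹ * H.toBlocks₁₂ᵀ) 0 0 0).trace) := by
        intro i
        rw [hSq, add_sub_right_comm, Matrix.mul_add, trace_add, Matrix.mul_smul, trace_smul,
          smul_eq_mul]
        ring
      simp only [this, Finset.sum_add_distrib, ← Finset.mul_sum]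
      ring
    rw [hlag]
    have hd : HasFDerivAt (fun q : ℝ × ℝ × ℝ => q.2.2 - p.2.2)
        ((ContinuousLinearMap.snd ℝ ℝ ℝ).comp (ContinuousLinearMap.snd ℝ ℝ (ℝ × ℝ))) p :=
      ((ContinuousLinearMap.snd ℝ ℝ ℝ).comp
        (ContinuousLinearMap.snd ℝ ℝ (ℝ × ℝ))).hasFDerivAt.sub_const _
    have h2 := ((hd.pow 2).mul_const (∑ i, γ * ‖lam i‖ ^ 2 * (Z i * Matrix.fromBlocks
        (H.toBlocks₁₂ * H.toBlocks₂₂⁻¹ * H.toBlocks₂₂⁻¹ * H.toBlocks₁₂ᵀ) 0 0 0).trace)).const_add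
        p.1
    refine h2.congr_fderiv ?_
    simp

end Stationary

theorem eq_zero_and_nonneg_of_eventually {b d : ℝ}
    (h : ∀ᶠ s in 𝓝 (0 : ℝ), 0 ≤ s * b + s ^ 2 * d) : b = 0 ∧ 0 ≤ d := by
  obtain ⟨ε, hε, hs⟩ := Metric.eventually_nhds_iff.1 h
  simp only [dist_zero_right, Real.norm_eq_abs] at hs
  have hd : 0 ≤ d := by
    have h1 := hs (y := ε / 2) (by rw [abs_of_pos (by linarith)]; linarith)
    have h2 := hs (y := -(ε / 2)) (by rw [abs_neg, abs_of_pos (by linarith)]; linarith)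
    have h3 : 0 ≤ ε ^ 2 / 2 * d := by nlinarith
    exact nonneg_of_mul_nonneg_right h3 (by positivity)
  refine ⟨?_, hd⟩
  by_contra hb
  set s := min (ε / 2) (|b| / (2 * (d + 1))) with hsdef
  have hb' : 0 < |b| := abs_pos.2 hb
  have hs0 : 0 < s := lt_min (by linarith) (by positivity)
  have hs1 : s ≤ ε / 2 := min_le_left _ _
  have hs2 : s * (d + 1) ≤ |b| / 2 := by
    have : s ≤ |b| / (2 * (d + 1)) := min_le_right _ _
    rw [le_div_iff₀ (by positivity)] at this
    linarith
  have h1 := hs (y := s) (by rw [abs_of_pos hs0]; linarith)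
  have h2 := hs (y := -s) (by rw [abs_neg, abs_of_pos hs0]; linarith)
  have h3 : s * |b| ≤ s * (s * d) := by
    rcases abs_cases b with ⟨h, -⟩ | ⟨h, -⟩ <;> rw [h] <;> nlinarith
  have h4 := le_of_mul_le_mul_left h3 hs0
  nlinarith

/-! ### Uniqueness of subproblem solutions against locally constant values -/

section Limit

variable {n m : ℕ} {Q : Matrix (Fin n) (Fin n) ℝ} {γ : ℝ}
  {H : Matrix (Fin n ⊕ Fin m) (Fin n ⊕ Fin m) ℝ} {ι : Type*} [Fintype ι] {lam : ι → ℂ}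

/-- The form is minimal at a null vector, so its derivative in the u-direction v vanishes. -/
theorem couplingForm_stationary (hD : IsCouplingData Q γ H) {α β t : ℝ}
    (h : ∀ x u, 0 ≤ couplingForm Q H α β t x u) {x : Fin n → ℝ} {u : Fin m → ℝ}
    (h0 : couplingForm Q H α β t x u = 0) (v : Fin m → ℝ) :
    β * (v ⬝ᵥ H.toBlocks₂₂ *ᵥ gain H *ᵥ x) + v ⬝ᵥ H.toBlocks₂₂ *ᵥ u - α * (v ⬝ᵥ u) = 0 := by
  have key : 2 * (β * (v ⬝ᵥ H.toBlocks₂₂ *ᵥ gain H *ᵥ x) + v ⬝ᵥ H.toBlocks₂₂ *ᵥ u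
      - α * (v ⬝ᵥ u)) = 0 := by
    apply eq_zero_of_forall_nonneg (d := v ⬝ᵥ H.toBlocks₂₂ *ᵥ v - α * (v ⬝ᵥ v))
    intro s
    have h1 := h x (u + s • v)
    unfold couplingForm at h0 h1
    simp only [mulVec_add, mulVec_smul, dotProduct_add, add_dotProduct, smul_dotProduct,
      dotProduct_smul, smul_eq_mul] at h1
    rw [dotProduct_mulVec_comm_of_isSymm hD.isSymm u v, dotProduct_comm u v] at h1
    linarith
  linarith

theorem couplingForm_stationary' {α β t : ℝ}
    (h : ∀ x u, 0 ≤ couplingForm Q H α β t x u) {u : Fin m → ℝ}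
    (h0 : u ⬝ᵥ H.toBlocks₂₂ *ᵥ u - α * (u ⬝ᵥ u) = 0) (y : Fin n → ℝ) :
    β * (u ⬝ᵥ H.toBlocks₂₂ *ᵥ gain H *ᵥ y) = 0 := by
  have key : 2 * (β * (u ⬝ᵥ H.toBlocks₂₂ *ᵥ gain H *ᵥ y)) = 0 := by
    apply eq_zero_of_forall_nonneg (d := y ⬝ᵥ Q *ᵥ y - α * (y ⬝ᵥ y)
      + t * (gain H *ᵥ y ⬝ᵥ gain H *ᵥ y))
    intro s
    have h1 := h (s • y) u
    unfold couplingForm at h1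
    simp only [mulVec_smul, smul_dotProduct, dotProduct_smul, smul_eq_mul] at h1
    linarith
  linarith

/-- The optimal value of the non-convex problem at a fixed gain is not locally constant at the gain
of a point that is the only solution of its own subproblem. -/
theorem false_of_unique_of_eventually_feasible [Nonempty ι] (hD : IsCouplingData Q γ H)
    (hre : ∀ i, 0 < (lam i).re) {p : ℝ × ℝ × ℝ} (hp : SubOptimal Q γ H lam p.2.2 p)
    (huniq : ∀ q, SubOptimal Q γ H lam p.2.2 q → q = p) (hβ : p.2.1 ≠ 0)
    (hc : 0 < p.2.2 ∨ (p.2.2 < 0 ∧ 0 ≤ p.1))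
    (hflat : ∀ᶠ c in 𝓝 p.2.2, ∃ β, Feasible Q γ H lam (p.1, β, c)) : False := by
  have hlam : ∀ i, lam i ≠ 0 := fun i h => by simpa [h] using hre i
  obtain ⟨α, β, c⟩ := p
  simp only at hβ hc hflat
  have hf := (subFeasible_iff hD hlam _ _).1 hp.1
  simp only at hf huniq
  have huniq' : ∀ β', SubFeasible Q γ H lam c (α, β', c) → β' = β := by
    intro β' hβ'
    have := huniq (α, β', c) ⟨hβ', hp.2⟩
    simpa using this
  obtain ⟨j, hj⟩ := Finite.exists_max fun j => ‖1 - (c : ℂ) * lam j‖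
  -- A smaller β keeps the coupling form nonnegative, so uniqueness leaves only the least β that 𝓝 ⪰
  -- 0 allows.
  have hβj : ‖1 - (c : ℂ) * lam j‖ = β := huniq' _ ((subFeasible_iff hD hlam _ _).2 fun i =>
    ⟨couplingForm_nonneg_of_abs_le (by rw [abs_norm]; exact (hf j).2) (hf i).1, hj i⟩)
  have hβ0 : 0 < β := lt_of_le_of_ne (hβj ▸ norm_nonneg _) (Ne.symm hβ)
  have hβ2 : β ^ 2 = 1 - 2 * c * (lam j).re + c ^ 2 * ‖lam j‖ ^ 2 := by
    rw [← hβj, norm_sq_one_sub_mul]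
  have hpsd : ∀ v : Fin m → ℝ, 0 ≤ v ⬝ᵥ H.toBlocks₂₂ *ᵥ v - α * (v ⬝ᵥ v) := by
    intro v
    simpa [couplingForm] using (hf j).1 0 v
  have hγ := hD.pos
  -- every null vector of a coupling form is decoupled
  have hnull : ∀ i x u,
      couplingForm Q H α β ((2 * c * c - c ^ 2) * γ * ‖lam i‖ ^ 2) x u = 0 →
      u ⬝ᵥ H.toBlocks₂₂ *ᵥ u - α * (u ⬝ᵥ u) = 0 := by
    intro i x u h0
    have hst := couplingForm_stationary hD (hf i).1 h0
    set w := (u ⬝ᵥ H.toBlocks₂₂ *ᵥ u - α * (u ⬝ᵥ u)) / β ^ 2 with hw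
    set y := gain H *ᵥ x ⬝ᵥ gain H *ᵥ x with hy
    set b := u ⬝ᵥ H.toBlocks₂₂ *ᵥ gain H *ᵥ x with hb
    have hy0 : 0 ≤ y := dotProduct_self_nonneg_real _
    have huu : u ⬝ᵥ H.toBlocks₂₂ *ᵥ u - α * (u ⬝ᵥ u) = β ^ 2 * w := by
      rw [hw]; field_simp
    have hw0 : 0 ≤ w := div_nonneg (hpsd u) (by positivity)
    have hbw : b = -(β * w) := by
      have h1 := hst u
      rw [add_sub_assoc, huu] at h1
      have h2 : β * (b + β * w) = 0 := by rw [← h1]; ring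
      rcases mul_eq_zero.1 h2 with h | h
      · exact absurd h hβ0.ne'
      · linarith
    set d := γ * ‖lam i‖ ^ 2 * y - ‖lam j‖ ^ 2 * w with hd
    -- At gain c + s the form is tested at x and at u rescaled by |1 - (c + s)λⱼ|/β. Because (x, u)
    -- is a null vector at s = 0, the result is a quadratic in s without constant term.
    have hquad : ∀ᶠ s in 𝓝 (0 : ℝ),
        0 ≤ s * (2 * (lam j).re * w + 2 * c * d) + s ^ 2 * d := by
      have hshift : Tendsto (fun s : ℝ => c + s) (𝓝 0) (𝓝 c) := by
        have : Continuous fun s : ℝ => c + s := by fun_prop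
        simpa using this.tendsto 0
      filter_upwards [hshift.eventually hflat] with s hs
      obtain ⟨β', hs⟩ := hs
      rw [feasible_iff_subFeasible_self, subFeasible_iff hD hlam] at hs
      simp only at hs
      have h1 := couplingForm_nonneg_of_abs_le (β' := ‖1 - ((c + s : ℝ) : ℂ) * lam j‖)
        (by rw [abs_norm]; exact (hs j).2) (hs i).1 x ((‖1 - ((c + s : ℝ) : ℂ) * lam j‖ / β) • u)
      rw [couplingForm_smul, ← hb, ← hy, huu, hbw] at h1
      have h2 := norm_sq_one_sub_mul (c + s) (lam j)
      set ρ := ‖1 - ((c + s : ℝ) : ℂ) * lam j‖ with hρ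
      have h3 : ρ / β * (2 * ρ * -(β * w)) + (ρ / β) ^ 2 * (β ^ 2 * w) = -(ρ ^ 2 * w) := by
        field_simp
        ring
      have h4 : couplingForm Q H α β ((2 * c * c - c ^ 2) * γ * ‖lam i‖ ^ 2) x u
          = x ⬝ᵥ Q *ᵥ x - α * (x ⬝ᵥ x) + (2 * c * c - c ^ 2) * γ * ‖lam i‖ ^ 2 * y
            + 2 * β * b + (u ⬝ᵥ H.toBlocks₂₂ *ᵥ u - α * (u ⬝ᵥ u)) := by
        rw [couplingForm]; ring
      rw [h0, huu, hbw] at h4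
      rw [add_assoc, h3, h2] at h1
      have h5 : 2 * β * -(β * w) = -(2 * (β ^ 2 * w)) := by ring
      rw [h5, hβ2] at h4
      rw [hd]
      linarith
    obtain ⟨hb0, hd0⟩ := eq_zero_and_nonneg_of_eventually hquad
    have hrj := hre j
    -- The vanishing linear coefficient reads Re λⱼ w = -cd with w, d ≥ 0. For c > 0 this gives w =
    -- 0; for c < 0 it remains to show d ≤ 0.
    have hw' : w = 0 := by
      rcases hc with hc | ⟨hc, hα⟩
      · by_contra hne
        have : 0 < w := lt_of_le_of_ne hw0 (Ne.symm hne)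
        nlinarith [mul_pos hrj this, mul_nonneg hc.le hd0]
      · have hd1 : d ≤ 0 := by
          rcases le_or_gt ‖lam i‖ ‖lam j‖ with hij | hij
          · have hwy : γ * y ≤ w := by
              -- By stationarity, nonnegativity of H₂₂ - αI at u/β + Kx says w ≥ (Kx)ᵀH₂₂(Kx) +
              -- α|Kx|², which is at least γ|Kx|².
              have h1 := hpsd (β⁻¹ • u + gain H *ᵥ x)
              simp only [mulVec_add, mulVec_smul, dotProduct_add, add_dotProduct,
                smul_dotProduct, dotProduct_smul, smul_eq_mul] at h1
              have h2 := hst (gain H *ᵥ x)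
              rw [dotProduct_mulVec_comm_of_isSymm hD.isSymm (gain H *ᵥ x) u,
                dotProduct_comm (gain H *ᵥ x) u] at h1 h2
              rw [← hb] at h1 h2
              rw [← hy] at h1
              have h3 := hD.coercive (gain H *ᵥ x)
              rw [← hy] at h3
              set h22 := gain H *ᵥ x ⬝ᵥ H.toBlocks₂₂ *ᵥ gain H *ᵥ x with hh22
              have h4 : w = β⁻¹ * (β⁻¹ * (u ⬝ᵥ H.toBlocks₂₂ *ᵥ u))
                  - α * (β⁻¹ * (β⁻¹ * (u ⬝ᵥ u))) := by
                rw [hw]; field_simp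
              have h5 : β⁻¹ * (b - α * (u ⬝ᵥ gain H *ᵥ x)) = -h22 := by
                have : b - α * (u ⬝ᵥ gain H *ᵥ x) = -(β * h22) := by linarith
                rw [this]; field_simp
              have h6 : 0 ≤ w - h22 - α * y := by linarith
              nlinarith [mul_nonneg hα hy0]
            have h1 : ‖lam i‖ ^ 2 ≤ ‖lam j‖ ^ 2 := by gcongr
            have h2 := mul_le_mul_of_nonneg_right h1 (mul_nonneg hγ.le hy0)
            have h3 := mul_le_mul_of_nonneg_left hwy (sq_nonneg ‖lam j‖)
            rw [hd]
            linarith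
          -- Mode j has a smaller t than mode i, so its form at a null vector of mode i would be
          -- negative unless Kx = 0.
          · have h1 := (hf j).1 x u
            have h2 : couplingForm Q H α β ((2 * c * c - c ^ 2) * γ * ‖lam j‖ ^ 2) x u
                = couplingForm Q H α β ((2 * c * c - c ^ 2) * γ * ‖lam i‖ ^ 2) x u
                  - c ^ 2 * γ * (‖lam i‖ ^ 2 - ‖lam j‖ ^ 2) * y := by
              unfold couplingForm
              rw [← hy]
              ring
            rw [h2, h0] at h1
            have h3 : 0 < c ^ 2 * γ * (‖lam i‖ ^ 2 - ‖lam j‖ ^ 2) := by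
              have : ‖lam j‖ ^ 2 < ‖lam i‖ ^ 2 := by gcongr
              have hc2 : 0 < c ^ 2 := by
                have := hc.ne
                positivity
              exact mul_pos (mul_pos hc2 hγ) (by linarith)
            have h4 : y = 0 := by
              by_contra hne
              have : 0 < y := lt_of_le_of_ne hy0 (Ne.symm hne)
              nlinarith [mul_pos h3 this]
            rw [hd, h4]
            nlinarith [mul_nonneg (sq_nonneg ‖lam j‖) hw0]
        have hd2 : d = 0 := le_antisymm hd1 hd0
        rw [hd2] at hb0
        have : (lam j).re * w = 0 := by linarith
        rcases mul_eq_zero.1 this with h | h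
        · exact absurd h hrj.ne'
        · exact h
    rw [huu, hw', mul_zero]
  -- hence `β` can be increased
  have hN : (Matrix.fromBlocks 0 H.toBlocks₁₂ H.toBlocks₁₂ᵀ 0 :
      Matrix (Fin n ⊕ Fin m) (Fin n ⊕ Fin m) ℝ).IsSymm := by
    rw [Matrix.isSymm_fromBlocks_iff]
    simp
  have h12 : H.toBlocks₁₂ = (gain H)ᵀ * H.toBlocks₂₂ := by
    rw [← transpose_transpose H.toBlocks₁₂, hD.factor, transpose_mul, hD.isSymm.eq]
  have hbil : ∀ v y, v ⬝ᵥ (gain H)ᵀ *ᵥ H.toBlocks₂₂ *ᵥ y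
      = y ⬝ᵥ H.toBlocks₂₂ *ᵥ gain H *ᵥ v := by
    intro v y
    rw [dotProduct_transpose_mulVec, dotProduct_comm,
      ← dotProduct_mulVec_comm_of_isSymm hD.isSymm]
  have hε : ∀ i, ∃ ε : ℝ, 0 < ε ∧ ∀ δ, |δ| ≤ ε → ∀ x u,
      0 ≤ couplingForm Q H α (β + δ) ((2 * c * c - c ^ 2) * γ * ‖lam i‖ ^ 2) x u := by
    intro i
    have hform := couplingMatrix_form hD α β (2 * c * c - c ^ 2) (lam i)
    -- Null vectors satisfy (H₂₂ - αI)u = 0, H₂₂Kx = 0 and KᵀH₂₂u = 0. They lie in the kernel of the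
    -- β-derivative of the coupling matrix, so β may change a little.
    obtain ⟨ε, hε, h⟩ := exists_pos_forall_form_nonneg (hp.1 i).1 hN (fun z hz => by
      rw [← Sum.elim_comp_inl_inr z] at hz ⊢
      set x := z ∘ Sum.inl
      set u := z ∘ Sum.inr
      have hz' : couplingForm Q H α β ((2 * c * c - c ^ 2) * γ * ‖lam i‖ ^ 2) x u = 0 := by
        rw [← hform]; exact hz
      have h1 := hnull i x u hz'
      have h2 : ∀ y, u ⬝ᵥ H.toBlocks₂₂ *ᵥ gain H *ᵥ y = 0 := fun y =>
        (mul_eq_zero.1 (couplingForm_stationary' (hf i).1 h1 y)).resolve_left hβ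
      have hM : (H.toBlocks₂₂ - α • (1 : Matrix (Fin m) (Fin m) ℝ)).PosSemidef := by
        refine (posSemidef_iff_real _).2 ⟨hD.isSymm.sub (by simp [Matrix.IsSymm]), fun v => ?_⟩
        simpa [sub_mulVec, smul_mulVec] using hpsd v
      have h3 : H.toBlocks₂₂ *ᵥ u - α • u = 0 := by
        have := mulVec_eq_zero_of_form_eq_zero hM (x := u)
          (by simpa [sub_mulVec, smul_mulVec] using h1)
        simpa [sub_mulVec, smul_mulVec] using this
      have h4 : H.toBlocks₂₂ *ᵥ gain H *ᵥ x = 0 := by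
        refine dotProduct_eq_zero _ fun v => ?_
        have h5 := couplingForm_stationary hD (hf i).1 hz' v
        have h6 : v ⬝ᵥ (H.toBlocks₂₂ *ᵥ u - α • u) = 0 := by rw [h3, dotProduct_zero]
        rw [dotProduct_sub, dotProduct_smul, smul_eq_mul] at h6
        have h7 : β * (v ⬝ᵥ H.toBlocks₂₂ *ᵥ gain H *ᵥ x) = 0 := by linarith
        rw [dotProduct_comm]
        exact (mul_eq_zero.1 h7).resolve_left hβ
      rw [fromBlocks_mulVec, hD.factor, h12]
      simp only [Sum.elim_comp_inl, Sum.elim_comp_inr, zero_mulVec, zero_add, add_zero,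
        ← mulVec_mulVec, h4]
      have h5 : (gain H)ᵀ *ᵥ H.toBlocks₂₂ *ᵥ u = 0 := by
        refine dotProduct_eq_zero _ fun v => ?_
        rw [dotProduct_comm, hbil]
        exact h2 v
      rw [h5]
      ext (i | i) <;> rfl)
    refine ⟨ε, hε, fun δ hδ x u => ?_⟩
    have h1 := h δ hδ (Sum.elim x u)
    rw [Sl, hform, fromBlocks_mulVec, sumElim_dotProduct_sumElim, hD.factor, h12] at h1
    simp only [Sum.elim_comp_inl, Sum.elim_comp_inr, zero_mulVec, zero_add, add_zero,
        ← mulVec_mulVec, hbil] at h1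
    unfold couplingForm at h1 ⊢
    linarith
  choose ε hε0 hε using hε
  obtain ⟨i₀, hi₀⟩ := Finite.exists_min ε
  have := huniq' (β + ε i₀) ((subFeasible_iff hD hlam _ _).2 fun i =>
    ⟨hε i _ (by rw [abs_of_pos (hε0 i₀)]; exact hi₀ i), (hf i).2.trans
      (by simpa using (hε0 i₀).le)⟩)
  linarith [hε0 i₀]

end Limit

/-! ### Convergence of the iterates -/

section Sequence

theorem exists_mapClusterPt_comp_of_isBounded {X : Type*} [PseudoMetricSpace X] [ProperSpace X]
    {x : ℕ → X} (hb : Bornology.IsBounded (Set.range x)) {φ : ℕ → ℕ} (hφ : StrictMono φ) :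
    ∃ p, ∃ ψ : ℕ → ℕ, StrictMono ψ ∧ Tendsto (fun k => x (φ (ψ k))) atTop (𝓝 p) ∧
      MapClusterPt p atTop x := by
  obtain ⟨p, -, ψ, hψ, hlim⟩ := tendsto_subseq_of_bounded hb (x := x ∘ φ)
    (fun k => Set.mem_range_self _)
  exact ⟨p, ψ, hψ, hlim, MapClusterPt.of_comp (hφ.comp hψ).tendsto_atTop hlim.mapClusterPt⟩

/-- A subsequence staying ε away from S would still accumulate, at a point of S. Boundedness also
makes S nonempty, so the default value of `infDist` for the empty set plays no role. -/
theorem tendsto_infDist_of_mapClusterPt_mem {X : Type*} [PseudoMetricSpace X] [ProperSpace X]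
    {x : ℕ → X} (hb : Bornology.IsBounded (Set.range x)) {S : Set X}
    (h : ∀ p, MapClusterPt p atTop x → p ∈ S) :
    Tendsto (fun k => Metric.infDist (x k) S) atTop (𝓝 0) := by
  rw [Metric.tendsto_atTop]
  by_contra hcon
  push Not at hcon
  obtain ⟨ε, hε, hfr⟩ := hcon
  obtain ⟨φ, hφ, hφε⟩ := extraction_of_frequently_atTop
    (P := fun k => ε ≤ dist (Metric.infDist (x k) S) 0) (frequently_atTop.2 hfr)
  obtain ⟨p, ψ, hψ, hlim, hp⟩ := exists_mapClusterPt_comp_of_isBounded hb hφ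
  obtain ⟨k, hk⟩ := ((Metric.tendsto_nhds.1 hlim) ε hε).exists
  have h1 := hφε (ψ k)
  rw [Real.dist_eq, sub_zero, abs_of_nonneg Metric.infDist_nonneg] at h1
  exact absurd (h1.trans (Metric.infDist_le_dist_of_mem (h p hp))) (not_le.2 hk)

/-- A real sequence with vanishing increments accumulates at every point between two limit
points. -/
theorem mapClusterPt_of_mem_Ioo {c : ℕ → ℝ} (hc : Tendsto (fun k => c (k + 1) - c k) atTop (𝓝 0))
    {a b y : ℝ} (ha : MapClusterPt a atTop c) (hb : MapClusterPt b atTop c)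
    (hy : y ∈ Set.Ioo a b) : MapClusterPt y atTop c := by
  rw [mapClusterPt_iff_frequently]
  intro s hs
  obtain ⟨ε, hε, hball⟩ := Metric.mem_nhds_iff.1 hs
  by_contra hcon
  rw [not_frequently] at hcon
  have h1 : ∀ᶠ k in atTop, ε ≤ |c k - y| := by
    filter_upwards [hcon] with k hk
    by_contra hlt
    exact hk (hball (by rw [Metric.mem_ball, Real.dist_eq]; exact not_le.1 hlt))
  have h2 : ∀ᶠ k in atTop, |c (k + 1) - c k| < ε := by
    filter_upwards [Metric.tendsto_nhds.1 hc ε hε] with k hk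
    simpa [Real.dist_eq] using hk
  obtain ⟨M, hM⟩ := eventually_atTop.1 (h1.and h2)
  have hlow := (mapClusterPt_iff_frequently.1 ha) _ (Iio_mem_nhds hy.1)
  have hhigh := (mapClusterPt_iff_frequently.1 hb) _ (Ioi_mem_nhds hy.2)
  obtain ⟨k, hk, hck⟩ := frequently_atTop.1 hlow M
  obtain ⟨l, hl, hcl⟩ := frequently_atTop.1 hhigh k
  -- The sequence avoids the window of radius ε about y and its steps are shorter than ε, so it
  -- cannot cross.
  have hall : ∀ i, k ≤ i → c i < y := by
    intro i hi
    induction i, hi using Nat.le_induction with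
    | base => exact hck
    | succ i hi ih =>
      obtain ⟨-, h4⟩ := hM i (hk.trans hi)
      obtain ⟨h5, -⟩ := hM (i + 1) (by omega)
      obtain ⟨h6, -⟩ := hM i (hk.trans hi)
      rw [abs_of_neg (by linarith)] at h6
      by_contra hge
      rw [abs_of_nonneg (by linarith)] at h5
      have := (abs_lt.1 h4).2
      linarith
  exact absurd (hall l hl) (not_lt.2 (le_of_lt hcl))

end Sequence

section Convergence

variable {n m : ℕ} {Q : Matrix (Fin n) (Fin n) ℝ} {γ : ℝ}
  {H : Matrix (Fin n ⊕ Fin m) (Fin n ⊕ Fin m) ℝ} {ι : Type*} [Fintype ι] {lam : ι → ℂ}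
  {x : ℕ → ℝ × ℝ × ℝ}

theorem IsRun.exists_nonneg_of_neg [Nonempty ι] (hx : IsRun Q γ H lam x)
    (hre : ∀ i, 0 < (lam i).re) (hD : IsCouplingData Q γ H) (hc₀ : 0 ≤ (x 0).2.2) {k : ℕ}
    (hk : (x k).2.2 < 0) : ∃ j, 0 ≤ (x (j + 1)).1 := by
  by_contra hcon
  push Not at hcon
  have hc : ∀ k, 0 ≤ (x k).2.2 := by
    intro k
    induction k with
    | zero => exact hc₀
    | succ k ih =>
      by_contra hlt
      linarith [hcon k, (hx k).nonneg_of_neg hre hD ih (not_le.1 hlt)]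
  exact absurd (hc k) (not_le.2 hk)

/-- If a subsequence tends to p and its successors to q, then q is feasible for the subproblem at p
and has the common limit value. Uniqueness gives q = p. -/
theorem IsRun.tendsto_gain_sub [Nonempty ι] (hx : IsRun Q γ H lam x)
    (hlam : ∀ i, lam i ≠ 0) (hD : IsCouplingData Q γ H)
    (hb : Bornology.IsBounded (Set.range x))
    (huniq : ∀ p, MapClusterPt p atTop x → ∀ q, SubOptimal Q γ H lam p.2.2 q → q = p) :
    Tendsto (fun k => (x (k + 1)).2.2 - (x k).2.2) atTop (𝓝 0) := by
  rw [Metric.tendsto_atTop]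
  by_contra hcon
  push Not at hcon
  obtain ⟨ε, hε, hfr⟩ := hcon
  obtain ⟨φ, hφ, hφε⟩ := extraction_of_frequently_atTop
    (P := fun k => ε ≤ dist ((x (k + 1)).2.2 - (x k).2.2) 0) (frequently_atTop.2 hfr)
  obtain ⟨p, ψ, hψ, hlim, hp⟩ := exists_mapClusterPt_comp_of_isBounded hb hφ
  have hφψ : StrictMono fun k => φ (ψ k) + 1 := fun i j hij => by
    have := hφ (hψ hij)
    simp only
    omega
  obtain ⟨q, θ, hθ, hlimq, hq⟩ := exists_mapClusterPt_comp_of_isBounded hb hφψ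
  have hlimp := hlim.comp hθ.tendsto_atTop
  have hcont : Continuous fun p : ℝ × ℝ × ℝ => p.2.2 := by fun_prop
  have hpo := hx.subOptimal_of_mapClusterPt hD hlam hp
  have hqo := hx.subOptimal_of_mapClusterPt hD hlam hq
  have hval : q.1 = p.1 := tendsto_nhds_unique hqo.2 hpo.2
  have hqf : SubFeasible Q γ H lam p.2.2 q :=
    subFeasible_of_tendsto hD hlam ((hcont.tendsto p).comp hlimp) hlimq
      (Eventually.of_forall fun k => (hx _).1)
  have hqp : q = p := huniq p hp q ⟨hqf, fun r hr => hval ▸ hpo.1.2 r hr⟩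
  subst hqp
  have hlim0 := ((hcont.tendsto q).comp hlimq).sub ((hcont.tendsto q).comp hlimp)
  rw [sub_self] at hlim0
  obtain ⟨k, hk⟩ := ((Metric.tendsto_nhds.1 hlim0) ε hε).exists
  exact absurd (hφε (ψ (θ k))) (not_le.2 hk)

/-- If every limit point is the only solution of its own subproblem, the iterates converge. -/
theorem IsRun.exists_tendsto_of_unique [Nonempty ι] (hx : IsRun Q γ H lam x)
    (hre : ∀ i, 0 < (lam i).re) (hD : IsCouplingData Q γ H) (hc₀ : 0 ≤ (x 0).2.2)
    (hb : Bornology.IsBounded (Set.range x))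
    (huniq : ∀ p, MapClusterPt p atTop x → ∀ q, SubOptimal Q γ H lam p.2.2 q → q = p) :
    ∃ p, MapClusterPt p atTop x ∧ Tendsto x atTop (𝓝 p) := by
  have hlam : ∀ i, lam i ≠ 0 := fun i h => by simpa [h] using hre i
  have hcont : Continuous fun p : ℝ × ℝ × ℝ => p.2.2 := by fun_prop
  obtain ⟨i₀⟩ := ‹Nonempty ι›
  have hgain : ∀ p, MapClusterPt p atTop x → MapClusterPt p.2.2 atTop fun k => (x k).2.2 :=
    fun p hp => MapClusterPt.continuousAt_comp (f := fun p : ℝ × ℝ × ℝ => p.2.2)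
      hcont.continuousAt hp
  have hstep := hx.tendsto_gain_sub hlam hD hb huniq
  have key : ∀ p q, MapClusterPt p atTop x → MapClusterPt q atTop x → ¬ p.2.2 < q.2.2 := by
    intro p q hp hq hlt
    have hmid : ∀ c ∈ Set.Ioo p.2.2 q.2.2, ∃ r, MapClusterPt r atTop x ∧ r.2.2 = c := by
      intro c hc
      obtain ⟨φ, hφ, hlim⟩ :=
        (mapClusterPt_of_mem_Ioo hstep (hgain p hp) (hgain q hq) hc).tendsto_subseq
      obtain ⟨r, ψ, hψ, hlimr, hr⟩ := exists_mapClusterPt_comp_of_isBounded hb hφ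
      exact ⟨r, hr, tendsto_nhds_unique ((hcont.tendsto r).comp hlimr)
        (hlim.comp hψ.tendsto_atTop)⟩
    -- Two gains are avoided: 0, and the only one that permits β = 0, since β = 0 forces cλ = 1.
    obtain ⟨c, hc, hcne⟩ := (Set.Ioo_infinite hlt).exists_notMem_finite
      (Set.toFinite {0, (lam i₀)⁻¹.re})
    simp only [Set.mem_insert_iff, Set.mem_singleton_iff, not_or] at hcne
    obtain ⟨r, hr, rfl⟩ := hmid c hc
    have hro := hx.subOptimal_of_mapClusterPt hD hlam hr
    refine false_of_unique_of_eventually_feasible hD hre hro.1 (huniq r hr) ?_ ?_ ?_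
    · intro h0
      have h1 := ((subFeasible_iff hD hlam _ _).1 hro.1.1 i₀).2
      rw [h0] at h1
      have h2 : 1 - (r.2.2 : ℂ) * lam i₀ = 0 := norm_le_zero_iff.1 h1
      apply hcne.2
      have h3 : (r.2.2 : ℂ) = (lam i₀)⁻¹ := by
        refine eq_inv_of_mul_eq_one_left ?_
        linear_combination -h2
      rw [← h3, Complex.ofReal_re]
    · rcases lt_or_gt_of_ne hcne.1 with h | h
      · refine Or.inr ⟨h, ?_⟩
        obtain ⟨k, hk⟩ := ((mapClusterPt_iff_frequently.1 (hgain r hr)) _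
          (Iio_mem_nhds h)).exists
        obtain ⟨j, hj⟩ := hx.exists_nonneg_of_neg hre hD hc₀ hk
        obtain ⟨a, ha, hale⟩ := hx.exists_tendsto hD hlam
        rw [tendsto_nhds_unique hro.2 ha]
        exact hj.trans (hale j)
      · exact Or.inl h
    -- Nearby gains also belong to limit points, and all limit points share one value.
    · filter_upwards [Ioo_mem_nhds hc.1 hc.2] with c hc
      obtain ⟨r', hr', rfl⟩ := hmid c hc
      have hro' := hx.subOptimal_of_mapClusterPt hD hlam hr'
      refine ⟨r'.2.1, ?_⟩
      rw [tendsto_nhds_unique hro.2 hro'.2]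
      exact (feasible_iff_subFeasible_self _).2 hro'.1.1
  obtain ⟨p, -, -, -, hp⟩ := exists_mapClusterPt_comp_of_isBounded hb strictMono_id
  refine ⟨p, hp, hb.isCompact_closure.tendsto_nhds_of_unique_mapClusterPt
    (Eventually.of_forall fun k => subset_closure (Set.mem_range_self k)) fun q _ hq => ?_⟩
  have hc : q.2.2 = p.2.2 :=
    le_antisymm (not_lt.1 (key p q hp hq)) (not_lt.1 (key q p hq hp))
  have hqo := (hx.subOptimal_of_mapClusterPt hD hlam hq).1
  rw [hc] at hqo
  exact huniq p hp q hqo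

end Convergence

/-! ### Complex matrices, Lyapunov inequalities and the spectral radius -/

section Spectral

variable {d : Type*} [Fintype d] [DecidableEq d]

theorem exists_eigenvector_of_mem_spectrum {M : Matrix d d ℂ} {z : ℂ} (hz : z ∈ spectrum ℂ M) :
    ∃ v, v ≠ 0 ∧ M *ᵥ v = z • v := by
  rw [← Matrix.spectrum_toLin', ← Module.End.hasEigenvalue_iff_mem_spectrum] at hz
  obtain ⟨v, hv⟩ := hz.exists_hasEigenvector
  exact ⟨v, hv.2, by simpa using hv.apply_eq_smul⟩

theorem mem_spectrum_of_eigenvector {M : Matrix d d ℂ} {z : ℂ} {v : d → ℂ} (hv : v ≠ 0)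
    (h : M *ᵥ v = z • v) : z ∈ spectrum ℂ M := by
  rw [← Matrix.spectrum_toLin', ← Module.End.hasEigenvalue_iff_mem_spectrum]
  exact Module.End.hasEigenvalue_of_hasEigenvector
    ⟨Module.End.mem_eigenspace_iff.2 (by simpa using h), hv⟩

theorem spectralRadius_lt_ofReal {M : Matrix d d ℂ} {r : ℝ} (hr : 0 < r)
    (h : ∀ (z : ℂ) (v : d → ℂ), v ≠ 0 → M *ᵥ v = z • v → ‖z‖ < r) :
    spectralRadius ℂ M < ENNReal.ofReal r := by
  have hfin := Matrix.finite_spectrum M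
  rw [spectralRadius]
  have : (⨆ k ∈ spectrum ℂ M, (‖k‖₊ : ENNReal)) = hfin.toFinset.sup fun k => (‖k‖₊ : ENNReal) := by
    rw [Finset.sup_eq_iSup]
    simp
  rw [this, Finset.sup_lt_iff (by simpa using hr)]
  intro z hz
  rw [Set.Finite.mem_toFinset] at hz
  obtain ⟨v, hv, hM⟩ := exists_eigenvector_of_mem_spectrum hz
  have h1 := h z v hv hM
  rw [← enorm_eq_nnnorm, ← ofReal_norm]
  exact (ENNReal.ofReal_lt_ofReal_iff hr).2 h1

/-- By Gelfand's formula a spectral radius below q < 1 gives ‖Mᵏ‖ ≤ qᵏ eventually. -/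
theorem tendsto_pow_mulVec_zero {M : Matrix d d ℂ}
    (h : ∀ (z : ℂ) (v : d → ℂ), v ≠ 0 → M *ᵥ v = z • v → ‖z‖ < 1) (v : d → ℂ) :
    Tendsto (fun k => (M ^ k) *ᵥ v) atTop (𝓝 0) := by
  let _ := Matrix.linftyOpNormedRing (n := d) (α := ℂ)
  let _ := Matrix.linftyOpNormedAlgebra (n := d) (R := ℂ) (α := ℂ)
  have _ : CompleteSpace (Matrix d d ℂ) := FiniteDimensional.complete ℂ _
  have hrad : spectralRadius ℂ M < ENNReal.ofReal 1 := spectralRadius_lt_ofReal one_pos h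
  rw [ENNReal.ofReal_one] at hrad
  obtain ⟨q, hq1, hq2⟩ := ENNReal.lt_iff_exists_nnreal_btwn.1 hrad
  have hq : (q : ℝ) < 1 := by exact_mod_cast hq2
  have hG := spectrum.pow_nnnorm_pow_one_div_tendsto_nhds_spectralRadius M
  have hev : ∀ᶠ k : ℕ in atTop, ‖M ^ k‖ ≤ (q : ℝ) ^ k := by
    filter_upwards [hG.eventually_lt_const hq1, eventually_gt_atTop 0] with k hk hk0
    have hk0' : (k : ℝ) ≠ 0 := by positivity
    have h1 : (‖M ^ k‖₊ : ENNReal) ≤ (q : ENNReal) ^ k := by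
      have h2 := ENNReal.rpow_le_rpow hk.le (by positivity : (0 : ℝ) ≤ k)
      rw [← ENNReal.rpow_mul, one_div_mul_cancel hk0', ENNReal.rpow_one,
        ENNReal.rpow_natCast] at h2
      exact h2
    have h2 : ‖M ^ k‖₊ ≤ q ^ k := by exact_mod_cast h1
    exact_mod_cast h2
  have hlim : Tendsto (fun k : ℕ => (q : ℝ) ^ k * ‖v‖) atTop (𝓝 0) := by
    simpa using (tendsto_pow_atTop_nhds_zero_of_lt_one q.2 hq).mul_const ‖v‖
  refine squeeze_zero_norm' ?_ hlim
  filter_upwards [hev] with k hk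
  exact (Matrix.linfty_opNorm_mulVec (M ^ k) v).trans
    (mul_le_mul_of_nonneg_right hk (norm_nonneg v))

-- On an eigenvector v the inequality reads (1 - |z|²) v*Pv > 0, where v*Pv ≥ 0.
omit [DecidableEq d] in
theorem norm_lt_one_of_lyapunov {P M : Matrix d d ℂ} (hP : P.PosSemidef)
    (h : (P - Mᴴ * P * M).PosDef) (z : ℂ) (v : d → ℂ) (hv : v ≠ 0) (hM : M *ᵥ v = z • v) :
    ‖z‖ < 1 := by
  have h1 := h.dotProduct_mulVec_pos hv
  have h0 := hP.dotProduct_mulVec_nonneg v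
  have h2 : star v ⬝ᵥ (Mᴴ * P * M) *ᵥ v = ((‖z‖ ^ 2 : ℝ) : ℂ) * (star v ⬝ᵥ P *ᵥ v) := by
    rw [Matrix.mul_assoc, ← mulVec_mulVec, ← mulVec_mulVec, dotProduct_mulVec, ← star_mulVec, hM,
      mulVec_smul, star_smul, smul_dotProduct, dotProduct_smul, smul_eq_mul, smul_eq_mul,
      ← mul_assoc, ← Complex.normSq_eq_norm_sq, Complex.normSq_eq_conj_mul_self]
    rfl
  rw [sub_mulVec, dotProduct_sub, h2] at h1
  set r := star v ⬝ᵥ P *ᵥ v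
  have h3 := (Complex.pos_iff.1 h1).1
  have h4 := (Complex.nonneg_iff.1 h0).1
  rw [Complex.sub_re, Complex.re_ofReal_mul] at h3
  by_contra hz
  push Not at hz
  have : 1 ≤ ‖z‖ ^ 2 := one_le_pow₀ hz
  nlinarith

end Spectral

section Complexify

variable {d : Type*} [Fintype d]

theorem map_ofReal_form (D : Matrix d d ℝ) (a b : d → ℝ) :
    (fun i => (a i : ℂ)) ⬝ᵥ D.map Complex.ofReal *ᵥ (fun i => (b i : ℂ))
      = ((a ⬝ᵥ D *ᵥ b : ℝ) : ℂ) := by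
  simp [dotProduct, mulVec]

theorem star_map_ofReal_form {D : Matrix d d ℝ} (hD : D.IsSymm) (v : d → ℂ) :
    star v ⬝ᵥ D.map Complex.ofReal *ᵥ v
      = (((fun i => (v i).re) ⬝ᵥ D *ᵥ (fun i => (v i).re)
        + (fun i => (v i).im) ⬝ᵥ D *ᵥ (fun i => (v i).im) : ℝ) : ℂ) := by
  set a : d → ℝ := fun i => (v i).re
  set b : d → ℝ := fun i => (v i).im
  have hv : v = (fun i => (a i : ℂ)) + Complex.I • fun i => (b i : ℂ) := by
    ext i
    simp [a, b, mul_comm Complex.I, Complex.re_add_im]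
  have hs : star v = (fun i => (a i : ℂ)) - Complex.I • fun i => (b i : ℂ) := by
    ext i
    apply Complex.ext <;> simp [a, b]
  rw [hs]
  conv_lhs => rw [hv]
  simp only [mulVec_add, mulVec_smul, dotProduct_add, sub_dotProduct, smul_dotProduct,
    dotProduct_smul, smul_eq_mul, map_ofReal_form]
  rw [dotProduct_mulVec_comm_of_isSymm hD b a]
  push_cast
  linear_combination (-(b ⬝ᵥ D *ᵥ b : ℝ) : ℂ) * Complex.I_mul_I

omit [Fintype d] in
theorem map_ofReal_isHermitian_iff {D : Matrix d d ℝ} :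
    (D.map Complex.ofReal).IsHermitian ↔ D.IsSymm := by
  constructor
  · intro h
    ext i j
    have := congr_fun (congr_fun h i) j
    simpa using this
  · intro h
    ext i j
    have := congr_fun (congr_fun h i) j
    simpa using this

theorem posDef_map_ofReal_iff {D : Matrix d d ℝ} : (D.map Complex.ofReal).PosDef ↔ D.PosDef := by
  rw [posDef_iff_real, Matrix.posDef_iff_dotProduct_mulVec, map_ofReal_isHermitian_iff]
  refine and_congr_right fun hD => ⟨fun h x hx => ?_, fun h v hv => ?_⟩
  · have h1 := h (x := fun i => (x i : ℂ)) (fun h0 => hx (by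
      ext i
      simpa using congr_fun h0 i))
    rw [star_map_ofReal_form hD] at h1
    have h2 : (fun _ : d => (0 : ℝ)) = 0 := rfl
    simpa [h2] using h1
  · rw [star_map_ofReal_form hD, Complex.zero_lt_real]
    have hnn : ∀ x : d → ℝ, 0 ≤ x ⬝ᵥ D *ᵥ x := fun x => by
      by_cases hx : x = 0
      · simp [hx]
      · exact (h x hx).le
    by_cases ha : (fun i => (v i).re) = 0
    · refine add_pos_of_nonneg_of_pos (hnn _) (h _ fun hb => hv ?_)
      ext i
      exact Complex.ext (congr_fun ha i) (congr_fun hb i)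
    · exact add_pos_of_pos_of_nonneg (h _ ha) (hnn _)

theorem posSemidef_map_ofReal {D : Matrix d d ℝ} (h : D.PosSemidef) :
    (D.map Complex.ofReal).PosSemidef := by
  obtain ⟨hD, h⟩ := (posSemidef_iff_real D).1 h
  rw [Matrix.posSemidef_iff_dotProduct_mulVec, map_ofReal_isHermitian_iff]
  refine ⟨hD, fun v => ?_⟩
  rw [star_map_ofReal_form hD, Complex.zero_le_real]
  exact add_nonneg (h _) (h _)

theorem map_ofReal_mul {k l m : Type*} [Fintype l] (M : Matrix k l ℝ) (N : Matrix l m ℝ) :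
    (M * N).map Complex.ofReal = M.map Complex.ofReal * N.map Complex.ofReal :=
  Matrix.map_mul (f := Complex.ofRealHom)

end Complexify

/-! ### The Laplacian -/

section Laplacian

variable {M : ℕ}

theorem laplacian_row_sum {N : ℕ} (a : Matrix (Fin N) (Fin N) ℝ) (i : Fin N) :
    ∑ j, laplacian a i j = 0 := by
  simp [laplacian, Matrix.diagonal_apply]

theorem laplacian_mulVec {N : ℕ} (a : Matrix (Fin N) (Fin N) ℝ) (x : Fin N → ℝ) (i : Fin N) :
    (laplacian a *ᵥ x) i = ∑ j, a i j * (x i - x j) := by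
  have h : (laplacian a *ᵥ x) i = (∑ j, a i j) * x i - (a *ᵥ x) i := by
    rw [laplacian, sub_mulVec, Pi.sub_apply, mulVec_diagonal]
  rw [h]
  simp only [mul_sub, Finset.sum_sub_distrib, Finset.sum_mul, mulVec, dotProduct]

/-- The action of a matrix with vanishing row sums on the differences `x (i + 1) - x 0`. -/
def reducedMatrix {R : Type*} [Ring R] (L : Matrix (Fin (M + 1)) (Fin (M + 1)) R) :
    Matrix (Fin M) (Fin M) R :=
  Matrix.of fun i j => L i.succ j.succ - L 0 j.succ

/-- The all-ones vector lies in the kernel. Completed by all standard basis vectors but the first to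
a basis, it makes the matrix block triangular with diagonal blocks 0 and the reduced matrix. -/
theorem charpoly_eq_X_mul_charpoly_reducedMatrix {R : Type*} [CommRing R]
    (L : Matrix (Fin (M + 1)) (Fin (M + 1)) R) (hL : ∀ i, ∑ j, L i j = 0) :
    L.charpoly = Polynomial.X * (reducedMatrix L).charpoly := by
  set U : Matrix (Fin (M + 1)) (Fin (M + 1)) R :=
    Matrix.of fun i j => Fin.cases 1 (fun j' => if i = j'.succ then 1 else 0) j with hU
  set V : Matrix (Fin (M + 1)) (Fin (M + 1)) R :=
    Matrix.of fun i j => Fin.cases (Fin.cases 1 (fun _ => -1) i)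
      (fun j' => if i = j'.succ then 1 else 0) j with hV
  set T : Matrix (Fin (M + 1)) (Fin (M + 1)) R :=
    Matrix.of fun i j => Fin.cases 0 (fun j' => Fin.cases (L 0 j'.succ)
      (fun i' => reducedMatrix L i' j') i) j with hT
  have hUV : U * V = 1 := by
    ext i j
    rw [mul_apply, Fin.sum_univ_succ]
    refine Fin.cases ?_ (fun j => ?_) j <;> refine Fin.cases ?_ (fun i => ?_) i <;>
      simp [hU, hV, Matrix.one_apply, Fin.succ_ne_zero, (Fin.succ_ne_zero _).symm]
  have hL0 : ∀ i, L i 0 = -∑ j : Fin M, L i j.succ := fun i => by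
    have := hL i
    rw [Fin.sum_univ_succ] at this
    exact eq_neg_of_add_eq_zero_left this
  have hUT : ∀ i j, (U * T) i j = Fin.cases 0 (fun j' => L i j'.succ) j := by
    intro i j
    rw [mul_apply, Fin.sum_univ_succ]
    refine Fin.cases ?_ (fun j => ?_) j <;> refine Fin.cases ?_ (fun i => ?_) i <;>
      simp [hU, hT, reducedMatrix, (Fin.succ_ne_zero _).symm]
  have hconj : L = U * T * V := by
    ext i j
    rw [mul_apply, Fin.sum_univ_succ]
    simp only [hUT]
    refine Fin.cases ?_ (fun j => ?_) j
    · simp [hV, hL0]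
    · simp [hV, (Fin.succ_ne_zero _).symm]
  have hVU : V * U = 1 := mul_eq_one_comm.1 hUV
  have h1 : L.charpoly = T.charpoly := by
    rw [hconj, Matrix.charpoly_mul_comm, ← mul_assoc, hVU, one_mul]
  rw [h1, Matrix.charpoly, Matrix.det_succ_column_zero, Fin.sum_univ_succ]
  have h2 : ∀ i : Fin M, T.charmatrix i.succ 0 = 0 := by
    intro i
    rw [charmatrix_apply_ne _ _ _ (Fin.succ_ne_zero i)]
    simp [hT]
  have h3 : T.charmatrix.submatrix (Fin.succAbove 0) Fin.succ = (reducedMatrix L).charmatrix := by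
    ext i j : 1
    by_cases hij : i = j
    · subst hij
      simp [hT, charmatrix_apply_eq]
    · simp [hT, hij, charmatrix_apply_ne]
  simp only [h2, mul_zero, zero_mul, Finset.sum_const_zero, add_zero, h3]
  simp [hT, charmatrix_apply_eq, Matrix.charpoly]

theorem reducedMatrix_map (L : Matrix (Fin (M + 1)) (Fin (M + 1)) ℝ) :
    reducedMatrix (L.map Complex.ofReal) = (reducedMatrix L).map Complex.ofReal := by
  ext i j
  simp [reducedMatrix]

/-- Maximum principle: Lx is nonnegative at a maximum and nonpositive at a minimum, so t = 0. Both
extreme values then propagate against the edges to the root, where they must agree. -/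
theorem eq_const_of_laplacian_mulVec {N : ℕ} {a : Matrix (Fin N) (Fin N) ℝ}
    (ha : ∀ i j, 0 ≤ a i j) (hspan : HasSpanningTree a) {x : Fin N → ℝ} {t : ℝ}
    (hx : ∀ i, (laplacian a *ᵥ x) i = t) : ∃ s, ∀ i, x i = s := by
  obtain ⟨r, hr⟩ := hspan
  have : Nonempty (Fin N) := ⟨r⟩
  obtain ⟨i₁, h₁⟩ := Finite.exists_max x
  obtain ⟨i₂, h₂⟩ := Finite.exists_min x
  have ht : t = 0 := by
    refine le_antisymm ?_ ?_
    · rw [← hx i₂, laplacian_mulVec]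
      exact Finset.sum_nonpos fun j _ =>
        mul_nonpos_of_nonneg_of_nonpos (ha _ _) (by linarith [h₂ j])
    · rw [← hx i₁, laplacian_mulVec]
      exact Finset.sum_nonneg fun j _ => mul_nonneg (ha _ _) (by linarith [h₁ j])
  have hmax : ∀ i, x i = x i₁ → ∀ j, 0 < a i j → x j = x i₁ := by
    intro i hi j hij
    have h0 := hx i
    rw [ht, laplacian_mulVec, Finset.sum_eq_zero_iff_of_nonneg fun j _ =>
      mul_nonneg (ha _ _) (by linarith [h₁ j])] at h0
    have := (mul_eq_zero.1 (h0 j (Finset.mem_univ j))).resolve_left hij.ne'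
    linarith
  have hmin : ∀ i, x i = x i₂ → ∀ j, 0 < a i j → x j = x i₂ := by
    intro i hi j hij
    have h0 := hx i
    rw [ht, laplacian_mulVec, Finset.sum_eq_zero_iff_of_nonpos fun j _ =>
      mul_nonpos_of_nonneg_of_nonpos (ha _ _) (by linarith [h₂ j])] at h0
    have := (mul_eq_zero.1 (h0 j (Finset.mem_univ j))).resolve_left hij.ne'
    linarith
  have hback : ∀ (s : ℝ), (∀ i, x i = s → ∀ j, 0 < a i j → x j = s) → ∀ i, x i = s → x r = s := by
    intro s hs i hi
    induction hr i with
    | refl => exact hi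
    | tail _ hbc ih => exact ih (hs _ hi _ hbc)
  have e₁ := hback _ hmax i₁ rfl
  have e₂ := hback _ hmin i₂ rfl
  exact ⟨x i₁, fun i => le_antisymm (h₁ i) (by linarith [h₂ i])⟩

theorem reducedMatrix_laplacian_mulVec (a : Matrix (Fin (M + 1)) (Fin (M + 1)) ℝ)
    (x : Fin (M + 1) → ℝ) (i : Fin M) :
    (reducedMatrix (laplacian a) *ᵥ fun j => x j.succ - x 0) i
      = (laplacian a *ᵥ x) i.succ - (laplacian a *ᵥ x) 0 := by
  have h := laplacian_row_sum a
  have h1 := h i.succ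
  have h2 := h 0
  rw [Fin.sum_univ_succ] at h1 h2
  simp only [mulVec, dotProduct, reducedMatrix, of_apply, Fin.sum_univ_succ (n := M)]
  have : ∑ j : Fin M, (laplacian a i.succ j.succ - laplacian a 0 j.succ) * (x j.succ - x 0)
      = ∑ j : Fin M, laplacian a i.succ j.succ * x j.succ
        - ∑ j : Fin M, laplacian a 0 j.succ * x j.succ
        - (∑ j : Fin M, laplacian a i.succ j.succ - ∑ j : Fin M, laplacian a 0 j.succ) * x 0 := by
    rw [← Finset.sum_sub_distrib, ← Finset.sum_sub_distrib, Finset.sum_mul,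
      ← Finset.sum_sub_distrib]
    exact Finset.sum_congr rfl fun j _ => by ring
  rw [this]
  linear_combination (x 0) * (h2 - h1)

theorem det_reducedMatrix_laplacian_ne_zero {a : Matrix (Fin (M + 1)) (Fin (M + 1)) ℝ}
    (ha : ∀ i j, 0 ≤ a i j) (hspan : HasSpanningTree a) :
    (reducedMatrix (laplacian a)).det ≠ 0 := by
  intro h0
  obtain ⟨e, he, hLe⟩ := Matrix.exists_mulVec_eq_zero_iff.2 h0
  apply he
  set x : Fin (M + 1) → ℝ := Fin.cons 0 e with hx
  have hxe : (fun j : Fin M => x j.succ - x 0) = e := by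
    ext j
    simp [hx]
  obtain ⟨s, hs⟩ := eq_const_of_laplacian_mulVec ha hspan (x := x)
    (t := (laplacian a *ᵥ x) 0) (fun i => by
      refine Fin.cases rfl (fun i => ?_) i
      have := reducedMatrix_laplacian_mulVec a x i
      rw [hxe, hLe] at this
      simp only [Pi.zero_apply] at this
      linarith)
  ext j
  have h1 := hs j.succ
  have h2 := hs 0
  simp only [hx, Fin.cons_succ, Fin.cons_zero] at h1 h2
  rw [h1, ← h2]
  rfl

/-- Each Gershgorin disc has a centre ρ ≥ 0 and radius ρ, so it meets the closed left half plane
only at 0. -/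
theorem re_pos_of_mem_spectrum_laplacian {N : ℕ} {a : Matrix (Fin N) (Fin N) ℝ}
    (ha : ∀ i j, 0 ≤ a i j) {z : ℂ} (hz : z ∈ spectrum ℂ ((laplacian a).map Complex.ofReal))
    (hz0 : z ≠ 0) : 0 < z.re := by
  rw [← Matrix.spectrum_toLin', ← Module.End.hasEigenvalue_iff_mem_spectrum] at hz
  obtain ⟨k, hk⟩ := eigenvalue_mem_ball hz
  set ρ := ∑ j ∈ Finset.univ.erase k, a k j with hρ
  have hρ0 : 0 ≤ ρ := Finset.sum_nonneg fun j _ => ha k j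
  have hdiag : laplacian a k k = ρ := by
    rw [hρ, Finset.sum_erase_eq_sub (Finset.mem_univ k)]
    simp [laplacian]
  have hoff : ∑ j ∈ Finset.univ.erase k, ‖(laplacian a).map Complex.ofReal k j‖ = ρ := by
    refine Finset.sum_congr rfl fun j hj => ?_
    have hne : k ≠ j := (Finset.ne_of_mem_erase hj).symm
    simp [laplacian, Matrix.diagonal_apply_ne _ hne, abs_of_nonneg (ha k j)]
  rw [hoff, map_apply, hdiag, mem_closedBall_iff_norm] at hk
  have h1 : ‖z - (ρ : ℂ)‖ ^ 2 ≤ ρ ^ 2 := by gcongr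
  rw [← Complex.normSq_eq_norm_sq, Complex.normSq_apply] at h1
  simp only [Complex.sub_re, Complex.ofReal_re, Complex.sub_im, Complex.ofReal_im, sub_zero] at h1
  have h2 : 0 < z.re * z.re + z.im * z.im := by
    rw [← Complex.normSq_apply]
    exact Complex.normSq_pos.2 hz0
  by_contra hneg
  push Not at hneg
  nlinarith [mul_nonneg hρ0 (neg_nonneg.2 hneg)]

/-- The listed modes are the eigenvalues of the reduced Laplacian. -/
theorem ListsModes.map_eq_roots {a : Matrix (Fin (M + 1)) (Fin (M + 1)) ℝ} {lam : Fin M → ℂ}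
    (h : ListsModes (laplacian a) lam) : Finset.univ.val.map lam
      = ((reducedMatrix (laplacian a)).map Complex.ofReal).charpoly.roots := by
  have h1 := h
  unfold ListsModes at h1
  rw [charpoly_eq_X_mul_charpoly_reducedMatrix, reducedMatrix_map, Polynomial.roots_mul,
    Polynomial.roots_X, Multiset.singleton_add] at h1
  · exact (Multiset.cons_inj_right _).1 h1
  · exact mul_ne_zero Polynomial.X_ne_zero (Matrix.charpoly_monic _).ne_zero
  · intro i
    have := laplacian_row_sum a i
    simp only [map_apply]
    exact_mod_cast this

theorem ListsModes.mem_spectrum_iff {a : Matrix (Fin (M + 1)) (Fin (M + 1)) ℝ} {lam : Fin M → ℂ}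
    (h : ListsModes (laplacian a) lam) (z : ℂ) :
    z ∈ spectrum ℂ ((reducedMatrix (laplacian a)).map Complex.ofReal) ↔ ∃ i, lam i = z := by
  rw [Matrix.mem_spectrum_iff_isRoot_charpoly,
    ← Polynomial.mem_roots (Matrix.charpoly_monic _).ne_zero, ← h.map_eq_roots]
  simp

theorem ListsModes.re_pos {a : Matrix (Fin (M + 1)) (Fin (M + 1)) ℝ} {lam : Fin M → ℂ}
    (h : ListsModes (laplacian a) lam) (ha : ∀ i j, 0 ≤ a i j) (hspan : HasSpanningTree a)
    (i : Fin M) : 0 < (lam i).re := by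
  have hmem := (h.mem_spectrum_iff _).2 ⟨i, rfl⟩
  have hroot := (Matrix.mem_spectrum_iff_isRoot_charpoly).1 hmem
  refine re_pos_of_mem_spectrum_laplacian ha ?_ ?_
  · rw [Matrix.mem_spectrum_iff_isRoot_charpoly, charpoly_eq_X_mul_charpoly_reducedMatrix,
      reducedMatrix_map]
    · exact Polynomial.root_mul_left_of_isRoot _ hroot
    · intro i
      have := laplacian_row_sum a i
      simp only [map_apply]
      exact_mod_cast this
  · intro h0
    rw [h0] at hmem
    rw [spectrum.zero_mem_iff, Matrix.isUnit_iff_isUnit_det, isUnit_iff_ne_zero, not_not] at hmem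
    have h1 : ((reducedMatrix (laplacian a)).map Complex.ofReal).det
        = ((reducedMatrix (laplacian a)).det : ℂ) :=
      (Complex.ofRealHom.map_det (reducedMatrix (laplacian a))).symm
    rw [h1, Complex.ofReal_eq_zero] at hmem
    exact det_reducedMatrix_laplacian_ne_zero ha hspan hmem

end Laplacian

/-! ### Consensus -/

section Dynamics

variable {M n m : ℕ}

open scoped Kronecker

/-- The matrix that drives the stacked differences `x (i + 1) - x 0`. -/
noncomputable def stackedMatrix (A : Matrix (Fin n) (Fin n) ℂ) (G : Matrix (Fin n) (Fin n) ℂ)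
    (L : Matrix (Fin M) (Fin M) ℂ) (c : ℂ) : Matrix (Fin M × Fin n) (Fin M × Fin n) ℂ :=
  (1 : Matrix (Fin M) (Fin M) ℂ) ⊗ₖ A - c • (L ⊗ₖ G)

theorem stackedMatrix_mulVec (A : Matrix (Fin n) (Fin n) ℂ) (G : Matrix (Fin n) (Fin n) ℂ)
    (L : Matrix (Fin M) (Fin M) ℂ) (c : ℂ) (v : Fin M × Fin n → ℂ) (i : Fin M) (s : Fin n) :
    (stackedMatrix A G L c *ᵥ v) (i, s)
      = (A *ᵥ fun t => v (i, t)) s - c * (G *ᵥ fun t => (L *ᵥ fun j => v (j, t)) i) s := by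
  simp only [stackedMatrix, sub_mulVec, smul_mulVec, Pi.sub_apply, Pi.smul_apply, smul_eq_mul]
  congr 1
  · simp [mulVec, dotProduct, Fintype.sum_prod_type, Matrix.one_apply]
  · congr 1
    simp only [mulVec, dotProduct, Fintype.sum_prod_type, kroneckerMap_apply, Finset.mul_sum]
    rw [Finset.sum_comm]
    exact Finset.sum_congr rfl fun t _ => Finset.sum_congr rfl fun j _ => by ring

/-- L ⊗ I commutes with the stacked matrix, so it has an eigenvector inside the eigenspace for z.
Slices of this common eigenvector are eigenvectors of L and of the mode matrix; L need not be
diagonalizable. -/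
theorem exists_mode_of_stackedMatrix_eigenvector {A : Matrix (Fin n) (Fin n) ℂ}
    {G : Matrix (Fin n) (Fin n) ℂ} {L : Matrix (Fin M) (Fin M) ℂ} {c z : ℂ}
    {v : Fin M × Fin n → ℂ} (hv : v ≠ 0) (h : stackedMatrix A G L c *ᵥ v = z • v) :
    ∃ l ∈ spectrum ℂ L, ∃ w, w ≠ 0 ∧ (A - (c * l) • G) *ᵥ w = z • w := by
  set T := stackedMatrix A G L c with hT
  set S : Matrix (Fin M × Fin n) (Fin M × Fin n) ℂ :=
    L ⊗ₖ (1 : Matrix (Fin n) (Fin n) ℂ) with hS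
  have hcomm : T * S = S * T := by
    simp only [hT, hS, stackedMatrix, sub_mul, mul_sub, smul_mul_assoc, mul_smul_comm,
      ← mul_kronecker_mul, one_mul, mul_one]
  have hcommL : Commute (toLin' T) (toLin' S) := by
    rw [Commute, SemiconjBy, Module.End.mul_eq_comp, Module.End.mul_eq_comp, ← toLin'_mul,
      ← toLin'_mul, hcomm]
  have hmaps : Set.MapsTo (toLin' S) (Module.End.eigenspace (toLin' T) z) (Module.End.eigenspace (toLin' T) z) :=
    Module.End.mapsTo_genEigenspace_of_comm hcommL z 1
  have hmem : v ∈ Module.End.eigenspace (toLin' T) z := Module.End.mem_eigenspace_iff.2 (by simpa using h)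
  have : Nontrivial (Module.End.eigenspace (toLin' T) z) :=
    ⟨⟨⟨v, hmem⟩, 0, fun h0 => hv (congrArg Subtype.val h0)⟩⟩
  obtain ⟨l, hl⟩ := Module.End.exists_eigenvalue ((toLin' S).restrict hmaps)
  obtain ⟨v', hv'⟩ := hl.exists_hasEigenvector
  have hSv : S *ᵥ v'.1 = l • v'.1 := by
    rw [← toLin'_apply]
    exact congrArg Subtype.val hv'.apply_eq_smul
  have hTv : T *ᵥ v'.1 = z • v'.1 := by
    have := Module.End.mem_eigenspace_iff.1 v'.2
    simpa using this
  have hLv : ∀ i t, (L *ᵥ fun j => v'.1 (j, t)) i = l * v'.1 (i, t) := by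
    intro i t
    have := congr_fun hSv (i, t)
    simpa [hS, mulVec, dotProduct, Fintype.sum_prod_type, Matrix.one_apply] using this
  have hne : v'.1 ≠ 0 := fun h0 => hv'.2 (Subtype.ext h0)
  obtain ⟨⟨i, s⟩, his⟩ := Function.ne_iff.1 hne
  refine ⟨l, mem_spectrum_of_eigenvector (v := fun j => v'.1 (j, s))
    (fun h0 => his (congr_fun h0 i)) (funext fun j => by simpa using hLv j s),
    fun t => v'.1 (i, t), fun h0 => his (congr_fun h0 s), funext fun t => ?_⟩
  have h1 : (stackedMatrix A G L c *ᵥ v'.1) (i, t) = (z • v'.1) (i, t) := congr_fun hTv (i, t)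
  rw [stackedMatrix_mulVec] at h1
  simp only [hLv] at h1
  have h2 : (fun t => l * v'.1 (i, t)) = l • fun t => v'.1 (i, t) := rfl
  rw [h2, mulVec_smul] at h1
  rw [sub_mulVec, smul_mulVec, Pi.sub_apply, Pi.smul_apply, smul_eq_mul, mul_assoc]
  exact h1

theorem IsClosedLoopTrajectory.difference_succ {a : Matrix (Fin (M + 1)) (Fin (M + 1)) ℝ}
    {A : Matrix (Fin n) (Fin n) ℝ} {B : Matrix (Fin n) (Fin m) ℝ} {c : ℝ}
    {K : Matrix (Fin m) (Fin n) ℝ} {x : ℕ → Fin (M + 1) → Fin n → ℝ}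
    (hx : IsClosedLoopTrajectory a A B c K x) (k : ℕ) (i : Fin M) :
    x (k + 1) i.succ - x (k + 1) 0 = A *ᵥ (x k i.succ - x k 0)
      - c • ((B * K) *ᵥ fun t => (reducedMatrix (laplacian a) *ᵥ
        fun j => (x k j.succ - x k 0) t) i) := by
  have hsum : ∀ i, (∑ j, a i j • (x k i - x k j)) = fun t => (laplacian a *ᵥ fun j => x k j t) i := by
    intro i
    ext t
    rw [laplacian_mulVec]
    simp
  have hred : (fun t => (reducedMatrix (laplacian a) *ᵥ fun j => (x k j.succ - x k 0) t) i)
      = (fun t => (laplacian a *ᵥ fun j => x k j t) i.succ)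
        - fun t => (laplacian a *ᵥ fun j => x k j t) 0 := by
    ext t
    exact reducedMatrix_laplacian_mulVec a (fun j => x k j t) i
  rw [hx, hx, hsum, hsum, hred]
  simp only [mulVec_neg, mulVec_smul, ← mulVec_mulVec, mulVec_sub, smul_sub]
  abel

theorem reachesConsensusAtRate {a : Matrix (Fin (M + 1)) (Fin (M + 1)) ℝ} {lam : Fin M → ℂ}
    (h : ListsModes (laplacian a) lam) {μ : ℝ} {A : Matrix (Fin n) (Fin n) ℝ}
    {B : Matrix (Fin n) (Fin m) ℝ} {c : ℝ} {K : Matrix (Fin m) (Fin n) ℝ}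
    (hmode : ∀ i (z : ℂ) v, v ≠ 0 → ((μ : ℂ) • modeMatrix A B K c (lam i)) *ᵥ v = z • v → ‖z‖ < 1) :
    ReachesConsensusAtRate μ a A B c K := by
  intro x hx
  set Lr := (reducedMatrix (laplacian a)).map Complex.ofReal with hLr
  set T := stackedMatrix (A.map Complex.ofReal) ((B * K).map Complex.ofReal) Lr c with hT
  set e : ℕ → Fin M × Fin n → ℂ := fun k p => ((x k p.1.succ - x k 0) p.2 : ℝ) with he
  have hstep : ∀ k, e (k + 1) = T *ᵥ e k := by
    intro k
    ext ⟨i, s⟩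
    rw [hT, stackedMatrix_mulVec]
    simp only [he]
    rw [hx.difference_succ k i]
    simp [mulVec, dotProduct, hLr]
  have hiter : ∀ k, e k = (T ^ k) *ᵥ e 0 := by
    intro k
    induction k with
    | zero => simp
    | succ k ih => rw [hstep, ih, mulVec_mulVec, ← pow_succ']
  have heig : ∀ (z : ℂ) (v : Fin M × Fin n → ℂ), v ≠ 0 → ((μ : ℂ) • T) *ᵥ v = z • v →
      ‖z‖ < 1 := by
    intro z v hv hz
    have hstack : (μ : ℂ) • T = stackedMatrix ((μ : ℂ) • A.map Complex.ofReal)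
        ((μ : ℂ) • (B * K).map Complex.ofReal) Lr c := by
      rw [hT, stackedMatrix, stackedMatrix, smul_sub, kronecker_smul, kronecker_smul,
        smul_comm (μ : ℂ) (c : ℂ)]
    rw [hstack] at hz
    obtain ⟨l, hl, w, hw, hlw⟩ := exists_mode_of_stackedMatrix_eigenvector hv hz
    obtain ⟨i, rfl⟩ := (h.mem_spectrum_iff l).1 hl
    refine hmode i z w hw ?_
    rw [← hlw, modeMatrix, smul_sub, smul_comm (μ : ℂ)]
  have hlim := tendsto_pow_mulVec_zero heig (e 0)
  have hdiff : ∀ i s, Tendsto (fun k => μ ^ k * (x k i s - x k 0 s)) atTop (𝓝 0) := by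
    intro i s
    refine Fin.cases (by simp) (fun i => ?_) i
    have h1 := (tendsto_pi_nhds.1 hlim) (i, s)
    have h2 := (Complex.continuous_re.tendsto _).comp h1
    simp only [Pi.zero_apply, Complex.zero_re] at h2
    refine h2.congr fun k => ?_
    have h3 : (((μ : ℂ) • T) ^ k) *ᵥ e 0 = ((μ ^ k : ℝ) : ℂ) • e k := by
      rw [smul_pow, smul_mulVec, ← hiter, Complex.ofReal_pow]
    rw [Function.comp_apply, h3, Pi.smul_apply, smul_eq_mul, Complex.re_ofReal_mul]
    simp only [he, Complex.ofReal_re, Pi.sub_apply]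
  intro i j
  have hvec : Tendsto (fun k => μ ^ k • (x k i - x k j)) atTop (𝓝 0) := by
    refine tendsto_pi_nhds.2 fun s => ?_
    have := (hdiff i s).sub (hdiff j s)
    rw [sub_zero] at this
    refine this.congr fun k => ?_
    simp only [Pi.smul_apply, Pi.sub_apply, smul_eq_mul]
    ring
  have h4 := hvec.norm
  rw [norm_zero] at h4
  refine (tendsto_zero_iff_abs_tendsto_zero _).2 (h4.congr fun k => ?_)
  simp [norm_smul, abs_mul]

end Dynamics

/-! ### The Riccati equation and the Q-function -/

section Riccati

variable {n m : ℕ} {μ γ : ℝ} {A : Matrix (Fin n) (Fin n) ℝ} {B : Matrix (Fin n) (Fin m) ℝ}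
  {Q P : Matrix (Fin n) (Fin n) ℝ}

theorem transpose_mul_mul_form {k l d : Type*} [Fintype k] [Fintype l] [Fintype d]
    (S : Matrix d k ℝ) (P : Matrix d d ℝ) (T : Matrix d l ℝ) (x : k → ℝ) (y : l → ℝ) :
    x ⬝ᵥ (Sᵀ * P * T) *ᵥ y = (S *ᵥ x) ⬝ᵥ P *ᵥ (T *ᵥ y) := by
  rw [Matrix.mul_assoc, ← mulVec_mulVec, ← mulVec_mulVec, dotProduct_mulVec, vecMul_transpose]

theorem qMatrix_toBlocks₁₁ :
    (qMatrix μ A B Q γ P).toBlocks₁₁ = Q + μ ^ 2 • (Aᵀ * P * A) := rfl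

theorem qMatrix_toBlocks₁₂ : (qMatrix μ A B Q γ P).toBlocks₁₂ = μ ^ 2 • (Aᵀ * P * B) := rfl

theorem qMatrix_toBlocks₂₂ :
    (qMatrix μ A B Q γ P).toBlocks₂₂ = γ • 1 + μ ^ 2 • (Bᵀ * P * B) := rfl

theorem qMatrix_toBlocks₁₂_transpose (hP : P.IsSymm) :
    (qMatrix μ A B Q γ P).toBlocks₁₂ᵀ = μ ^ 2 • (Bᵀ * P * A) := by
  rw [qMatrix_toBlocks₁₂, transpose_smul, transpose_mul, transpose_mul, transpose_transpose,
    hP.eq, Matrix.mul_assoc]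

theorem qMatrix_toBlocks₂₂_isSymm (hP : P.IsSymm) : (qMatrix μ A B Q γ P).toBlocks₂₂.IsSymm := by
  rw [qMatrix_toBlocks₂₂, Matrix.IsSymm, transpose_add, transpose_smul, transpose_smul,
    transpose_one, transpose_mul, transpose_mul, transpose_transpose, hP.eq, Matrix.mul_assoc]

theorem qMatrix_isSymm (hQ : Q.IsSymm) (hP : P.IsSymm) : (qMatrix μ A B Q γ P).IsSymm := by
  refine Matrix.isSymm_fromBlocks_iff.2 ⟨?_, qMatrix_toBlocks₁₂_transpose (Q := Q) (γ := γ) hP, ?_,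
    qMatrix_toBlocks₂₂_isSymm (A := A) (Q := Q) hP⟩
  · rw [Matrix.IsSymm, transpose_add, transpose_smul, transpose_mul, transpose_mul,
      transpose_transpose, hP.eq, hQ.eq, Matrix.mul_assoc]
  · rw [← qMatrix_toBlocks₁₂_transpose (Q := Q) (γ := γ) hP, transpose_transpose,
      qMatrix_toBlocks₁₂]

theorem qMatrix_toBlocks₂₂_form (u : Fin m → ℝ) :
    u ⬝ᵥ (qMatrix μ A B Q γ P).toBlocks₂₂ *ᵥ u
      = γ * (u ⬝ᵥ u) + μ ^ 2 * ((B *ᵥ u) ⬝ᵥ P *ᵥ (B *ᵥ u)) := by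
  rw [qMatrix_toBlocks₂₂, add_mulVec, smul_mulVec, smul_mulVec, one_mulVec, dotProduct_add,
    dotProduct_smul, dotProduct_smul, transpose_mul_mul_form, smul_eq_mul, smul_eq_mul]

theorem qMatrix_coercive (hP : P.PosSemidef) (u : Fin m → ℝ) :
    γ * (u ⬝ᵥ u) ≤ u ⬝ᵥ (qMatrix μ A B Q γ P).toBlocks₂₂ *ᵥ u := by
  rw [qMatrix_toBlocks₂₂_form]
  have := mul_nonneg (sq_nonneg μ) (((posSemidef_iff_real P).1 hP).2 (B *ᵥ u))
  linarith

theorem qMatrix_toBlocks₂₂_posDef (hP : P.PosSemidef) (hγ : 0 < γ) :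
    (qMatrix μ A B Q γ P).toBlocks₂₂.PosDef := by
  refine (posDef_iff_real _).2
    ⟨qMatrix_toBlocks₂₂_isSymm ((posSemidef_iff_real P).1 hP).1, fun u hu => ?_⟩
  exact lt_of_lt_of_le (mul_pos hγ (dotProduct_self_pos_real hu)) (qMatrix_coercive hP u)

theorem qMatrix_factor (hP : P.PosSemidef) (hγ : 0 < γ) :
    (qMatrix μ A B Q γ P).toBlocks₁₂ᵀ
      = (qMatrix μ A B Q γ P).toBlocks₂₂ * gain (qMatrix μ A B Q γ P) := by
  rw [gain, Matrix.mul_nonsing_inv_cancel_left]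
  exact (Matrix.isUnit_iff_isUnit_det _).1
    (qMatrix_toBlocks₂₂_posDef (A := A) (Q := Q) hP hγ).isUnit

theorem lyapMatrix_qMatrix (hP : IsRiccatiSolution μ A B Q γ P) :
    lyapMatrix (qMatrix μ A B Q γ P) = P := by
  have hs := ((posSemidef_iff_real P).1 hP.1).1
  conv_rhs => rw [hP.2]
  rw [lyapMatrix, qMatrix_toBlocks₁₂_transpose hs, qMatrix_toBlocks₁₁, qMatrix_toBlocks₁₂,
    qMatrix_toBlocks₂₂, Matrix.smul_mul, Matrix.smul_mul, Matrix.mul_smul, smul_smul,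
    show μ ^ 2 * μ ^ 2 = μ ^ 4 by ring]

/-- The Riccati equation in terms of the gain. -/
theorem IsRiccatiSolution.eq_gain (hP : IsRiccatiSolution μ A B Q γ P) (hγ : 0 < γ) :
    P = Q + μ ^ 2 • (Aᵀ * P * A) - (gain (qMatrix μ A B Q γ P))ᵀ
      * (qMatrix μ A B Q γ P).toBlocks₂₂ * gain (qMatrix μ A B Q γ P) := by
  have hs := ((posSemidef_iff_real P).1 hP.1).1
  have h22 := qMatrix_toBlocks₂₂_isSymm (μ := μ) (γ := γ) (A := A) (B := B) (Q := Q) hs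
  conv_lhs => rw [← lyapMatrix_qMatrix hP]
  rw [lyapMatrix, Matrix.mul_assoc _ _ (_ᵀ), ← gain, qMatrix_toBlocks₁₁,
    ← transpose_transpose (qMatrix μ A B Q γ P).toBlocks₁₂, qMatrix_factor hP.1 hγ,
    transpose_mul, h22.eq]

/-- The Q-function of the matrix `H` at the state `x` and the input `u`. -/
def qForm (H : Matrix (Fin n ⊕ Fin m) (Fin n ⊕ Fin m) ℝ) (x : Fin n → ℝ) (u : Fin m → ℝ) : ℝ :=
  Sum.elim x u ⬝ᵥ H *ᵥ Sum.elim x u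

theorem qForm_eq_blocks {H : Matrix (Fin n ⊕ Fin m) (Fin n ⊕ Fin m) ℝ} (hH : H.IsSymm)
    (x : Fin n → ℝ) (u : Fin m → ℝ) :
    qForm H x u = x ⬝ᵥ H.toBlocks₁₁ *ᵥ x + 2 * (x ⬝ᵥ H.toBlocks₁₂ *ᵥ u)
      + u ⬝ᵥ H.toBlocks₂₂ *ᵥ u := by
  have h21 : H.toBlocks₂₁ = H.toBlocks₁₂ᵀ := by
    ext i j
    exact hH.apply _ _
  have h := fromBlocks_toBlocks H
  rw [qForm]
  conv_lhs => rw [← h]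
  rw [fromBlocks_mulVec, sumElim_dotProduct_sumElim, h21]
  simp only [Sum.elim_comp_inl, Sum.elim_comp_inr, dotProduct_add, dotProduct_transpose_mulVec]
  ring

theorem qForm_qMatrix (hQ : Q.IsSymm) (hP : P.IsSymm) (x : Fin n → ℝ) (u : Fin m → ℝ) :
    qForm (qMatrix μ A B Q γ P) x u = x ⬝ᵥ Q *ᵥ x + γ * (u ⬝ᵥ u)
      + μ ^ 2 * ((A *ᵥ x + B *ᵥ u) ⬝ᵥ P *ᵥ (A *ᵥ x + B *ᵥ u)) := by
  rw [qForm_eq_blocks (qMatrix_isSymm hQ hP), qMatrix_toBlocks₂₂_form, qMatrix_toBlocks₁₁,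
    qMatrix_toBlocks₁₂]
  simp only [add_mulVec, smul_mulVec, mulVec_add, dotProduct_add, add_dotProduct, dotProduct_smul,
    transpose_mul_mul_form, smul_eq_mul]
  rw [dotProduct_mulVec_comm_of_isSymm hP (B *ᵥ u) (A *ᵥ x)]
  ring

/-- Completing the square in the input; the Riccati equation identifies the minimum, attained at u =
-Kx, as xᵀPx. -/
theorem qForm_qMatrix_eq_square (hQ : Q.IsSymm) (hP : IsRiccatiSolution μ A B Q γ P) (hγ : 0 < γ)
    (x : Fin n → ℝ) (u : Fin m → ℝ) :
    qForm (qMatrix μ A B Q γ P) x u = x ⬝ᵥ P *ᵥ x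
      + (u + gain (qMatrix μ A B Q γ P) *ᵥ x) ⬝ᵥ (qMatrix μ A B Q γ P).toBlocks₂₂ *ᵥ
        (u + gain (qMatrix μ A B Q γ P) *ᵥ x) := by
  have hs := ((posSemidef_iff_real P).1 hP.1).1
  have h22 := qMatrix_toBlocks₂₂_isSymm (μ := μ) (γ := γ) (A := A) (B := B) (Q := Q) hs
  have h1 : x ⬝ᵥ P *ᵥ x = x ⬝ᵥ (qMatrix μ A B Q γ P).toBlocks₁₁ *ᵥ x
      - (gain (qMatrix μ A B Q γ P) *ᵥ x) ⬝ᵥ (qMatrix μ A B Q γ P).toBlocks₂₂ *ᵥ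
        (gain (qMatrix μ A B Q γ P) *ᵥ x) := by
    conv_lhs => rw [hP.eq_gain hγ]
    rw [sub_mulVec, dotProduct_sub, transpose_mul_mul_form, qMatrix_toBlocks₁₁]
  have h2 : x ⬝ᵥ (qMatrix μ A B Q γ P).toBlocks₁₂ *ᵥ u
      = u ⬝ᵥ (qMatrix μ A B Q γ P).toBlocks₂₂ *ᵥ (gain (qMatrix μ A B Q γ P) *ᵥ x) := by
    rw [mulVec_mulVec, ← qMatrix_factor hP.1 hγ, dotProduct_transpose_mulVec]
  rw [qForm_eq_blocks (qMatrix_isSymm hQ hs), h1, h2]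
  simp only [mulVec_add, dotProduct_add, add_dotProduct]
  rw [dotProduct_mulVec_comm_of_isSymm h22 (gain (qMatrix μ A B Q γ P) *ᵥ x) u]
  ring

end Riccati

/-! ### The modewise Lyapunov inequality -/

section Lyapunov

variable {n m : ℕ} {μ γ : ℝ} {A : Matrix (Fin n) (Fin n) ℝ} {B : Matrix (Fin n) (Fin m) ℝ}
  {Q P : Matrix (Fin n) (Fin n) ℝ}

/-- The real matrix to which the modewise Lyapunov inequality reduces. -/
noncomputable def modeDefect (Q : Matrix (Fin n) (Fin n) ℝ) (γ : ℝ)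
    (H : Matrix (Fin n ⊕ Fin m) (Fin n ⊕ Fin m) ℝ) (c : ℝ) (l : ℂ) : Matrix (Fin n) (Fin n) ℝ :=
  Q + (c ^ 2 * ‖l‖ ^ 2 * γ) • ((gain H)ᵀ * gain H)
    - ‖1 - (c : ℂ) * l‖ ^ 2 • ((gain H)ᵀ * H.toBlocks₂₂ * gain H)

/-- In the expanded product H₁₂ᵀ = H₂₂K makes the mixed terms multiples of KᵀH₂₂K, and the last one
is a multiple of KᵀH₂₂K - γKᵀK. With the Riccati equation only the real factors |1 - cl|² and |cl|²
survive. -/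
theorem lyapunovIneq_iff_posDef_modeDefect (hP : IsRiccatiSolution μ A B Q γ P) (hγ : 0 < γ)
    (c : ℝ) (l : ℂ) :
    LyapunovIneq μ A B P (gain (qMatrix μ A B Q γ P)) c l ↔
      (modeDefect Q γ (qMatrix μ A B Q γ P) c l).PosDef := by
  have hs := ((posSemidef_iff_real P).1 hP.1).1
  have h22 := qMatrix_toBlocks₂₂_isSymm (μ := μ) (γ := γ) (A := A) (B := B) (Q := Q) hs
  have hfac := qMatrix_factor (μ := μ) (A := A) (B := B) (Q := Q) hP.1 hγ
  have hric := hP.eq_gain hγ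
  have h12 := qMatrix_toBlocks₁₂_transpose (μ := μ) (γ := γ) (A := A) (B := B) (Q := Q) hs
  have h22' := qMatrix_toBlocks₂₂ (μ := μ) (γ := γ) (A := A) (B := B) (Q := Q) (P := P)
  rw [LyapunovIneq, modeDefect, ← posDef_map_ofReal_iff]
  set K := gain (qMatrix μ A B Q γ P) with hK
  set R := (qMatrix μ A B Q γ P).toBlocks₂₂ with hR
  have hX3 : μ ^ 2 • ((B * K)ᵀ * P * A) = Kᵀ * R * K := by
    rw [Matrix.mul_assoc Kᵀ, ← hfac, h12, transpose_mul]
    simp only [Matrix.mul_assoc, Matrix.mul_smul]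
  have hX2 : μ ^ 2 • (Aᵀ * P * (B * K)) = Kᵀ * R * K := by
    have h1 := congrArg transpose hX3
    simp only [transpose_smul, transpose_mul, transpose_transpose, hs.eq, h22.eq] at h1
    rw [Matrix.mul_assoc Kᵀ, ← h1]
    simp only [Matrix.mul_assoc]
  have hX4 : μ ^ 2 • ((B * K)ᵀ * P * (B * K)) = Kᵀ * R * K - γ • (Kᵀ * K) := by
    rw [h22']
    simp only [transpose_mul, Matrix.mul_add, Matrix.add_mul, Matrix.mul_assoc, Matrix.mul_smul,
      Matrix.smul_mul, Matrix.one_mul, add_sub_cancel_left]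
  suffices h : P.map Complex.ofReal - ((μ : ℂ) • modeMatrix A B K c l)ᴴ * P.map Complex.ofReal
      * ((μ : ℂ) • modeMatrix A B K c l) = (Q + (c ^ 2 * ‖l‖ ^ 2 * γ) • (Kᵀ * K)
        - ‖1 - (c : ℂ) * l‖ ^ 2 • (Kᵀ * R * K)).map Complex.ofReal by rw [h]
  have hconj : ∀ S : Matrix (Fin n) (Fin n) ℝ, (S.map Complex.ofReal)ᴴ = Sᵀ.map Complex.ofReal := by
    intro S
    ext i j
    simp
  have hexp : ((μ : ℂ) • modeMatrix A B K c l)ᴴ * P.map Complex.ofReal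
      * ((μ : ℂ) • modeMatrix A B K c l)
      = ((μ : ℂ) ^ 2) • ((Aᵀ * P * A).map Complex.ofReal
        - (c * l) • (Aᵀ * P * (B * K)).map Complex.ofReal
        - (starRingEnd ℂ (c * l)) • ((B * K)ᵀ * P * A).map Complex.ofReal
        + (starRingEnd ℂ (c * l) * (c * l)) • ((B * K)ᵀ * P * (B * K)).map Complex.ofReal) := by
    rw [modeMatrix, conjTranspose_smul, conjTranspose_sub, conjTranspose_smul, hconj, hconj]
    simp only [map_ofReal_mul _ A, map_ofReal_mul _ (B * K), map_ofReal_mul _ P]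
    simp only [Matrix.sub_mul, Matrix.mul_sub, Matrix.smul_mul, Matrix.mul_smul, smul_sub, smul_add,
      smul_smul, RCLike.star_def, Complex.conj_ofReal]
    module
  rw [hexp]
  ext i j
  have e1 := congrArg (Complex.ofReal) (congr_fun (congr_fun hric i) j)
  have e2 := congrArg (Complex.ofReal) (congr_fun (congr_fun hX2 i) j)
  have e3 := congrArg (Complex.ofReal) (congr_fun (congr_fun hX3 i) j)
  have e4 := congrArg (Complex.ofReal) (congr_fun (congr_fun hX4 i) j)
  have e5 : ((‖1 - (c : ℂ) * l‖ : ℝ) : ℂ) ^ 2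
      = (1 - c * starRingEnd ℂ l) * (1 - c * l) := by
    rw [← Complex.conj_mul', map_sub, map_one, map_mul, Complex.conj_ofReal]
  have e6 := (Complex.conj_mul' l).symm
  simp only [Matrix.sub_apply, Matrix.add_apply, Matrix.smul_apply, smul_eq_mul, Complex.ofReal_sub, Complex.ofReal_add,
    Complex.ofReal_mul, Complex.ofReal_pow] at e1 e2 e3 e4
  simp only [map_apply, Matrix.sub_apply, Matrix.add_apply, Matrix.smul_apply, smul_eq_mul, Complex.ofReal_sub,
    Complex.ofReal_add, Complex.ofReal_mul, Complex.ofReal_pow, map_mul, Complex.conj_ofReal]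
  rw [e5, e6]
  linear_combination e1 + c * l * e2 + c * starRingEnd ℂ l * e3
    - c * starRingEnd ℂ l * (c * l) * e4

theorem modeDefect_form (H : Matrix (Fin n ⊕ Fin m) (Fin n ⊕ Fin m) ℝ) (c : ℝ) (l : ℂ)
    (x : Fin n → ℝ) :
    x ⬝ᵥ modeDefect Q γ H c l *ᵥ x = x ⬝ᵥ Q *ᵥ x
      + c ^ 2 * ‖l‖ ^ 2 * γ * (gain H *ᵥ x ⬝ᵥ gain H *ᵥ x)
      - ‖1 - (c : ℂ) * l‖ ^ 2 * (gain H *ᵥ x ⬝ᵥ H.toBlocks₂₂ *ᵥ gain H *ᵥ x) := by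
  have h := transpose_mul_mul_form (gain H) 1 (gain H) x x
  rw [Matrix.mul_one, one_mulVec] at h
  rw [modeDefect, sub_mulVec, add_mulVec, smul_mulVec, smul_mulVec, dotProduct_sub, dotProduct_add,
    dotProduct_smul, dotProduct_smul, transpose_mul_mul_form, h, smul_eq_mul, smul_eq_mul]

theorem modeDefect_isSymm (hQ : Q.IsSymm) {H : Matrix (Fin n ⊕ Fin m) (Fin n ⊕ Fin m) ℝ}
    (h22 : H.toBlocks₂₂.IsSymm) (c : ℝ) (l : ℂ) : (modeDefect Q γ H c l).IsSymm := by
  rw [modeDefect, Matrix.IsSymm]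
  simp only [transpose_sub, transpose_add, transpose_smul, transpose_mul, transpose_transpose,
    hQ.eq, h22.eq, Matrix.mul_assoc]

/-- A solution of the modewise Lyapunov inequality for one mode gives one for the optimal gain. -/
theorem posDef_modeDefect_one (hQ : Q.PosSemidef) (hγ : 0 < γ)
    {H : Matrix (Fin n ⊕ Fin m) (Fin n ⊕ Fin m) ℝ} (h22 : H.toBlocks₂₂.IsSymm) {c : ℝ} {l : ℂ}
    (h : (modeDefect Q γ H c l).PosDef) : (modeDefect Q γ H 1 1).PosDef := by
  obtain ⟨hQs, hQp⟩ := (posSemidef_iff_real Q).1 hQ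
  refine (posDef_iff_real _).2 ⟨modeDefect_isSymm hQs h22 1 1, fun x hx => ?_⟩
  have h1 := ((posDef_iff_real _).1 h).2 x hx
  -- For c = l = 1 the negative term disappears and Q + γKᵀK remains; on ker K it agrees with the
  -- given positive form.
  rw [modeDefect_form] at h1 ⊢
  simp only [Complex.ofReal_one, mul_one, sub_self, norm_zero, norm_one, one_pow, one_mul, ne_eq,
    OfNat.ofNat_ne_zero, not_false_eq_true, zero_pow, zero_mul, sub_zero]
  by_cases hK : gain H *ᵥ x = 0
  · simpa [hK] using h1
  · exact add_pos_of_nonneg_of_pos (hQp x) (mul_pos hγ (dotProduct_self_pos_real hK))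

/-- The optimal closed loop `μ (A - B K)` is stable. -/
theorem tendsto_optimalLoop_pow (hP : IsRiccatiSolution μ A B Q γ P)
    (h : LyapunovIneq μ A B P (gain (qMatrix μ A B Q γ P)) 1 1) (x : Fin n → ℝ) :
    Tendsto (fun k => ((μ • (A - B * gain (qMatrix μ A B Q γ P))) ^ k) *ᵥ x) atTop (𝓝 0) := by
  set F := μ • (A - B * gain (qMatrix μ A B Q γ P)) with hF
  have hM : (μ : ℂ) • modeMatrix A B (gain (qMatrix μ A B Q γ P)) 1 1 = F.map Complex.ofReal := by
    ext i j
    simp [modeMatrix, hF]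
  have hlim := tendsto_pow_mulVec_zero
    (norm_lt_one_of_lyapunov (posSemidef_map_ofReal hP.1) h) (fun i => (x i : ℂ))
  rw [hM] at hlim
  have hpow : ∀ k, (F.map Complex.ofReal) ^ k *ᵥ (fun i => (x i : ℂ))
      = fun i => (((F ^ k *ᵥ x) i : ℝ) : ℂ) := by
    intro k
    have : (F.map Complex.ofReal) ^ k = (F ^ k).map Complex.ofReal :=
      (map_pow (Complex.ofRealHom.mapMatrix) F k).symm
    rw [this]
    ext i
    simp [mulVec, dotProduct]
  refine tendsto_pi_nhds.2 fun i => ?_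
  have h1 := (Complex.continuous_re.tendsto _).comp ((tendsto_pi_nhds.1 hlim) i)
  simp only [Pi.zero_apply, Complex.zero_re] at h1
  refine h1.congr fun k => ?_
  rw [Function.comp_apply, hpow, Complex.ofReal_re]

theorem Controllable.nonempty_input (hn : 1 ≤ n) (hAB : Controllable A B) : Nonempty (Fin m) := by
  by_contra hm
  rw [not_nonempty_iff] at hm
  unfold Controllable at hAB
  have := (of fun (i : Fin n) (p : Fin n × Fin m) => (A ^ (p.1 : ℕ) * B) i p.2).rank_le_card_width
  rw [hAB, Fintype.card_of_isEmpty] at this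
  omega

theorem isCouplingData_qMatrix (hn : 1 ≤ n) (hAB : Controllable A B) (hQ : Q.PosSemidef)
    (hγ : 0 < γ) (hμ : 1 ≤ μ) (hP : IsRiccatiSolution μ A B Q γ P) :
    IsCouplingData Q γ (qMatrix μ A B Q γ P) where
  posSemidef := hQ
  pos := hγ
  nonempty := hAB.nonempty_input hn
  isSymm := qMatrix_toBlocks₂₂_isSymm ((posSemidef_iff_real P).1 hP.1).1
  coercive := qMatrix_coercive hP.1
  factor := qMatrix_factor hP.1 hγ
  strict := by
    intro x hx
    obtain ⟨hs, hp⟩ := (posSemidef_iff_real P).1 hP.1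
    have hx' := hx
    rw [qMatrix_toBlocks₂₂_form] at hx'
    have hμ2 : 0 < μ ^ 2 := by positivity
    have h1 := hp (B *ᵥ gain (qMatrix μ A B Q γ P) *ᵥ x)
    -- Equality in coercivity makes (BKx)ᵀP(BKx) vanish; then H₂₂Kx = μ²BᵀPAx pairs to zero with Kx.
    have h2 : P *ᵥ (B *ᵥ gain (qMatrix μ A B Q γ P) *ᵥ x) = 0 :=
      mulVec_eq_zero_of_form_eq_zero hP.1 (by nlinarith)
    have h3 := qMatrix_coercive (μ := μ) (γ := γ) (A := A) (B := B) (Q := Q) hP.1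
      (gain (qMatrix μ A B Q γ P) *ᵥ x)
    have h4 : gain (qMatrix μ A B Q γ P) *ᵥ x ⬝ᵥ (qMatrix μ A B Q γ P).toBlocks₂₂ *ᵥ
        gain (qMatrix μ A B Q γ P) *ᵥ x = 0 := by
      rw [mulVec_mulVec x, ← qMatrix_factor hP.1 hγ, qMatrix_toBlocks₁₂_transpose hs, smul_mulVec,
        dotProduct_smul, transpose_mul_mul_form, dotProduct_mulVec_comm_of_isSymm hs, h2,
        dotProduct_zero, smul_zero]
    by_contra hK
    have := mul_pos hγ (dotProduct_self_pos_real hK)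
    linarith

/-- A positive level of the coupling form certifies the modewise Lyapunov inequality. -/
theorem posDef_modeDefect_of_couplingForm {H : Matrix (Fin n ⊕ Fin m) (Fin n ⊕ Fin m) ℝ}
    (hD : IsCouplingData Q γ H) {α β c : ℝ} {l : ℂ} (hα : 0 < α)
    (h : ∀ x u, 0 ≤ couplingForm Q H α β (c ^ 2 * γ * ‖l‖ ^ 2) x u)
    (hl : ‖1 - (c : ℂ) * l‖ ≤ β) : (modeDefect Q γ H c l).PosDef := by
  refine (posDef_iff_real _).2
    ⟨modeDefect_isSymm ((posSemidef_iff_real Q).1 hD.posSemidef).1 hD.isSymm c l, fun x hx => ?_⟩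
  -- This input minimizes the H₂₂ part and leaves -β²(Kx)ᵀH₂₂(Kx), where β ≥ |1 - cl|.
  have h1 := h x (-β • gain H *ᵥ x)
  rw [couplingForm_smul] at h1
  rw [modeDefect_form]
  have hxx := mul_pos hα (dotProduct_self_pos_real hx)
  have hKK := mul_nonneg hα.le (dotProduct_self_nonneg_real (gain H *ᵥ x))
  have hR := (mul_nonneg hD.pos.le (dotProduct_self_nonneg_real (gain H *ᵥ x))).trans
    (hD.coercive (gain H *ᵥ x))
  have hsq : ‖1 - (c : ℂ) * l‖ ^ 2 ≤ β ^ 2 := by gcongr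
  have h2 := mul_le_mul_of_nonneg_right hsq hR
  nlinarith [mul_nonneg (sq_nonneg β) hKK]

end Lyapunov

/-! ### The semidefinite program of the LQR problem -/

section LQRProgram

variable {n m : ℕ} {μ γ : ℝ} {A : Matrix (Fin n) (Fin n) ℝ} {B : Matrix (Fin n) (Fin m) ℝ}
  {Q P : Matrix (Fin n) (Fin n) ℝ}

/-- The form of the linear matrix inequality is the Bellman residual. -/
theorem lmiMatrix_form {H : Matrix (Fin n ⊕ Fin m) (Fin n ⊕ Fin m) ℝ} (hH : H.IsSymm)
    (x : Fin n → ℝ) (u v : Fin m → ℝ) :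
    Sum.elim (Sum.elim x u) v ⬝ᵥ lmiMatrix μ A B Q γ H *ᵥ Sum.elim (Sum.elim x u) v
      = x ⬝ᵥ Q *ᵥ x + γ * (u ⬝ᵥ u) + qForm H (μ • (A *ᵥ x + B *ᵥ u)) v - qForm H x u := by
  have hcols : fromCols A B *ᵥ Sum.elim x u = A *ᵥ x + B *ᵥ u := fromCols_mulVec_sumElim _ _ _ _
  have h12 : (Sum.elim x u) ⬝ᵥ (fromCols A B)ᵀ *ᵥ H.toBlocks₁₂ *ᵥ v
      = (A *ᵥ x + B *ᵥ u) ⬝ᵥ H.toBlocks₁₂ *ᵥ v := by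
    rw [dotProduct_mulVec, vecMul_transpose, hcols]
  have h21 : v ⬝ᵥ (H.toBlocks₁₂ᵀ * fromCols A B) *ᵥ Sum.elim x u
      = (A *ᵥ x + B *ᵥ u) ⬝ᵥ H.toBlocks₁₂ *ᵥ v := by
    rw [← mulVec_mulVec, hcols, dotProduct_transpose_mulVec]
  have h11 : Sum.elim x u ⬝ᵥ ((fromCols A B)ᵀ * H.toBlocks₁₁ * fromCols A B) *ᵥ Sum.elim x u
      = (A *ᵥ x + B *ᵥ u) ⬝ᵥ H.toBlocks₁₁ *ᵥ (A *ᵥ x + B *ᵥ u) := by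
    rw [transpose_mul_mul_form, hcols]
  have hcost : Sum.elim x u ⬝ᵥ fromBlocks Q 0 0 (γ • (1 : Matrix (Fin m) (Fin m) ℝ)) *ᵥ Sum.elim x u
      = x ⬝ᵥ Q *ᵥ x + γ * (u ⬝ᵥ u) := by
    rw [fromBlocks_mulVec, sumElim_dotProduct_sumElim]
    simp [smul_mulVec]
  rw [lmiMatrix, fromBlocks_mulVec, sumElim_dotProduct_sumElim]
  simp only [Sum.elim_comp_inl, Sum.elim_comp_inr]
  rw [add_mulVec, sub_mulVec, smul_mulVec, smul_mulVec, smul_mulVec, ← mulVec_mulVec v]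
  simp only [dotProduct_add, dotProduct_sub, dotProduct_smul, h11, h12, h21, hcost]
  rw [qForm_eq_blocks hH (μ • _), ← qForm]
  simp only [mulVec_smul, dotProduct_smul, smul_dotProduct, smul_eq_mul]
  ring

theorem valueBlock_form {H : Matrix (Fin n ⊕ Fin m) (Fin n ⊕ Fin m) ℝ} (hH : H.IsSymm)
    (W : Matrix (Fin n) (Fin n) ℝ) (x : Fin n → ℝ) (u : Fin m → ℝ) :
    Sum.elim x u ⬝ᵥ fromBlocks (H.toBlocks₁₁ - W) H.toBlocks₁₂ H.toBlocks₁₂ᵀ H.toBlocks₂₂ *ᵥ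
      Sum.elim x u = qForm H x u - x ⬝ᵥ W *ᵥ x := by
  rw [qForm_eq_blocks hH, fromBlocks_mulVec, sumElim_dotProduct_sumElim]
  simp only [Sum.elim_comp_inl, Sum.elim_comp_inr, dotProduct_add, sub_mulVec, dotProduct_sub,
    dotProduct_transpose_mulVec]
  ring

/-- Feasibility for the semidefinite program means that `W` is a lower bound for the Q-function of
`H` and that `H` satisfies the Bellman inequality. -/
theorem lqrFeasible_iff {H : Matrix (Fin n ⊕ Fin m) (Fin n ⊕ Fin m) ℝ} (hQ : Q.IsSymm)
    (W : Matrix (Fin n) (Fin n) ℝ) :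
    LQRFeasible μ A B Q γ H W ↔ H.IsSymm ∧ W.IsSymm ∧ (∀ x u, x ⬝ᵥ W *ᵥ x ≤ qForm H x u) ∧
      ∀ x u v, qForm H x u
        ≤ x ⬝ᵥ Q *ᵥ x + γ * (u ⬝ᵥ u) + qForm H (μ • (A *ᵥ x + B *ᵥ u)) v := by
  refine and_congr_right fun hH => ?_
  have hblocks := hH
  rw [← fromBlocks_toBlocks H, Matrix.isSymm_fromBlocks_iff] at hblocks
  obtain ⟨h11, -, -, h22⟩ := hblocks
  rw [posSemidef_iff_real, posSemidef_iff_real]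
  constructor
  · rintro ⟨⟨hs1, h1⟩, -, h2⟩
    refine ⟨?_, fun x u => ?_, fun x u v => ?_⟩
    · have := h11.sub (Matrix.isSymm_fromBlocks_iff.1 hs1).1
      rwa [sub_sub_cancel] at this
    · have := h1 (Sum.elim x u)
      rw [valueBlock_form hH] at this
      linarith
    · have := h2 (Sum.elim (Sum.elim x u) v)
      rw [lmiMatrix_form hH] at this
      linarith
  · rintro ⟨hW, h1, h2⟩
    refine ⟨⟨Matrix.isSymm_fromBlocks_iff.2 ⟨h11.sub hW, rfl, transpose_transpose _, h22⟩,
      fun z => ?_⟩, Matrix.isSymm_fromBlocks_iff.2 ⟨?_, ?_, ?_, h22⟩, fun z => ?_⟩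
    · rw [← Sum.elim_comp_inl_inr z, valueBlock_form hH]
      exact sub_nonneg.2 (h1 _ _)
    · refine (Matrix.IsSymm.sub ?_ hH).add
        (Matrix.isSymm_fromBlocks_iff.2 ⟨hQ, by simp, by simp, by simp [Matrix.IsSymm]⟩)
      rw [Matrix.IsSymm, transpose_smul, transpose_mul, transpose_mul, transpose_transpose, h11.eq,
        Matrix.mul_assoc]
    · rw [transpose_smul, transpose_mul, transpose_transpose]
    · rw [transpose_smul, transpose_mul, transpose_transpose]
    · rw [← Sum.elim_comp_inl_inr z, ← Sum.elim_comp_inl_inr (z ∘ Sum.inl), lmiMatrix_form hH]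
      exact sub_nonneg.2 (h2 _ _ _)

theorem qForm_qMatrix_bellman (hQ : Q.IsSymm) (hP : IsRiccatiSolution μ A B Q γ P) (hγ : 0 < γ)
    (x : Fin n → ℝ) (u : Fin m → ℝ) :
    qForm (qMatrix μ A B Q γ P) x u = x ⬝ᵥ Q *ᵥ x + γ * (u ⬝ᵥ u)
      + qForm (qMatrix μ A B Q γ P) (μ • (A *ᵥ x + B *ᵥ u))
        (-(gain (qMatrix μ A B Q γ P) *ᵥ (μ • (A *ᵥ x + B *ᵥ u)))) := by
  have hs := ((posSemidef_iff_real P).1 hP.1).1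
  rw [qForm_qMatrix_eq_square hQ hP hγ (μ • _), neg_add_cancel, qForm_qMatrix hQ hs]
  simp only [mulVec_zero, dotProduct_zero, mulVec_smul, dotProduct_smul, smul_dotProduct,
    smul_eq_mul]
  ring

theorem le_qForm_qMatrix (hQ : Q.IsSymm) (hP : IsRiccatiSolution μ A B Q γ P) (hγ : 0 < γ)
    (x : Fin n → ℝ) (u : Fin m → ℝ) : x ⬝ᵥ P *ᵥ x ≤ qForm (qMatrix μ A B Q γ P) x u := by
  rw [qForm_qMatrix_eq_square hQ hP hγ]
  have := (qMatrix_toBlocks₂₂_posDef (μ := μ) (A := A) (B := B) (Q := Q) hP.1 hγ).posSemidef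
  linarith [((posSemidef_iff_real _).1 this).2 (u + gain (qMatrix μ A B Q γ P) *ᵥ x)]

theorem lqrFeasible_qMatrix (hQ : Q.IsSymm) (hP : IsRiccatiSolution μ A B Q γ P) (hγ : 0 < γ) :
    LQRFeasible μ A B Q γ (qMatrix μ A B Q γ P) P := by
  have hs := ((posSemidef_iff_real P).1 hP.1).1
  refine (lqrFeasible_iff hQ P).2 ⟨qMatrix_isSymm hQ hs, hs, le_qForm_qMatrix hQ hP hγ,
    fun x u v => ?_⟩
  have h1 := le_qForm_qMatrix hQ hP hγ (μ • (A *ᵥ x + B *ᵥ u)) v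
  rw [qForm_qMatrix_bellman hQ hP hγ]
  have h2 := qForm_qMatrix_eq_square hQ hP hγ (μ • (A *ᵥ x + B *ᵥ u))
    (-(gain (qMatrix μ A B Q γ P) *ᵥ (μ • (A *ᵥ x + B *ᵥ u))))
  rw [neg_add_cancel, zero_dotProduct, add_zero] at h2
  linarith

theorem continuous_qForm_feedback (H : Matrix (Fin n ⊕ Fin m) (Fin n ⊕ Fin m) ℝ)
    (K : Matrix (Fin m) (Fin n) ℝ) : Continuous fun x : Fin n → ℝ => qForm H x (-(K *ᵥ x)) := by
  have h : Continuous fun x : Fin n → ℝ => (Sum.elim x (-(K *ᵥ x)) : Fin n ⊕ Fin m → ℝ) := by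
    refine continuous_pi fun i => ?_
    rcases i with i | i
    · exact continuous_apply i
    · exact (continuous_apply i).comp (by fun_prop : Continuous fun x : Fin n → ℝ => -(K *ᵥ x))
  unfold qForm
  fun_prop

/-- The Q-function of the Riccati solution dominates every solution of the Bellman inequality. -/
theorem qForm_le_qForm_qMatrix (hQ : Q.IsSymm) (hP : IsRiccatiSolution μ A B Q γ P) (hγ : 0 < γ)
    (hlyap : LyapunovIneq μ A B P (gain (qMatrix μ A B Q γ P)) 1 1)
    {H' : Matrix (Fin n ⊕ Fin m) (Fin n ⊕ Fin m) ℝ} {W' : Matrix (Fin n) (Fin n) ℝ}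
    (h : LQRFeasible μ A B Q γ H' W') (x : Fin n → ℝ) (u : Fin m → ℝ) :
    qForm H' x u ≤ qForm (qMatrix μ A B Q γ P) x u := by
  obtain ⟨-, -, -, hb⟩ := (lqrFeasible_iff hQ W').1 h
  set K := gain (qMatrix μ A B Q γ P) with hK
  set g : (Fin n → ℝ) → ℝ := fun y =>
    qForm (qMatrix μ A B Q γ P) y (-(K *ᵥ y)) - qForm H' y (-(K *ᵥ y)) with hg
  set F := μ • (A - B * K) with hF
  -- The Bellman equality for the Riccati Q-function minus the Bellman inequality for H', both with
  -- the next input given by -K.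
  have hstep : ∀ x u, g (μ • (A *ᵥ x + B *ᵥ u))
      ≤ qForm (qMatrix μ A B Q γ P) x u - qForm H' x u := by
    intro x u
    have h1 := qForm_qMatrix_bellman hQ hP hγ x u
    have h2 := hb x u (-(K *ᵥ (μ • (A *ᵥ x + B *ᵥ u))))
    simp only [hg]
    linarith
  have hloop : ∀ y, μ • (A *ᵥ y + B *ᵥ -(K *ᵥ y)) = F *ᵥ y := by
    intro y
    rw [hF, smul_mulVec, sub_mulVec, mulVec_neg, mulVec_mulVec, sub_eq_add_neg]
  have hiter : ∀ k y, g (F ^ k *ᵥ y) ≤ g y := by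
    intro k
    induction k with
    | zero => simp
    | succ k ih =>
      intro y
      refine le_trans ?_ (ih y)
      have := hstep (F ^ k *ᵥ y) (-(K *ᵥ F ^ k *ᵥ y))
      rwa [hloop, mulVec_mulVec, ← pow_succ'] at this
  have hg0 : g 0 = 0 := by simp [hg, qForm]
  have hcont : Continuous g :=
    (continuous_qForm_feedback _ K).sub (continuous_qForm_feedback _ K)
  -- The gap does not increase along the stable loop and tends to g 0 = 0.
  have hnonneg : ∀ y, 0 ≤ g y := by
    intro y
    have hlim := (hcont.tendsto 0).comp (tendsto_optimalLoop_pow hP hlyap y)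
    rw [hg0] at hlim
    exact le_of_tendsto' hlim fun k => hiter k y
  linarith [hnonneg (μ • (A *ᵥ x + B *ᵥ u)), hstep x u]

theorem form_le_of_lqrFeasible (hQ : Q.IsSymm) (hP : IsRiccatiSolution μ A B Q γ P) (hγ : 0 < γ)
    (hlyap : LyapunovIneq μ A B P (gain (qMatrix μ A B Q γ P)) 1 1)
    {H' : Matrix (Fin n ⊕ Fin m) (Fin n ⊕ Fin m) ℝ} {W' : Matrix (Fin n) (Fin n) ℝ}
    (h : LQRFeasible μ A B Q γ H' W') : (P - W').PosSemidef := by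
  have hs := ((posSemidef_iff_real P).1 hP.1).1
  obtain ⟨-, hW, hle, -⟩ := (lqrFeasible_iff hQ W').1 h
  refine (posSemidef_iff_real _).2 ⟨hs.sub hW, fun x => ?_⟩
  have h1 := hle x (-(gain (qMatrix μ A B Q γ P) *ᵥ x))
  have h2 := qForm_le_qForm_qMatrix hQ hP hγ hlyap h x (-(gain (qMatrix μ A B Q γ P) *ᵥ x))
  rw [qForm_qMatrix_eq_square hQ hP hγ, neg_add_cancel, zero_dotProduct, add_zero] at h2
  rw [sub_mulVec, dotProduct_sub]
  linarith

theorem lqrOptimal_qMatrix (hQ : Q.IsSymm) (hP : IsRiccatiSolution μ A B Q γ P) (hγ : 0 < γ)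
    (hlyap : LyapunovIneq μ A B P (gain (qMatrix μ A B Q γ P)) 1 1) :
    LQROptimal μ A B Q γ (qMatrix μ A B Q γ P) P := by
  refine ⟨lqrFeasible_qMatrix hQ hP hγ, fun H' W' h => ?_⟩
  have := (form_le_of_lqrFeasible hQ hP hγ hlyap h).trace_nonneg
  rw [trace_sub] at this
  linarith

theorem LQROptimal.eq_and_posSemidef (hQ : Q.IsSymm) (hP : IsRiccatiSolution μ A B Q γ P)
    (hγ : 0 < γ) (hlyap : LyapunovIneq μ A B P (gain (qMatrix μ A B Q γ P)) 1 1)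
    {H' : Matrix (Fin n ⊕ Fin m) (Fin n ⊕ Fin m) ℝ} {W' : Matrix (Fin n) (Fin n) ℝ}
    (h : LQROptimal μ A B Q γ H' W') :
    W' = P ∧ (qMatrix μ A B Q γ P - H').PosSemidef := by
  have hs := ((posSemidef_iff_real P).1 hP.1).1
  constructor
  · have hpsd := form_le_of_lqrFeasible hQ hP hγ hlyap h.1
    have h1 := hpsd.trace_nonneg
    have h2 := h.2 _ _ (lqrFeasible_qMatrix hQ hP hγ)
    have h3 : (P - W').trace = 0 := by
      refine le_antisymm ?_ h1
      rw [trace_sub]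
      linarith
    exact (sub_eq_zero.1 (hpsd.trace_eq_zero_iff.1 h3)).symm
  · refine (posSemidef_iff_real _).2 ⟨(qMatrix_isSymm hQ hs).sub h.1.1, fun z => ?_⟩
    have := qForm_le_qForm_qMatrix hQ hP hγ hlyap h.1 (z ∘ Sum.inl) (z ∘ Sum.inr)
    rw [qForm, qForm, Sum.elim_comp_inl_inr] at this
    rw [sub_mulVec, dotProduct_sub]
    linarith

end LQRProgram

/-! ### Stability of the modes -/

theorem spectralRadius_modeMatrix_lt {n m : ℕ} {μ : ℝ} (hμ : 0 < μ) {A : Matrix (Fin n) (Fin n) ℝ}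
    {B : Matrix (Fin n) (Fin m) ℝ} {K : Matrix (Fin m) (Fin n) ℝ} {c : ℝ} {l : ℂ}
    (h : ∀ (z : ℂ) v, v ≠ 0 → ((μ : ℂ) • modeMatrix A B K c l) *ᵥ v = z • v → ‖z‖ < 1) :
    spectralRadius ℂ (modeMatrix A B K c l) < ENNReal.ofReal μ⁻¹ := by
  refine spectralRadius_lt_ofReal (inv_pos.2 hμ) fun z v hv hz => ?_
  have h1 := h (μ * z) v hv (by rw [smul_mulVec, hz, smul_smul])
  rw [norm_mul, Complex.norm_real, Real.norm_of_nonneg hμ.le] at h1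
  rwa [← one_div, lt_div_iff₀ hμ, mul_comm]

end Consensus

theorem theorem5 {N n m : ℕ} (hN : 2 ≤ N) (hn : 1 ≤ n)
    -- the communication graph and its Laplacian eigenvalues other than `λ₁ = 0`
    (a : Matrix (Fin N) (Fin N) ℝ) (ha : ∀ i j, 0 ≤ a i j) (hspan : HasSpanningTree a)
    (lam : Fin (N - 1) → ℂ) (hlam : ListsModes (laplacian a) lam)
    -- the agents, the weights of the synthetic LQR problem and the consensus rate
    (A : Matrix (Fin n) (Fin n) ℝ) (B : Matrix (Fin n) (Fin m) ℝ) (hAB : Controllable A B)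
    (Q : Matrix (Fin n) (Fin n) ℝ) (hQ : Q.PosSemidef) (γ μ : ℝ) (hγ : 0 < γ) (hμ : 1 ≤ μ)
    -- the Q-function matrix of that problem
    (P : Matrix (Fin n) (Fin n) ℝ) (hP : IsRiccatiSolution μ A B Q γ P)
    (H : Matrix (Fin n ⊕ Fin m) (Fin n ⊕ Fin m) ℝ) (hH : H = qMatrix μ A B Q γ P)
    -- some coupling gain satisfies the modewise Lyapunov inequalities
    (hlyap : ∃ c : ℝ, 0 < c ∧ ∀ i, LyapunovIneq μ A B (lyapMatrix H) (gain H) c (lam i)) :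
    -- `H` is the optimal solution of the semidefinite program, the largest one if there are several
    (LQROptimal μ A B Q γ H (lyapMatrix H) ∧
      ∀ H' W', LQROptimal μ A B Q γ H' W' → W' = lyapMatrix H ∧ (H - H').PosSemidef) ∧
    -- the algorithm generates a sequence of iterates from every initialization
    (∀ p₀ : ℝ × ℝ × ℝ, ∃ x, x 0 = p₀ ∧ IsRun Q γ H lam x) ∧
    (∀ x : ℕ → ℝ × ℝ × ℝ, IsRun Q γ H lam x →
      -- the objective values do not decrease, and the iterates are feasible
      (∀ k, (x (k + 1)).1 ≤ (x (k + 2)).1) ∧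
      (Feasible Q γ H lam (x 0) → (x 0).1 ≤ (x 1).1) ∧
      (∀ k, Feasible Q γ H lam (x (k + 1))) ∧
      -- the objective values converge, so that the stopping test is met at last
      (∃ αlim : ℝ, Tendsto (fun k => (x k).1) atTop (𝓝 αlim)) ∧
      (∀ ε : ℝ, 0 < ε → ∃ k, |(x (k + 2)).1 - (x (k + 1)).1| ≤ ε) ∧
      -- every limit point is a stationary point of the non-convex problem
      (∀ p, MapClusterPt p atTop x → IsStationaryPoint Q γ H lam p) ∧
      -- the iterates are bounded, have limit points and converge to the stationary points; they
      -- converge to one stationary point if no subproblem at a limit point has a second solution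
      (gain H ≠ 0 → 0 ≤ (x 0).2.2 →
        Bornology.IsBounded (Set.range x) ∧
        (∃ p, MapClusterPt p atTop x) ∧
        Tendsto (fun k => Metric.infDist (x k) {p | IsStationaryPoint Q γ H lam p}) atTop (𝓝 0) ∧
        ((∀ p, MapClusterPt p atTop x → ∀ q, SubOptimal Q γ H lam p.2.2 q → q = p) →
          ∃ p, IsStationaryPoint Q γ H lam p ∧ Tendsto x atTop (𝓝 p))) ∧
      -- a limit point with positive objective value certifies consensus at rate `μ`
      (∀ p, MapClusterPt p atTop x → 0 < p.1 →
        (∀ i, LyapunovIneq μ A B (lyapMatrix H) (gain H) p.2.2 (lam i) ∧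
          spectralRadius ℂ (modeMatrix A B (gain H) p.2.2 (lam i)) < ENNReal.ofReal μ⁻¹) ∧
        ReachesConsensusAtRate μ a A B p.2.2 (gain H))) := by
  obtain ⟨M, rfl⟩ : ∃ M, N = M + 1 := ⟨N - 1, by omega⟩
  have hne : Nonempty (Fin (M + 1 - 1)) := ⟨⟨0, by omega⟩⟩
  have hre : ∀ i, 0 < (lam i).re := hlam.re_pos ha hspan
  have hlam0 : ∀ i, lam i ≠ 0 := fun i h0 => by
    have := hre i
    rw [h0, Complex.zero_re] at this
    exact lt_irrefl _ this
  have hQs := ((posSemidef_iff_real Q).1 hQ).1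
  have hD : IsCouplingData Q γ H := hH ▸ isCouplingData_qMatrix hn hAB hQ hγ hμ hP
  have hW : lyapMatrix H = P := hH ▸ lyapMatrix_qMatrix hP
  have hiff : ∀ c l, LyapunovIneq μ A B P (gain H) c l ↔ (modeDefect Q γ H c l).PosDef :=
    fun c l => hH ▸ lyapunovIneq_iff_posDef_modeDefect hP hγ c l
  rw [hW] at hlyap ⊢
  -- A single mode suffices here, and N ≥ 2 provides one.
  have hone : LyapunovIneq μ A B P (gain H) 1 1 := by
    obtain ⟨c, -, hc⟩ := hlyap
    exact (hiff 1 1).2 (posDef_modeDefect_one hQ hγ hD.isSymm ((hiff _ _).1 (hc hne.some)))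
  refine ⟨?_, fun p₀ => exists_isRun hD hlam0 p₀, fun x hx => ?_⟩
  · subst hH
    exact ⟨lqrOptimal_qMatrix hQs hP hγ hone, fun H' W' h => h.eq_and_posSemidef hQs hP hγ hone⟩
  obtain ⟨αlim, hαlim, -⟩ := hx.exists_tendsto hD hlam0
  have hstat : ∀ p, MapClusterPt p atTop x → IsStationaryPoint Q γ H lam p := fun p hp =>
    isStationaryPoint_of_subOptimal hD hlam0 (hx.subOptimal_of_mapClusterPt hD hlam0 hp).1
  refine ⟨fun k => hx.monotone hD hlam0 k.le_succ, hx.le_succ_of_feasible, hx.feasible hD hlam0, ⟨αlim, hαlim⟩,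
    fun ε hε => ?_, hstat, fun hK hc₀ => ?_, fun p hp hα => ?_⟩
  · have h1 := ((tendsto_add_atTop_iff_nat 2).2 hαlim).sub ((tendsto_add_atTop_iff_nat 1).2 hαlim)
    rw [sub_self] at h1
    have h2 := h1.abs
    rw [abs_zero] at h2
    exact ((h2.eventually_lt_const hε).mono fun k hk => hk.le).exists
  · have hb := hx.isBounded hre hD hK hc₀
    obtain ⟨p, -, -, -, hp⟩ := exists_mapClusterPt_comp_of_isBounded hb strictMono_id
    refine ⟨hb, ⟨p, hp⟩, tendsto_infDist_of_mapClusterPt_mem hb hstat, fun huniq => ?_⟩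
    obtain ⟨q, hq, hlim⟩ := hx.exists_tendsto_of_unique hre hD hc₀ hb huniq
    exact ⟨q, hstat q hq, hlim⟩
  · have hfeas := (subFeasible_iff hD hlam0 _ _).1 (hx.subOptimal_of_mapClusterPt hD hlam0 hp).1.1
    have hmode : ∀ i, LyapunovIneq μ A B P (gain H) p.2.2 (lam i) := fun i => by
      obtain ⟨h1, h2⟩ := hfeas i
      rw [show 2 * p.2.2 * p.2.2 - p.2.2 ^ 2 = p.2.2 ^ 2 by ring] at h1
      exact (hiff _ _).2 (posDef_modeDefect_of_couplingForm hD hα h1 h2)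
    have heig := fun i => norm_lt_one_of_lyapunov (posSemidef_map_ofReal hP.1) (hmode i)
    exact ⟨fun i => ⟨hmode i, spectralRadius_modeMatrix_lt (by linarith) (heig i)⟩,
      reachesConsensusAtRate hlam heig⟩
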